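/- Let $d\in\mathbb N$, $T>0$, and let $D=\mathbb R^d$ or $D=\mathbb T^d=\mathbb R^d/\mathbb Z^d$. Points of the phase space $\mathbb R^{d+1}$ are written $(v,p)$ with $v\in\mathbb R^d$, $p\in\mathbb R$, and $\langle\mu,g\rangle=\int g\,d\mu$. **Statistical solutions.** A statistical solution of the incompressible Euler equations on $[0,T]\times D$ is a family $\nu=(\nu^k)_{k\ge1}$ of measurable maps $\nu^k:(t,x_1,\dots,x_k)\mapsto\nu^k_{t,x_1,\dots,x_k}$ from $[0,T]\times D^k$ to the probability measures on $(\mathbb R^{d+1})^k$, with the following properties. 1. *Symmetry:* for each permutation $\sigma$ of $\{1,\dots,k\}$ and each $f\in C_0((\mathbb R^{d+1})^k)$, writing $x^\sigma=(x_{\sigma(1)},\dots,x_{\sigma(k)})$, one has $\int f(\xi^{\sigma^{-1}})\,d\nu^k_{t,x^\sigma}(\xi)=\int f\,d\nu^k_{t,x}$ for a.e. $(t,x)\in[0,T]\times D^k$. 2. *Consistency:* for each $g\in C_0((\mathbb R^{d+1})^{k-1})$, $\int g(\xi_1,\dots,\xi_{k-1})\,d\nu^k_{t,x_1,\dots,x_k}(\xi)=\langle\nu^{k-1}_{t,x_1,\dots,x_{k-1}},g\rangle$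 for a.e. $(t,x)\in[0,T]\times D^k$. 3. *Integrability:* there is $c>0$ with $\int_D\langle\nu^1_{t,x},|v|^2\rangle dx\le c$ for a.e. $t\in[0,T]$, and $\int_0^T\!\int_D\langle\nu^1_{t,x},|v|^3+|p|^{3/2}\rangle\,dx\,dt<\infty$. 4. *Diagonal continuity:* $\displaystyle\lim_{\varepsilon\to0}\int_0^T\!\!\int_D\frac1{|B_\varepsilon|}\int_{B_\varepsilon(x)}\langle\nu^2_{t,x,y},|v_1-v_2|^2+|v_1-v_2|^3+|p_1-p_2|^{3/2}\rangle\,dy\,dx\,dt=0$. 5. *Evolution:* for all $k\ge1$, $i_1,\dots,i_k\in\{1,\dots,d\}$ and $\phi\in C_c^\infty((0,T)\times D^k)$, $$\int_0^T\!\!\int_{D^k}\langle\nu^k,v_1^{i_1}\cdots v_k^{i_k}\rangle\,\partial_t\phi+\sum_{l=1}^k\langle\nu^k,v_l\,v_1^{i_1}\cdots v_k^{i_k}\rangle\cdot\nabla_{x_l}\phi+\sum_{l=1}^k\Big\langle\nu^k,p_l\prod_{j\ne l}v_j^{i_j}\Big\rangle\,\partial_{x_l^{i_l}}\phi\;dx\,dt=0,$$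 whenever all the moments that occur are locally integrable on $[0,T]\times D^k$ (for $k\le2$ they always are, by 3). 6. *Incompressibility:* for all $k\ge1$, $\phi\in C_c^\infty([0,\infty)\times D^k)$ and all continuous $\kappa:(\mathbb R^{d+1})^{k-1}\to\mathbb R$ such that $\langle\nu^k,|\kappa(\xi_1,\dots,\xi_{k-1})|\rangle<\infty$ a.e. on $[0,T]\times D^k$ and $\langle\nu^k,|\kappa(\xi_1,\dots,\xi_{k-1})|\,|v_k|\rangle$ is locally integrable on $[0,T]\times D^k$, $$\int_0^T\!\!\int_{D^k}\nabla_{x_k}\phi\cdot\langle\nu^k,\kappa(\xi_1,\dots,\xi_{k-1})\,v_k\rangle\,dx\,dt=0 .$$ **Mollifiers.** A mollifier is a rotationally symmetric, nonnegative $\rho\in C_c^\infty(\mathbb R^d)$ with unit mass and support in the closed unit ball; $\rho_\varepsilon(z)=\varepsilon^{-d}\rho(z/\varepsilon)$. **Theorem.** Let $\nu$ be a statistical solution of the incompressible Euler equations on $[0,T]\times D$. Then $\langle\nu^2,|v_1-v_2|^3\rangle$, $\langle\nu^1,|v|^2\rangle$ and $\langle\nu^1,\big||v|^2v^m+2pv^m\big|\rangle$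 ($m=1,\dots,d$) are locally integrable, and there is a distribution $\mathcal E(\nu)\in\mathcal D'((0,T)\times D)$ such that: (a) for every mollifier $\rho$ and every $\psi\in C_c^\infty((0,T)\times D)$, $$\mathcal E(\nu)(\psi)=-\frac12\lim_{\varepsilon\to0}\int_0^T\!\!\int_D\int_{B_\varepsilon(0)}\psi(t,x)\,\nabla\rho_\varepsilon(z)\cdot\langle\nu^2_{t,x,x-z},(v_1-v_2)|v_1-v_2|^2\rangle\,dz\,dx\,dt ;$$ in particular the limit exists and does not depend on $\rho$; (b) in the sense of distributions on $(0,T)\times D$, $$\partial_t\langle\nu^1_{t,x},|v|^2\rangle+\sum_{m=1}^d\partial_{x^m}\langle\nu^1_{t,x},|v|^2v^m+2pv^m\rangle=\mathcal E(\nu);$$ (c) if $$\liminf_{\varepsilon\to0}\frac1\varepsilon\int_0^T\!\!\int_D\frac1{|B_\varepsilon|}\int_{B_\varepsilon(x)}\langle\nu^2_{t,x,y},|v_1-v_2|^3\rangle\,dy\,dx\,dt=0,$$ then $\mathcal E(\nu)=0$. -/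

import Mathlib

open MeasureTheory ProbabilityTheory Filter Topology Set
open scoped ENNReal NNReal ContDiff ZeroAtInfty

noncomputable section

namespace StatEuler

/-- The Euclidean space `ℝ^d`. -/
abbrev Space (d : ℕ) : Type := EuclideanSpace ℝ (Fin d)

/-- The phase space `ℝ^(d+1)`: a point `ξ` is a pair `(v, p)` of a velocity and a pressure. -/
abbrev Phase (d : ℕ) : Type := Space d × ℝ

/-- The two spatial domains `D = ℝ^d` and `D = 𝕋^d = ℝ^d / ℤ^d`. Throughout, a function on
`𝕋^d` is the same thing as a `ℤ^d`-periodic function on `ℝ^d`, and the integral over `𝕋^d` is the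
integral over the unit cell `[0,1)^d`. -/
inductive SpaceDomain
  | wholeSpace
  | torus

namespace SpaceDomain

/-- `D.IsPeriod a`: translation by `a` is the identity of `D`; only `a = 0` on `ℝ^d`, and all
`a ∈ ℤ^d` on `𝕋^d`. -/
def IsPeriod {d : ℕ} : SpaceDomain → Space d → Prop
  | wholeSpace, a => a = 0
  | torus, a => ∀ i, ∃ n : ℤ, a i = n

/-- The set of representatives of the points of `D`: all of `ℝ^d`, respectively `[0,1)^d`. -/
def cell {d : ℕ} : SpaceDomain → Set (Space d)
  | wholeSpace => univ
  | torus => {x | ∀ i, x i ∈ Ico (0 : ℝ) 1}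

/-- `[0,T] × D^k`. -/
def box {d : ℕ} (D : SpaceDomain) (T : ℝ) (k : ℕ) : Set (ℝ × (Fin k → Space d)) :=
  Icc 0 T ×ˢ Set.pi univ (fun _ => D.cell)

end SpaceDomain

/-! ### Test functions and distributions -/

/-- `φ` vanishes outside `J × K`, where `K` is read modulo the periods of `D`. -/
def SupportedIn {d k : ℕ} (D : SpaceDomain) (J : Set ℝ) (K : Set (Fin k → Space d))
    (φ : ℝ × (Fin k → Space d) → ℝ) : Prop :=
  ∀ t x, φ (t, x) ≠ 0 →
    t ∈ J ∧ ∃ a : Fin k → Space d, (∀ l, D.IsPeriod (a l)) ∧ x + a ∈ K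

/-- The test functions `C_c^∞(I × D^k)`, for a set `I` of times. -/
def testFunctions {d : ℕ} (D : SpaceDomain) (I : Set ℝ) (k : ℕ) :
    Submodule ℝ (ℝ × (Fin k → Space d) → ℝ) where
  carrier := {φ | ContDiff ℝ ∞ φ ∧
    (∀ t x (a : Fin k → Space d), (∀ l, D.IsPeriod (a l)) → φ (t, x + a) = φ (t, x)) ∧
    ∃ J K, IsCompact J ∧ J ⊆ I ∧ IsCompact K ∧ SupportedIn D J K φ}
  zero_mem' := ⟨contDiff_const, fun _ _ _ _ => rfl, ∅, ∅, isCompact_empty, empty_subset _,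
    isCompact_empty, fun _ _ h => absurd rfl h⟩
  add_mem' := by
    rintro φ ψ ⟨hφ, pφ, J, K, hJ, hJI, hK, sφ⟩ ⟨hψ, pψ, J', K', hJ', hJI', hK', sψ⟩
    refine ⟨hφ.add hψ, fun t x a ha => ?_, J ∪ J', K ∪ K', hJ.union hJ', union_subset hJI hJI',
      hK.union hK', fun t x h => ?_⟩
    · simp only [Pi.add_apply, pφ t x a ha, pψ t x a ha]
    · by_cases h0 : φ (t, x) = 0
      · have h1 : ψ (t, x) ≠ 0 := fun h1 => h (by simp [h0, h1])
        obtain ⟨ht, a, ha, hx⟩ := sψ t x h1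
        exact ⟨Or.inr ht, a, ha, Or.inr hx⟩
      · obtain ⟨ht, a, ha, hx⟩ := sφ t x h0
        exact ⟨Or.inl ht, a, ha, Or.inl hx⟩
  smul_mem' := by
    rintro c φ ⟨hφ, pφ, J, K, hJ, hJI, hK, sφ⟩
    refine ⟨contDiff_const.smul hφ, fun t x a ha => ?_, J, K, hJ, hJI, hK, fun t x h => ?_⟩
    · simp only [Pi.smul_apply, pφ t x a ha]
    · exact sφ t x fun h0 => h (by simp [h0])

/-- A linear form on `C_c^∞((0,T) × D)` is a distribution if, on the test functions supported in a
fixed compact set, it is bounded by finitely many of the derivatives. -/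
def IsDistribution {d : ℕ} {D : SpaceDomain} {T : ℝ}
    (𝓔 : testFunctions (d := d) D (Ioo 0 T) 1 →ₗ[ℝ] ℝ) : Prop :=
  ∀ J K, IsCompact J → J ⊆ Ioo 0 T → IsCompact K →
    ∃ (N : ℕ) (C : ℝ), ∀ ψ : testFunctions (d := d) D (Ioo 0 T) 1, SupportedIn D J K ψ.1 →
      ∀ M : ℝ, (∀ n ≤ N, ∀ z, ‖iteratedFDeriv ℝ n ψ.1 z‖ ≤ M) → |𝓔 ψ| ≤ C * M

/-- `∂_t φ`. -/
def dt {d k : ℕ} (φ : ℝ × (Fin k → Space d) → ℝ) (z : ℝ × (Fin k → Space d)) : ℝ :=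
  fderiv ℝ φ z (1, 0)

/-- `∂φ / ∂x_l^m`, the derivative in the `m`-th coordinate of the `l`-th point. -/
def dx {d k : ℕ} (l : Fin k) (m : Fin d) (φ : ℝ × (Fin k → Space d) → ℝ)
    (z : ℝ × (Fin k → Space d)) : ℝ :=
  fderiv ℝ φ z (0, Pi.single l (EuclideanSpace.single m 1))

/-! ### Correlation measures -/

/-- A hierarchy `(ν^1, ν^2, …)`: `ν k (t, x)` is the law of the values (velocity and pressure) at
time `t` at the points `x_1, …, x_k`. Times outside `[0,T]` are never looked at, and `ν 0` lives on
a one-point space. -/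
abbrev Hierarchy (d : ℕ) : Type :=
  (k : ℕ) → Kernel (ℝ × (Fin k → Space d)) (Fin k → Phase d)

/-- The pairing `⟨ν_z, g⟩`. -/
def pairing {d k : ℕ} (ν : Kernel (ℝ × (Fin k → Space d)) (Fin k → Phase d))
    (g : (Fin k → Phase d) → ℝ) (z : ℝ × (Fin k → Space d)) : ℝ :=
  ∫ ξ, g ξ ∂(ν z)

/-- `⟨ν, |g|⟩` is integrable on `[0,T] × K` for every compact `K`. -/
def LocIntegrable {d k : ℕ} (T : ℝ) (ν : Kernel (ℝ × (Fin k → Space d)) (Fin k → Phase d))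
    (g : (Fin k → Phase d) → ℝ) : Prop :=
  ∀ K : Set (Fin k → Space d), IsCompact K →
    ∫⁻ z in Icc 0 T ×ˢ K, ∫⁻ ξ, ‖g ξ‖ₑ ∂(ν z) < ⊤

/-- `∫_0^T ∫_D ⨍_{B_ε(x)} ⟨ν^2_{t,x,y}, g⟩ dy dx dt`. -/
def diagonalMean {d : ℕ} (D : SpaceDomain) (T : ℝ) (ν : Hierarchy d)
    (g : (Fin 2 → Phase d) → ℝ≥0∞) (ε : ℝ) : ℝ≥0∞ :=
  ∫⁻ t in Icc 0 T, ∫⁻ x in D.cell, ⨍⁻ y in Metric.ball x ε, (∫⁻ ξ, g ξ ∂(ν 2 (t, ![x, y]))) ∂volume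

/-- Time-dependent correlation measures from `[0,T] × D` to `ℝ^(d+1)`, with the mixed integrability
and diagonal continuity for velocity and pressure. -/
structure IsCorrelationMeasure {d : ℕ} (D : SpaceDomain) (T : ℝ) (ν : Hierarchy d) : Prop where
  /-- Every `ν k (t, x)` is a probability measure. -/
  markov : ∀ k, IsMarkovKernel (ν k)
  /-- `ν k` is a function on `[0,T] × D^k`. -/
  periodic : ∀ k t (x a : Fin k → Space d), (∀ l, D.IsPeriod (a l)) →
    ν k (t, x + a) = ν k (t, x)
  symmetric : ∀ k (σ : Equiv.Perm (Fin k)) (f : C₀(Fin k → Phase d, ℝ)),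
    ∀ᵐ z ∂volume.restrict (D.box T k),
      ∫ ξ, f (ξ ∘ ⇑σ.symm) ∂(ν k (z.1, z.2 ∘ ⇑σ)) = ∫ ξ, f ξ ∂(ν k z)
  consistent : ∀ k (g : C₀(Fin k → Phase d, ℝ)),
    ∀ᵐ z ∂volume.restrict (D.box T (k + 1)),
      ∫ ξ, g (Fin.init ξ) ∂(ν (k + 1) z) = ∫ ξ, g ξ ∂(ν k (z.1, Fin.init z.2))
  energy_bound : ∃ c : ℝ≥0, ∀ᵐ t ∂volume.restrict (Icc 0 T),
    ∫⁻ x in D.cell, ∫⁻ ξ, ‖(ξ 0).1‖ₑ ^ 2 ∂(ν 1 (t, ![x])) ≤ c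
  cubic_bound : ∫⁻ t in Icc 0 T, ∫⁻ x in D.cell,
    ∫⁻ ξ, (‖(ξ 0).1‖ₑ ^ 3 + ‖(ξ 0).2‖ₑ ^ (3 / 2 : ℝ)) ∂(ν 1 (t, ![x])) < ⊤
  diagonal_continuity :
    Tendsto (diagonalMean D T ν fun ξ => ‖(ξ 0).1 - (ξ 1).1‖ₑ ^ 2 + ‖(ξ 0).1 - (ξ 1).1‖ₑ ^ 3 +
      ‖(ξ 0).2 - (ξ 1).2‖ₑ ^ (3 / 2 : ℝ)) (𝓝[>] 0) (𝓝 0)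

/-! ### Statistical solutions -/

/-- `v_1^{i_1} ⋯ v_k^{i_k}`. -/
def velProd {d k : ℕ} (i : Fin k → Fin d) (ξ : Fin k → Phase d) : ℝ :=
  ∏ j, (ξ j).1 (i j)

/-- `v_1^{i_1} ⋯ p_l ⋯ v_k^{i_k}`, with `p_l` in place of the `l`-th velocity factor. -/
def pressProd {d k : ℕ} (i : Fin k → Fin d) (l : Fin k) (ξ : Fin k → Phase d) : ℝ :=
  (ξ l).2 * ∏ j ∈ Finset.univ.erase l, (ξ j).1 (i j)

/-- The integrand of the evolution equation of `ν^k`, tested with `φ`. -/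
def momentIntegrand {d k : ℕ} (ν : Kernel (ℝ × (Fin k → Space d)) (Fin k → Phase d))
    (i : Fin k → Fin d) (φ : ℝ × (Fin k → Space d) → ℝ) (z : ℝ × (Fin k → Space d)) : ℝ :=
  pairing ν (velProd i) z * dt φ z
    + ∑ l, ∑ m, pairing ν (fun ξ => (ξ l).1 m * velProd i ξ) z * dx l m φ z
    + ∑ l, pairing ν (pressProd i l) z * dx l (i l) φ z

/-- Statistical solutions of the incompressible Euler equations on `[0,T] × D`. The moments that
occur in the equations for `k ≥ 3`, and the general observables `κ` in the divergence constraint,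
need not be integrable under the assumptions on a correlation measure; each identity is required
whenever its integrals exist. -/
structure IsStatisticalSolution {d : ℕ} (D : SpaceDomain) (T : ℝ) (ν : Hierarchy d) : Prop
    extends IsCorrelationMeasure D T ν where
  evolution : ∀ k, 1 ≤ k → ∀ i : Fin k → Fin d,
    LocIntegrable T (ν k) (velProd i) →
    (∀ l m, LocIntegrable T (ν k) fun ξ => (ξ l).1 m * velProd i ξ) →
    (∀ l, LocIntegrable T (ν k) (pressProd i l)) →
    ∀ φ ∈ testFunctions D (Ioo 0 T) k, ∫ z in D.box T k, momentIntegrand (ν k) i φ z = 0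
  divergence_free : ∀ k (κ : (Fin k → Phase d) → ℝ), Continuous κ →
    (∀ᵐ z ∂volume.restrict (D.box T k), ∫⁻ ξ, ‖κ ξ‖ₑ ∂(ν k z) < ⊤) →
    (∀ m, LocIntegrable T (ν (k + 1)) fun ξ => κ (Fin.init ξ) * (ξ (Fin.last k)).1 m) →
    ∀ φ ∈ testFunctions D univ (k + 1),
      ∫ z in D.box T (k + 1), ∑ m, dx (Fin.last k) m φ z *
        pairing (ν (k + 1)) (fun ξ => κ (Fin.init ξ) * (ξ (Fin.last k)).1 m) z = 0

/-! ### Energy -/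

/-- Rotationally symmetric mollifiers, supported in the unit ball. -/
structure IsMollifier {d : ℕ} (ρ : Space d → ℝ) : Prop where
  smooth : ContDiff ℝ ∞ ρ
  nonneg : ∀ z, 0 ≤ ρ z
  rotation_symmetric : ∀ z w, ‖z‖ = ‖w‖ → ρ z = ρ w
  support : tsupport ρ ⊆ Metric.closedBall 0 1
  mass : ∫ z, ρ z = 1

/-- `ρ_ε(z) = ε^{-d} ρ(z / ε)`. -/
def rescale {d : ℕ} (ρ : Space d → ℝ) (ε : ℝ) (z : Space d) : ℝ :=
  (ε ^ d)⁻¹ * ρ (ε⁻¹ • z)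

/-- `-½ ∫_0^T ∫_D ∫_{B_ε(0)} ψ(t,x) ∇ρ_ε(z) · ⟨ν^2_{t,x,x-z}, (v_1 - v_2)|v_1 - v_2|^2⟩ dz dx dt`. -/
def dissipation {d : ℕ} (D : SpaceDomain) (T : ℝ) (ν : Hierarchy d) (ρ : Space d → ℝ)
    (ψ : ℝ × (Fin 1 → Space d) → ℝ) (ε : ℝ) : ℝ :=
  -(1 / 2) * ∫ t in Icc 0 T, ∫ x in D.cell, ∫ z in Metric.ball 0 ε,
    ψ (t, ![x]) * inner ℝ (gradient (rescale ρ ε) z)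
      (∫ ξ, ‖(ξ 0).1 - (ξ 1).1‖ ^ 2 • ((ξ 0).1 - (ξ 1).1) ∂(ν 2 (t, ![x, x - z])))

/-- The energy density `|v|^2`. -/
def energy {d : ℕ} (ξ : Fin 1 → Phase d) : ℝ := ‖(ξ 0).1‖ ^ 2

/-- The `m`-th component `|v|^2 v^m + 2 p v^m` of the energy flux. -/
def flux {d : ℕ} (m : Fin d) (ξ : Fin 1 → Phase d) : ℝ :=
  ‖(ξ 0).1‖ ^ 2 * (ξ 0).1 m + 2 * (ξ 0).2 * (ξ 0).1 m

end StatEuler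

end

open StatEuler

noncomputable section

namespace StatEuler

/-! ### Periods and periodization -/

namespace SpaceDomain

variable {d : ℕ}

/-! The argument is that of Duchon and Robert, carried out for two-point correlation measures. Write
`v₁, p₁` for the values at `x` and `v₂, p₂` for the values at `y = x - z`, and put `w = ρ_ε`. Expand
`|v₁ - v₂|² (v₁ - v₂) = |v₁|² v₁ - |v₁|² v₂ + |v₂|² v₁ - |v₂|² v₂ - 2 (v₁·v₂)(v₁ - v₂)` and
integrate each term against `ψ(t,x) ∇w(z)`. The first term depends on `x` alone, and `∫ ∇w = 0`
removes it. The second vanishes because the flow is divergence free in `y`. The third becomes an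
integral against `∇ψ` because the flow is divergence free in `x`. The fourth depends on `y` alone,
so integration by parts in `z` moves the derivative to `ψ`. For the last one, the evolution equation
of `ν²`, with equal indices `j` summed over `j` and test function `ψ(t,x) w(x - y)`, trades the
mixed cubic term for `∂_t ψ`, `∇ψ` and pressure terms, and the divergence constraint leaves only
`∇ψ` in the pressure terms.

The outcome is the exact identity `sum_jointIntegral_diff`: the cubic increment tested with `ψ ∇w`
equals the integral of `2 ∂_tψ v₁·v₂ + ∇ψ · (2 (v₁·v₂) v₁ + 2 p₁ v₂ + 2 p₂ v₁ + |v₂|² v₂ - |v₂|²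
v₁)` against `w`. No derivative of `w` is left on the right. Diagonal continuity and Hölder's
inequality therefore allow `v₂ → v₁`, `p₂ → p₁` (`tendsto_jointIntegral`), and the limit is twice
`energyBalance`, namely `∂_tψ |v|² + ∇ψ · (|v|² v + 2 p v)` integrated against `ν¹`. This gives
existence of the limit, its independence of `ρ` and the energy equation at once, with `𝓔 =
-energyBalance`, a distribution of order one. Part (c) follows from `|∇ρ_ε| ≤ C ε^{-1} |B_ε|^{-1}`
on `B_ε`.

Two technical devices support this. On the torus the cutoff `w` is periodized, and unfolding turns
integrals over `D × D` into integrals over `D × ℝ^d` in the variables `(x, z)`; all of them are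
expressed by `jointIntegral`. Symmetry and consistency, assumed for one test function at a time, are
upgraded to equalities of measures at almost every point by `kernel_ae_eq_of_integral_eq`. -/

/-- The group of periods of `D`. -/
def periods (D : SpaceDomain) : AddSubgroup (Space d) where
  carrier := {a | D.IsPeriod a}
  zero_mem' := by
    cases D
    · exact rfl
    · exact fun i => ⟨0, by simp⟩
  add_mem' := by
    intro a b ha hb
    cases D
    · change a + b = 0
      rw [show a = 0 from ha, show b = 0 from hb, add_zero]
    · intro i
      obtain ⟨m, hm⟩ := ha i
      obtain ⟨n, hn⟩ := hb i
      exact ⟨m + n, by simp [hm, hn]⟩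
  neg_mem' := by
    intro a ha
    cases D
    · change -a = 0
      rw [show a = 0 from ha, neg_zero]
    · intro i
      obtain ⟨m, hm⟩ := ha i
      exact ⟨-m, by simp [hm]⟩

/-- A bounded set contains only finitely many periods. -/
lemma finite_periods (D : SpaceDomain) (R : ℝ) :
    {a : D.periods (d := d) | ‖(a : Space d)‖ ≤ R}.Finite := by
  refine Finite.of_finite_image (f := ((↑) : D.periods (d := d) → Space d)) ?_
    Subtype.val_injective.injOn
  cases D
  · refine (finite_singleton (0 : Space d)).subset ?_
    rintro _ ⟨a, -, rfl⟩
    exact a.2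
  · have hfin : (Set.pi univ fun _ : Fin d => Icc (-⌈R⌉) ⌈R⌉).Finite :=
      Set.Finite.pi fun _ => finite_Icc _ _
    refine (hfin.image fun n : Fin d → ℤ =>
      (WithLp.toLp 2 fun i => (n i : ℝ) : Space d)).subset ?_
    rintro _ ⟨a, ha, rfl⟩
    choose n hn using a.2
    refine ⟨n, fun i _ => ?_, ?_⟩
    · have h1 : |(n i : ℝ)| ≤ R := by
        rw [← hn i, ← Real.norm_eq_abs]
        exact (PiLp.norm_apply_le _ i).trans ha
      have h2 := abs_le.1 (h1.trans (Int.le_ceil R))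
      exact ⟨by exact_mod_cast h2.1, by exact_mod_cast h2.2⟩
    · ext i
      exact (hn i).symm

instance (D : SpaceDomain) : Countable (D.periods (d := d)) := by
  have h : (⋃ n : ℕ, {a : D.periods (d := d) | ‖(a : Space d)‖ ≤ n}) = univ := by
    refine eq_univ_of_forall fun a => mem_iUnion.2 ?_
    exact exists_nat_ge ‖(a : Space d)‖
  rw [← countable_univ_iff, ← h]
  exact countable_iUnion fun n => (D.finite_periods n).countable

lemma measurableSet_cell (D : SpaceDomain) : MeasurableSet (D.cell (d := d)) := by
  cases D
  · exact MeasurableSet.univ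
  · have : (torus.cell : Set (Space d)) = ⋂ i, (fun x : Space d => x i) ⁻¹' Ico 0 1 := by
      ext x; simp [cell]
    rw [this]
    exact MeasurableSet.iInter fun i => measurableSet_Ico.preimage (by fun_prop)

/-- On the torus the only integer vector that moves `x` into `[0,1)^d` is the negative of its
componentwise floor; on the whole space the group is trivial. -/
lemma isAddFundamentalDomain (D : SpaceDomain) :
    IsAddFundamentalDomain (D.periods (d := d)) (D.cell (d := d)) volume := by
  refine IsAddFundamentalDomain.mk' D.measurableSet_cell.nullMeasurableSet fun x => ?_
  cases D
  · refine ⟨0, trivial, fun g _ => Subtype.ext g.2⟩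
  · refine ⟨⟨WithLp.toLp 2 fun i => ((-⌊x i⌋ : ℤ) : ℝ), fun i => ⟨-⌊x i⌋, rfl⟩⟩, fun i => ?_,
      fun g hg => ?_⟩
    · simp only [AddSubgroup.vadd_def, vadd_eq_add, PiLp.add_apply]
      constructor
      · push_cast; linarith [Int.floor_le (x i)]
      · push_cast; linarith [Int.lt_floor_add_one (x i)]
    · ext i
      obtain ⟨n, hn⟩ := g.2 i
      have h : (g : Space d) i + x i ∈ Ico (0 : ℝ) 1 := hg i
      rw [hn] at h
      change (g : Space d) i = ((-⌊x i⌋ : ℤ) : ℝ)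
      rw [hn]
      congr 1
      have : ⌊x i⌋ = -n := by
        rw [Int.floor_eq_iff]
        push_cast
        exact ⟨by linarith [h.1], by linarith [h.2]⟩
      omega

/-- Lebesgue measure on `D`. -/
def vol (D : SpaceDomain) : Measure (Space d) := volume.restrict D.cell

instance (D : SpaceDomain) : SigmaFinite (D.vol (d := d)) := by unfold vol; infer_instance

lemma lintegral_eq_tsum_vol (D : SpaceDomain) (f : Space d → ℝ≥0∞) :
    ∫⁻ x, f x = ∑' a : D.periods (d := d), ∫⁻ x, f ((a : Space d) + x) ∂D.vol :=
  D.isAddFundamentalDomain.lintegral_eq_tsum'' f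

lemma integral_eq_tsum_vol (D : SpaceDomain) (f : Space d → ℝ) (hf : Integrable f) :
    ∫ x, f x = ∑' a : D.periods (d := d), ∫ x, f ((a : Space d) + x) ∂D.vol :=
  D.isAddFundamentalDomain.integral_eq_tsum'' f hf

open scoped Pointwise in
/-- A translate of a fundamental domain is a fundamental domain. -/
lemma lintegral_vol_add_right (D : SpaceDomain) {f : Space d → ℝ≥0∞}
    (hp : ∀ a ∈ D.periods (d := d), ∀ x, f (x + a) = f x) (c : Space d) :
    ∫⁻ x, f (x + c) ∂D.vol = ∫⁻ x, f x ∂D.vol := by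
  have h1 := D.isAddFundamentalDomain (d := d)
  have h2 : IsAddFundamentalDomain (D.periods (d := d)) (c +ᵥ D.cell (d := d)) volume :=
    h1.vadd_of_comm c
  have h3 := h1.setLIntegral_eq h2 f fun g x => by
    rw [AddSubgroup.vadd_def, vadd_eq_add, add_comm]
    exact hp _ g.2 x
  rw [vol, h3]
  have h4 : MeasurePreserving (fun x : Space d => x + c) volume volume :=
    measurePreserving_add_right volume c
  have h5 := h4.setLIntegral_comp_emb (measurableEmbedding_addRight c) f D.cell
  rw [h5, ← image_vadd]
  simp only [vadd_eq_add, add_comm]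

end SpaceDomain

variable {d : ℕ}

/-- The periodization of a function on `ℝ^d`. -/
def periodize (D : SpaceDomain) (f : Space d → ℝ) (x : Space d) : ℝ :=
  ∑' a : D.periods (d := d), f (a + x)

lemma periodize_add (D : SpaceDomain) (f : Space d → ℝ) {a : Space d}
    (ha : a ∈ D.periods) (x : Space d) : periodize D f (x + a) = periodize D f x := by
  unfold periodize
  rw [← (Equiv.addRight (⟨a, ha⟩ : D.periods (d := d))).tsum_eq fun b : D.periods (d := d) =>
    f (b + x)]
  refine tsum_congr fun b => ?_
  simp only [Equiv.coe_addRight, AddSubgroup.coe_add]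
  congr 1
  abel

/-- On a bounded set, a periodization is a finite sum. -/
lemma periodize_eq_sum (D : SpaceDomain) {f : Space d → ℝ} {r : ℝ}
    (hf : ∀ x, f x ≠ 0 → ‖x‖ ≤ r) {R : ℝ} {x : Space d} (hx : ‖x‖ ≤ R) :
    periodize D f x = ∑ a ∈ (D.finite_periods (d := d) (r + R)).toFinset, f (a + x) := by
  refine tsum_eq_sum fun a ha => ?_
  by_contra h
  refine ha ?_
  rw [Finite.mem_toFinset, mem_ofPred_eq]
  calc ‖(a : Space d)‖ = ‖(a + x) - x‖ := by rw [add_sub_cancel_right]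
    _ ≤ ‖(a : Space d) + x‖ + ‖x‖ := norm_sub_le _ _
    _ ≤ r + R := add_le_add (hf _ h) hx

/-- One finite set of periods serves all points of the unit ball around `x`, so continuity,
smoothness and derivatives can be read off term by term. -/
lemma periodize_eventuallyEq (D : SpaceDomain) {f : Space d → ℝ} {r : ℝ}
    (hf : ∀ x, f x ≠ 0 → ‖x‖ ≤ r) (x : Space d) :
    periodize D f =ᶠ[𝓝 x] fun y =>
      ∑ a ∈ (D.finite_periods (d := d) (r + (‖x‖ + 1))).toFinset, f (a + y) := by
  filter_upwards [Metric.ball_mem_nhds x one_pos] with y hy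
  refine periodize_eq_sum D hf ?_
  have h1 : ‖y - x‖ < 1 := by simpa [dist_eq_norm] using hy
  have h2 := norm_add_le (y - x) x
  rw [sub_add_cancel] at h2
  linarith

lemma contDiff_periodize (D : SpaceDomain) {f : Space d → ℝ} {r : ℝ}
    (hf : ∀ x, f x ≠ 0 → ‖x‖ ≤ r) (hs : ContDiff ℝ ∞ f) : ContDiff ℝ ∞ (periodize D f) := by
  rw [contDiff_iff_contDiffAt]
  intro x
  refine ContDiffAt.congr_of_eventuallyEq ?_ (periodize_eventuallyEq D hf x)
  exact ContDiff.contDiffAt <| ContDiff.sum fun a _ => hs.comp (contDiff_const.add contDiff_id)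

lemma continuous_periodize (D : SpaceDomain) {f : Space d → ℝ} {r : ℝ}
    (hf : ∀ x, f x ≠ 0 → ‖x‖ ≤ r) (hs : Continuous f) : Continuous (periodize D f) := by
  rw [continuous_iff_continuousAt]
  intro x
  refine ContinuousAt.congr ?_ (periodize_eventuallyEq D hf x).symm
  exact Continuous.continuousAt (by fun_prop)

lemma eq_zero_of_fderiv_ne {f : Space d → ℝ} {r : ℝ} (hf : ∀ x, f x ≠ 0 → ‖x‖ ≤ r) (x : Space d)
    (hx : fderiv ℝ f x ≠ 0) : ‖x‖ ≤ r := by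
  by_contra h
  refine hx ?_
  have : f =ᶠ[𝓝 x] fun _ => 0 := by
    filter_upwards [(isOpen_lt continuous_const continuous_norm).mem_nhds (not_le.1 h)] with y hy
    by_contra h'
    exact absurd (hf y h') (not_le.2 hy)
  rw [this.fderiv_eq, fderiv_const_apply]

lemma fderiv_periodize (D : SpaceDomain) {f : Space d → ℝ} {r : ℝ}
    (hf : ∀ x, f x ≠ 0 → ‖x‖ ≤ r) (hs : ContDiff ℝ ∞ f) (x v : Space d) :
    fderiv ℝ (periodize D f) x v = periodize D (fun y => fderiv ℝ f y v) x := by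
  have hd : Differentiable ℝ f := hs.differentiable (by simp)
  rw [(periodize_eventuallyEq D hf x).fderiv_eq, fderiv_fun_sum fun a _ => by fun_prop, _root_.sum_apply,
    periodize_eq_sum D (r := r) (R := ‖x‖ + 1) (fun y hy => eq_zero_of_fderiv_ne hf y fun h =>
      hy (by simp [h])) (by linarith)]
  refine Finset.sum_congr rfl fun a _ => ?_
  rw [fderiv_comp_add_left]

/-- The unfolding of an integral against a periodization. -/
lemma lintegral_unfold (D : SpaceDomain) {F : Space d → ℝ≥0∞} (hF : Measurable F)
    (hp : ∀ a ∈ D.periods (d := d), ∀ x, F (x + a) = F x) {w : Space d → ℝ≥0∞} (hw : Measurable w)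
    (x : Space d) :
    ∫⁻ y, F y * ∑' a : D.periods (d := d), w (a + (x - y)) ∂D.vol = ∫⁻ z, F (x - z) * w z := by
  have h1 : ∫⁻ z, F (x - z) * w z = ∫⁻ y, F y * w (x - y) := by
    rw [← lintegral_sub_left_eq_self _ x]
    simp
  rw [h1, D.lintegral_eq_tsum_vol]
  simp_rw [← ENNReal.tsum_mul_left]
  rw [lintegral_tsum fun a => by fun_prop,
    ← (Equiv.neg (D.periods (d := d))).tsum_eq]
  refine tsum_congr fun a => lintegral_congr fun y => ?_
  rw [add_comm (a : Space d) y, hp _ a.2]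
  simp only [Equiv.neg_apply, AddSubgroup.coe_neg]
  congr 2
  abel

/-- The sum over periods and the integral over a cell may be exchanged because the absolute version
unfolds to the integral of `|F(x - z) w(z)|` over `ℝ^d`, which is finite by `hi`. -/
lemma integral_unfold (D : SpaceDomain) {F : Space d → ℝ} (hF : Measurable F)
    (hp : ∀ a ∈ D.periods (d := d), ∀ x, F (x + a) = F x) {w : Space d → ℝ} (hw : Measurable w)
    (x : Space d) (hi : Integrable fun z => F (x - z) * w z) :
    ∫ y, F y * periodize D w (x - y) ∂D.vol = ∫ z, F (x - z) * w z := by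
  have h1 : ∫ z, F (x - z) * w z = ∫ y, F y * w (x - y) := by
    rw [← integral_sub_left_eq_self _ volume x]
    simp
  have h2 : Integrable fun y => F y * w (x - y) := by
    have := hi.comp_sub_left x
    simpa using this
  have h3 : ∀ (a : D.periods (d := d)) y, F (a + y) * w (x - (a + y))
      = F y * w (((-a : D.periods (d := d)) : Space d) + (x - y)) := fun a y => by
    rw [add_comm (a : Space d) y, hp _ a.2]
    simp only [AddSubgroup.coe_neg]
    congr 2
    abel
  rw [h1, D.integral_eq_tsum_vol _ h2]
  simp_rw [periodize, ← tsum_mul_left]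
  rw [← (Equiv.neg (D.periods (d := d))).tsum_eq]
  rw [integral_tsum]
  · refine tsum_congr fun a => ?_
    simp only [Equiv.neg_apply, h3, neg_neg]
  · intro a
    exact Measurable.aestronglyMeasurable (by fun_prop)
  · rw [← (Equiv.neg (D.periods (d := d))).tsum_eq]
    simp only [Equiv.neg_apply, ← h3]
    rw [← D.lintegral_eq_tsum_vol fun y => ‖F y * w (x - y)‖ₑ]
    exact h2.2.ne

/-- The integral of a periodic function over a ball is controlled by the integral over a cell. -/
lemma exists_lintegral_ball_le (D : SpaceDomain) (d : ℕ) (R : ℝ) :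
    ∃ N : ℕ, ∀ f : Space d → ℝ≥0∞, Measurable f →
      (∀ a ∈ D.periods (d := d), ∀ x, f (x + a) = f x) →
      ∫⁻ x in Metric.closedBall 0 R, f x ≤ N * ∫⁻ x, f x ∂D.vol := by
  -- `S` contains every period whose translate of the cell meets the ball. It is finite because the
  -- cell is bounded on the torus, and because `0` is the only period on the whole space. Its
  -- cardinality is the constant `N`.
  obtain ⟨S, hS⟩ : ∃ S : Finset (D.periods (d := d)),
      ∀ a : D.periods (d := d), ∀ x ∈ D.cell (d := d),
      ‖(a : Space d) + x‖ ≤ R → a ∈ S := by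
    cases D
    · refine ⟨{0}, fun a _ _ _ => ?_⟩
      rw [Finset.mem_singleton]
      exact Subtype.ext a.2
    · obtain ⟨r, hr⟩ : ∃ r, ∀ x ∈ SpaceDomain.torus.cell (d := d), ‖x‖ ≤ r := by
        refine ⟨√d, fun x hx => ?_⟩
        rw [EuclideanSpace.norm_eq]
        refine Real.sqrt_le_sqrt ?_
        calc ∑ i, ‖x i‖ ^ 2 ≤ ∑ i : Fin d, (1 : ℝ) := Finset.sum_le_sum fun i _ => by
              have h := hx i
              rw [Real.norm_eq_abs, sq_abs]
              nlinarith [h.1, h.2]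
          _ = d := by simp
      refine ⟨(SpaceDomain.torus.finite_periods (d := d) (R + r)).toFinset, fun a x hx h => ?_⟩
      rw [Finite.mem_toFinset, mem_ofPred_eq]
      calc ‖(a : Space d)‖ = ‖(a + x) - x‖ := by rw [add_sub_cancel_right]
        _ ≤ ‖(a : Space d) + x‖ + ‖x‖ := norm_sub_le _ _
        _ ≤ R + r := add_le_add h (hr x hx)
  refine ⟨S.card, fun f hf hp => ?_⟩
  rw [← lintegral_indicator Metric.isClosed_closedBall.measurableSet, D.lintegral_eq_tsum_vol]
  calc ∑' a : D.periods (d := d), ∫⁻ x, (Metric.closedBall 0 R).indicator f ((a : Space d) + x) ∂D.vol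
      ≤ ∑' a : D.periods (d := d), (S : Set (D.periods (d := d))).indicator
          (fun _ => ∫⁻ x, f x ∂D.vol) a := by
        refine ENNReal.tsum_le_tsum fun a => ?_
        by_cases ha : a ∈ S
        · rw [indicator_of_mem (by exact_mod_cast ha)]
          refine lintegral_mono fun x => (indicator_le_self _ _ _).trans ?_
          rw [add_comm, hp _ a.2]
        · rw [indicator_of_notMem (by exact_mod_cast ha), SpaceDomain.vol]
          refine le_of_eq ?_
          refine (setLIntegral_congr_fun (g := fun _ => 0) D.measurableSet_cell ?_).trans
            lintegral_zero
          intro x hx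
          refine indicator_of_notMem (fun h => ha (hS a x hx ?_)) _
          simpa using h
    _ = S.card * ∫⁻ x, f x ∂D.vol := by
        rw [tsum_eq_sum (s := S) fun a ha => indicator_of_notMem (by exact_mod_cast ha) _]
        rw [Finset.sum_congr rfl fun a ha => indicator_of_mem (by exact_mod_cast ha) _]
        simp

/-! ### Kernels determined by test functions -/

-- The exceptional null set in the hypothesis depends on `f`, so a fixed `z` cannot be tested
-- against all `f` directly. Integrating over an arbitrary measurable set `s` of base points first
-- removes this dependence: the second marginals of `μ|_s ⊗ κ` and `μ|_s ⊗ η` agree against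
-- compactly supported functions, hence as measures. As `s` varies this identifies `μ ⊗ κ` and `μ ⊗
-- η` on rectangles, and thereby the kernels almost everywhere.
open scoped CompactlySupported in
lemma kernel_ae_eq_of_integral_eq {Z : Type*} [MeasurableSpace Z] {k : ℕ} (μ : Measure Z)
    [SFinite μ] (κ η : Kernel Z (Fin k → Phase d)) [IsMarkovKernel κ] [IsMarkovKernel η]
    (h : ∀ f : C₀(Fin k → Phase d, ℝ), ∀ᵐ z ∂μ, ∫ ξ, f ξ ∂(κ z) = ∫ ξ, f ξ ∂(η z)) :
    ∀ᵐ z ∂μ, κ z = η z := by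
  -- Passing to a finite measure with the same null sets makes the composition products finite, so
  -- that rectangles determine them.
  rw [← ae_toFinite]
  simp_rw [← ae_toFinite (μ := μ)] at h
  refine Kernel.ae_eq_of_compProd_eq (μ := μ.toFinite) ?_
  refine Measure.ext_prod fun {s t} hs ht => ?_
  have key : ((μ.toFinite.restrict s) ⊗ₘ κ).snd = ((μ.toFinite.restrict s) ⊗ₘ η).snd := by
    refine Measure.ext_of_integral_eq_on_compactlySupported fun f => ?_
    have hb : ∃ C, ∀ x, ‖f x‖ ≤ C := by
      obtain ⟨C, hC⟩ := f.hasCompactSupport.exists_bound_of_continuous f.continuous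
      exact ⟨C, hC⟩
    obtain ⟨C, hC⟩ := hb
    have hi : ∀ (ρ : Kernel Z (Fin k → Phase d)) [IsMarkovKernel ρ],
        ∫ x, f x ∂((μ.toFinite.restrict s) ⊗ₘ ρ).snd
          = ∫ z in s, ∫ ξ, f ξ ∂(ρ z) ∂μ.toFinite := fun ρ _ => by
      rw [Measure.snd, integral_map measurable_snd.aemeasurable
        (map_continuous f).aestronglyMeasurable, Measure.integral_compProd]
      refine Integrable.of_bound (C := C) ?_ (Eventually.of_forall fun _ => hC _)
      exact (f.continuous.measurable.comp measurable_snd).aestronglyMeasurable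
    rw [hi, hi]
    refine integral_congr_ae (ae_restrict_of_ae ?_)
    exact h ⟨⟨f, f.continuous⟩, f.hasCompactSupport.is_zero_at_infty⟩
  have h2 := congrArg (fun m => m t) key
  simp only [Measure.snd_apply ht] at h2
  rw [Measure.compProd_apply_prod hs ht, Measure.compProd_apply_prod hs ht]
  have h3 : ∀ (ρ : Kernel Z (Fin k → Phase d)) [IsMarkovKernel ρ],
      ((μ.toFinite.restrict s) ⊗ₘ ρ) (Prod.snd ⁻¹' t) = ∫⁻ z in s, ρ z t ∂μ.toFinite :=
    fun ρ _ => by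
      rw [Measure.compProd_apply (measurable_snd ht)]
      rfl
  rwa [h3, h3] at h2

/-! ### The space-time domain -/

namespace SpaceDomain

/-- Lebesgue measure on `[0,T] × D`. -/
def spaceTime (D : SpaceDomain) (T : ℝ) : Measure (ℝ × Space d) :=
  (volume.restrict (Icc 0 T)).prod D.vol

instance (D : SpaceDomain) (T : ℝ) : SigmaFinite (D.spaceTime (d := d) T) := by
  unfold spaceTime; infer_instance

end SpaceDomain

/-- A point of space-time as an argument of the one-point measures. -/
def point (q : ℝ × Space d) : ℝ × (Fin 1 → Space d) := (q.1, ![q.2])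

/-- Two simultaneous points as an argument of the two-point measures. -/
def twoPoints (q : (ℝ × Space d) × Space d) : ℝ × (Fin 2 → Space d) := (q.1.1, ![q.1.2, q.2])

/-- The second point given by its offset from the first. -/
def offset (q : (ℝ × Space d) × Space d) : (ℝ × Space d) × Space d := (q.1, q.1.2 - q.2)

@[fun_prop]
lemma continuous_point : Continuous (point (d := d)) := by
  refine continuous_fst.prodMk (continuous_pi fun i => ?_)
  fin_cases i
  exact continuous_snd

@[fun_prop]
lemma continuous_twoPoints : Continuous (twoPoints (d := d)) := by
  refine (continuous_fst.comp continuous_fst).prodMk (continuous_pi fun i => ?_)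
  fin_cases i
  · exact continuous_snd.comp continuous_fst
  · exact continuous_snd

@[fun_prop]
lemma continuous_offset : Continuous (offset (d := d)) := by
  unfold offset; fun_prop

@[fun_prop]
lemma measurable_point : Measurable (point (d := d)) := continuous_point.measurable

@[fun_prop]
lemma measurable_twoPoints : Measurable (twoPoints (d := d)) := continuous_twoPoints.measurable

@[fun_prop]
lemma measurable_offset : Measurable (offset (d := d)) := continuous_offset.measurable

lemma volume_restrict_box (D : SpaceDomain) (T : ℝ) (k : ℕ) :
    (volume : Measure (ℝ × (Fin k → Space d))).restrict (D.box T k)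
      = (volume.restrict (Icc 0 T)).prod (Measure.pi fun _ => D.vol) := by
  rw [SpaceDomain.box, Measure.volume_eq_prod, ← Measure.prod_restrict, volume_pi,
    Measure.restrict_pi_pi]
  rfl

/-- `twoPoints` as a measurable equivalence. -/
def twoPointsEquiv : (ℝ × Space d) × Space d ≃ᵐ ℝ × (Fin 2 → Space d) :=
  MeasurableEquiv.prodAssoc.trans
    ((MeasurableEquiv.refl ℝ).prodCongr MeasurableEquiv.finTwoArrow.symm)

lemma measurePreserving_twoPointsEquiv (μ : Measure ℝ) [SFinite μ] (ρ : Measure (Space d))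
    [SigmaFinite ρ] : MeasurePreserving (twoPointsEquiv (d := d)) ((μ.prod ρ).prod ρ)
      (μ.prod (Measure.pi fun _ => ρ)) :=
  ((MeasurePreserving.id _).prod (measurePreserving_finTwoArrow ρ).symm).comp
    (measurePreserving_prodAssoc _ _ _)

lemma measurePreserving_twoPoints (D : SpaceDomain) (T : ℝ) :
    MeasurePreserving (twoPointsEquiv (d := d)) ((D.spaceTime T).prod D.vol)
      (volume.restrict (D.box T 2)) := by
  rw [volume_restrict_box]
  exact measurePreserving_twoPointsEquiv _ _

/-- `point` as a measurable equivalence. -/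
def pointEquiv : ℝ × Space d ≃ᵐ ℝ × (Fin 1 → Space d) :=
  (MeasurableEquiv.refl ℝ).prodCongr (MeasurableEquiv.funUnique (Fin 1) (Space d)).symm

lemma pointEquiv_apply (q : ℝ × Space d) : pointEquiv q = point q := by
  refine Prod.ext rfl (funext fun i => ?_)
  fin_cases i
  rfl

lemma measurePreserving_pointEquiv (μ : Measure ℝ) [SFinite μ] (ρ : Measure (Space d))
    [SigmaFinite ρ] : MeasurePreserving (pointEquiv (d := d)) (μ.prod ρ)
      (μ.prod (Measure.pi fun _ => ρ)) :=
  (MeasurePreserving.id _).prod (measurePreserving_funUnique ρ (Fin 1)).symm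

lemma measurePreserving_point (D : SpaceDomain) (T : ℝ) :
    MeasurePreserving (pointEquiv (d := d)) (D.spaceTime T) (volume.restrict (D.box T 1)) := by
  rw [volume_restrict_box]
  exact measurePreserving_pointEquiv _ _

lemma integral_box_two (D : SpaceDomain) (T : ℝ) (f : ℝ × (Fin 2 → Space d) → ℝ) :
    ∫ z in D.box T 2, f z = ∫ q, f (twoPoints q) ∂((D.spaceTime T).prod D.vol) :=
  ((measurePreserving_twoPoints D T).integral_comp' f).symm

lemma integral_box_one (D : SpaceDomain) (T : ℝ) (f : ℝ × (Fin 1 → Space d) → ℝ) :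
    ∫ z in D.box T 1, f z = ∫ q, f (point q) ∂(D.spaceTime T) := by
  rw [← (measurePreserving_point D T).integral_comp' f]
  simp_rw [pointEquiv_apply]

lemma ae_box_two {D : SpaceDomain} {T : ℝ} {p : ℝ × (Fin 2 → Space d) → Prop}
    (h : ∀ᵐ z ∂volume.restrict (D.box T 2), p z) :
    ∀ᵐ q ∂((D.spaceTime T).prod D.vol), p (twoPoints q) :=
  (measurePreserving_twoPoints D T).quasiMeasurePreserving.ae h

lemma ae_box_one {D : SpaceDomain} {T : ℝ} {p : ℝ × (Fin 1 → Space d) → Prop}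
    (h : ∀ᵐ q ∂(D.spaceTime T), p (point q)) :
    ∀ᵐ z ∂volume.restrict (D.box T 1), p z := by
  rw [← (measurePreserving_point D T).map_eq, pointEquiv.measurableEmbedding.ae_map_iff]
  simpa only [pointEquiv_apply] using h

/-- The exchange of the two points. -/
def exchange (q : (ℝ × Space d) × Space d) : (ℝ × Space d) × Space d := ((q.1.1, q.2), q.1.2)

lemma measurePreserving_exchange (D : SpaceDomain) (T : ℝ) :
    MeasurePreserving (exchange (d := d)) ((D.spaceTime T).prod D.vol)
      ((D.spaceTime T).prod D.vol) := by
  have h1 := measurePreserving_prodAssoc (volume.restrict (Icc 0 T)) (D.vol (d := d))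
    (D.vol (d := d))
  have h2 : MeasurePreserving (Prod.map id Prod.swap) _ _ :=
    (MeasurePreserving.id (volume.restrict (Icc 0 T))).prod
      (Measure.measurePreserving_swap (μ := D.vol (d := d)) (ν := D.vol (d := d)))
  exact (h1.symm MeasurableEquiv.prodAssoc).comp (h2.comp h1)

/-- `exchange` as a measurable equivalence. -/
def exchangeEquiv : (ℝ × Space d) × Space d ≃ᵐ (ℝ × Space d) × Space d where
  toFun := exchange
  invFun := exchange
  left_inv _ := rfl
  right_inv _ := rfl
  measurable_toFun := by
    change Measurable exchange
    unfold exchange; fun_prop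
  measurable_invFun := by
    change Measurable exchange
    unfold exchange; fun_prop

lemma integral_exchange (D : SpaceDomain) (T : ℝ) (f : (ℝ × Space d) × Space d → ℝ) :
    ∫ q, f (exchange q) ∂((D.spaceTime T).prod D.vol) = ∫ q, f q ∂((D.spaceTime T).prod D.vol) :=
  MeasurePreserving.integral_comp' (f := exchangeEquiv) (measurePreserving_exchange D T) f

/-! ### One- and two-point measures -/

/-- The one-point measures, as laws on the phase space. -/
def onePoint (ν : Hierarchy d) : Kernel (ℝ × Space d) (Phase d) :=
  ((ν 1).comap point measurable_point).map fun ξ => ξ 0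

/-- The two-point measures. -/
def twoPoint (ν : Hierarchy d) : Kernel ((ℝ × Space d) × Space d) (Fin 2 → Phase d) :=
  (ν 2).comap twoPoints measurable_twoPoints

lemma twoPoint_apply (ν : Hierarchy d) (q : (ℝ × Space d) × Space d) :
    twoPoint ν q = ν 2 (twoPoints q) := rfl

lemma onePoint_apply (ν : Hierarchy d) (q : ℝ × Space d) :
    onePoint ν q = (ν 1 (point q)).map fun ξ => ξ 0 := by
  rw [onePoint, Kernel.map_apply _ (measurable_pi_apply 0), Kernel.comap_apply]

lemma lintegral_onePoint (ν : Hierarchy d) (q : ℝ × Space d) {h : Phase d → ℝ≥0∞}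
    (hh : Measurable h) : ∫⁻ ζ, h ζ ∂(onePoint ν q) = ∫⁻ ξ, h (ξ 0) ∂(ν 1 (point q)) := by
  rw [onePoint_apply, lintegral_map hh (measurable_pi_apply 0)]

lemma integral_onePoint (ν : Hierarchy d) (q : ℝ × Space d) {h : Phase d → ℝ}
    (hh : Measurable h) : ∫ ζ, h ζ ∂(onePoint ν q) = ∫ ξ, h (ξ 0) ∂(ν 1 (point q)) := by
  rw [onePoint_apply, integral_map (measurable_pi_apply 0).aemeasurable hh.aestronglyMeasurable]

namespace IsCorrelationMeasure

variable {D : SpaceDomain} {T : ℝ} {ν : Hierarchy d}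

lemma isMarkovKernel_onePoint (hν : IsCorrelationMeasure D T ν) : IsMarkovKernel (onePoint ν) := by
  have := hν.markov 1
  exact Kernel.IsMarkovKernel.map _ (measurable_pi_apply 0)

lemma isMarkovKernel_twoPoint (hν : IsCorrelationMeasure D T ν) : IsMarkovKernel (twoPoint ν) := by
  have := hν.markov 2
  unfold twoPoint
  infer_instance

lemma onePoint_periodic (hν : IsCorrelationMeasure D T ν) {a : Space d} (ha : a ∈ D.periods) (t : ℝ)
    (x : Space d) : onePoint ν (t, x + a) = onePoint ν (t, x) := by
  rw [onePoint_apply, onePoint_apply]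
  congr 1
  have h := hν.periodic 1 t ![x] ![a] fun l => by
    fin_cases l
    exact ha
  rw [point, point, ← h]
  congr 2
  ext i : 1
  fin_cases i
  rfl

lemma twoPoint_periodic_right (hν : IsCorrelationMeasure D T ν) {a : Space d} (ha : a ∈ D.periods)
    (p : ℝ × Space d) (x : Space d) : twoPoint ν (p, x + a) = twoPoint ν (p, x) := by
  rw [twoPoint_apply, twoPoint_apply]
  have h := hν.periodic 2 p.1 ![p.2, x] ![0, a] fun l => by
    fin_cases l
    · exact D.periods.zero_mem
    · exact ha
  rw [twoPoints, twoPoints, ← h]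
  congr 2
  ext i : 1
  fin_cases i
  · simp
  · simp

lemma twoPoint_periodic_left (hν : IsCorrelationMeasure D T ν) {a : Space d} (ha : a ∈ D.periods)
    (t : ℝ) (x y : Space d) : twoPoint ν ((t, x + a), y) = twoPoint ν ((t, x), y) := by
  rw [twoPoint_apply, twoPoint_apply]
  have h := hν.periodic 2 t ![x, y] ![a, 0] fun l => by
    fin_cases l
    · exact ha
    · exact D.periods.zero_mem
  rw [twoPoints, twoPoints, ← h]
  congr 2
  ext i : 1
  fin_cases i
  · simp
  · simp

/-- Exchanging the points exchanges the values. -/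
lemma ae_map_exchange (hν : IsCorrelationMeasure D T ν) :
    ∀ᵐ q ∂((D.spaceTime T).prod D.vol),
      (twoPoint ν (exchange q)).map (fun ξ => ξ ∘ Equiv.swap 0 1) = twoPoint ν q := by
  have := hν.markov 2
  have hm : Measurable fun ξ : Fin 2 → Phase d => ξ ∘ Equiv.swap (0 : Fin 2) 1 := by fun_prop
  have hc : Measurable fun z : ℝ × (Fin 2 → Space d) =>
      (z.1, z.2 ∘ Equiv.swap (0 : Fin 2) 1) := by fun_prop
  have hM : IsMarkovKernel (((ν 2).comap _ hc).map fun ξ => ξ ∘ Equiv.swap (0 : Fin 2) 1) :=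
    Kernel.IsMarkovKernel.map _ hm
  have h := kernel_ae_eq_of_integral_eq (volume.restrict (D.box T 2))
    (((ν 2).comap _ hc).map fun ξ => ξ ∘ Equiv.swap (0 : Fin 2) 1) (ν 2) fun f => by
      filter_upwards [hν.symmetric 2 (Equiv.swap 0 1) f] with z hz
      rw [← hz, Kernel.map_apply _ hm, Kernel.comap_apply,
        integral_map hm.aemeasurable (map_continuous f).aestronglyMeasurable]
      rfl
  filter_upwards [ae_box_two h] with q hq
  rw [Kernel.map_apply _ hm, Kernel.comap_apply] at hq
  rw [twoPoint_apply, twoPoint_apply, ← hq]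
  congr 2
  refine Prod.ext rfl (funext fun i => ?_)
  fin_cases i <;> rfl

/-- The law of the value at the first point. -/
lemma ae_map_zero (hν : IsCorrelationMeasure D T ν) :
    ∀ᵐ q ∂((D.spaceTime T).prod D.vol),
      (twoPoint ν q).map (fun ξ => ξ 0) = onePoint ν q.1 := by
  have := hν.markov 2
  have := hν.markov 1
  have hm : Measurable fun ξ : Fin 2 → Phase d => (Fin.init ξ : Fin 1 → Phase d) :=
    measurable_pi_lambda _ fun i => measurable_pi_apply _
  have hc : Measurable fun z : ℝ × (Fin 2 → Space d) =>
      ((z.1, Fin.init z.2) : ℝ × (Fin 1 → Space d)) :=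
    measurable_fst.prodMk (measurable_pi_lambda _ fun i =>
      (measurable_pi_apply _).comp measurable_snd)
  have hM : IsMarkovKernel ((ν 2).map fun ξ => (Fin.init ξ : Fin 1 → Phase d)) :=
    Kernel.IsMarkovKernel.map _ hm
  have h := kernel_ae_eq_of_integral_eq (volume.restrict (D.box T 2))
    ((ν 2).map fun ξ => (Fin.init ξ : Fin 1 → Phase d)) ((ν 1).comap _ hc) fun f => by
      filter_upwards [hν.consistent 1 f] with z hz
      rw [Kernel.map_apply _ hm, Kernel.comap_apply, ← hz,
        integral_map hm.aemeasurable (map_continuous f).aestronglyMeasurable]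
  filter_upwards [ae_box_two h] with q hq
  rw [Kernel.map_apply _ hm, Kernel.comap_apply] at hq
  have h2 : point q.1 = ((twoPoints q).1, Fin.init (twoPoints q).2) := by
    refine Prod.ext rfl (funext fun i => ?_)
    fin_cases i
    rfl
  rw [onePoint_apply, twoPoint_apply, h2, ← hq, Measure.map_map (measurable_pi_apply 0) hm]
  rfl

/-- The law of the value at the second point. -/
lemma ae_map_one (hν : IsCorrelationMeasure D T ν) :
    ∀ᵐ q ∂((D.spaceTime T).prod D.vol),
      (twoPoint ν q).map (fun ξ => ξ 1) = onePoint ν (q.1.1, q.2) := by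
  filter_upwards [hν.ae_map_exchange,
    (measurePreserving_exchange D T).quasiMeasurePreserving.ae hν.ae_map_zero] with q h1 h2
  have hm : Measurable fun ξ : Fin 2 → Phase d => ξ ∘ Equiv.swap (0 : Fin 2) 1 := by fun_prop
  rw [← h1, Measure.map_map (measurable_pi_apply 1) hm]
  exact h2

end IsCorrelationMeasure

/-! ### Translation invariance on the space-time domain -/

lemma lintegral_spaceTime_add (D : SpaceDomain) (T : ℝ) {f : ℝ × Space d → ℝ≥0∞}
    (hf : Measurable f) (hp : ∀ a ∈ D.periods (d := d), ∀ t x, f (t, x + a) = f (t, x))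
    (c : Space d) :
    ∫⁻ p, f (p.1, p.2 + c) ∂(D.spaceTime T) = ∫⁻ p, f p ∂(D.spaceTime T) := by
  rw [SpaceDomain.spaceTime, lintegral_prod _ (by fun_prop), lintegral_prod _ (by fun_prop)]
  exact lintegral_congr fun t =>
    D.lintegral_vol_add_right (f := fun x => f (t, x)) (fun a ha x => hp a ha t x) c

/-- Reduction to the nonnegative case through positive and negative parts. Integrability is itself
translation invariant, so otherwise both integrals have the default value zero. -/
lemma integral_vol_add_right (D : SpaceDomain) {f : Space d → ℝ} (hf : Measurable f)
    (hp : ∀ a ∈ D.periods (d := d), ∀ x, f (x + a) = f x) (c : Space d) :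
    ∫ x, f (x + c) ∂D.vol = ∫ x, f x ∂D.vol := by
  have h1 : ∀ g : ℝ → ℝ≥0∞, Measurable g →
      ∫⁻ x, g (f (x + c)) ∂D.vol = ∫⁻ x, g (f x) ∂D.vol := fun g hg =>
    D.lintegral_vol_add_right (f := fun x => g (f x)) (fun a ha x => by rw [hp a ha]) c
  by_cases hi : Integrable f D.vol
  · have hi' : Integrable (fun x => f (x + c)) D.vol :=
      ⟨(by fun_prop : Measurable _).aestronglyMeasurable, by
        have := h1 (fun y => ‖y‖ₑ) (by fun_prop)
        rw [HasFiniteIntegral, this]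
        exact hi.2⟩
    rw [integral_eq_lintegral_pos_part_sub_lintegral_neg_part hi,
      integral_eq_lintegral_pos_part_sub_lintegral_neg_part hi',
      h1 (fun y => ENNReal.ofReal y) (by fun_prop), h1 (fun y => ENNReal.ofReal (-y)) (by fun_prop)]
  · have hi' : ¬ Integrable (fun x => f (x + c)) D.vol := fun h => hi ⟨hf.aestronglyMeasurable, by
      have := h1 (fun y => ‖y‖ₑ) (by fun_prop)
      rw [HasFiniteIntegral, ← this]
      exact h.2⟩
    rw [integral_undef hi, integral_undef hi']

lemma integral_spaceTime_add (D : SpaceDomain) (T : ℝ) {f : ℝ × Space d → ℝ}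
    (hf : Measurable f) (hp : ∀ a ∈ D.periods (d := d), ∀ t x, f (t, x + a) = f (t, x))
    (hi : Integrable f (D.spaceTime T)) (c : Space d) :
    ∫ p, f (p.1, p.2 + c) ∂(D.spaceTime T) = ∫ p, f p ∂(D.spaceTime T) := by
  have hi' : Integrable (fun p : ℝ × Space d => f (p.1, p.2 + c)) (D.spaceTime T) :=
    ⟨(by fun_prop : Measurable _).aestronglyMeasurable, by
      have := lintegral_spaceTime_add D T (f := fun p => ‖f p‖ₑ) (by fun_prop)
        (fun a ha t x => by rw [hp a ha]) c
      rw [HasFiniteIntegral, this]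
      exact hi.2⟩
  rw [SpaceDomain.spaceTime, integral_prod _ hi', integral_prod _ hi]
  exact integral_congr_ae <| Eventually.of_forall fun t =>
    integral_vol_add_right D (f := fun x => f (t, x)) (by fun_prop) (fun a ha x => hp a ha t x) c

/-! ### Pairs of points given by a base point and an offset -/

namespace SpaceDomain

/-- The measure `dt dx dz` on pairs of a point of `[0,T] × D` and an offset `z`. -/
def offsets (D : SpaceDomain) (T : ℝ) : Measure ((ℝ × Space d) × Space d) :=
  (D.spaceTime T).prod volume

instance (D : SpaceDomain) (T : ℝ) : SigmaFinite (D.offsets (d := d) T) := by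
  unfold offsets; infer_instance

end SpaceDomain

lemma measurePreserving_offset (D : SpaceDomain) (T : ℝ) :
    MeasurePreserving (offset (d := d)) (D.offsets T) (D.offsets T) :=
  (MeasurePreserving.id (D.spaceTime T)).skew_product
    (g := fun (p : ℝ × Space d) z => p.2 - z) (by unfold Function.uncurry; fun_prop)
    (Eventually.of_forall fun p => (Measure.measurePreserving_sub_left volume p.2).map_eq)

/-- The hypothesis only sees second points in one cell, whereas `x - z` runs through all of `ℝ^d`.
Every second point is moved into the cell by a period, so by `hp` the bad points are covered by
countably many translates of one null set. The map `z ↦ x - z` preserves Lebesgue measure, so this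
null set stays null in the offset variable. -/
lemma ae_offset (D : SpaceDomain) (T : ℝ) {P : (ℝ × Space d) × Space d → Prop}
    (hp : ∀ a ∈ D.periods (d := d), ∀ p x, P (p, x + a) → P (p, x))
    (h : ∀ᵐ q ∂((D.spaceTime T).prod D.vol), P q) : ∀ᵐ q ∂(D.offsets T), P (offset q) := by
  refine (measurePreserving_offset D T).quasiMeasurePreserving.ae ?_
  obtain ⟨N, hN, hNm, hN0⟩ := exists_measurable_superset_of_null (ae_iff.1 h)
  have h1 : (D.spaceTime T).prod D.vol
      = (D.offsets T).restrict (univ ×ˢ D.cell (d := d)) := by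
    rw [SpaceDomain.offsets, ← Measure.prod_restrict, Measure.restrict_univ]
    rfl
  rw [h1, Measure.restrict_apply hNm] at hN0
  have hs : ∀ a : D.periods (d := d), MeasurePreserving
      (fun q : (ℝ × Space d) × Space d => (q.1, q.2 + a)) (D.offsets T) (D.offsets T) := fun a =>
    (MeasurePreserving.id (D.spaceTime T)).prod (measurePreserving_add_right volume (a : Space d))
  rw [ae_iff]
  refine measure_mono_null (t := ⋃ a : D.periods (d := d),
    (fun q : (ℝ × Space d) × Space d => (q.1, q.2 + a)) ⁻¹' (N ∩ univ ×ˢ D.cell)) ?_ ?_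
  · intro q hq
    obtain ⟨a, ha⟩ : ∃ a : D.periods (d := d), (a : Space d) + q.2 ∈ D.cell := by
      cases D
      · exact ⟨0, trivial⟩
      · refine ⟨⟨WithLp.toLp 2 fun i => ((-⌊q.2 i⌋ : ℤ) : ℝ), fun i => ⟨-⌊q.2 i⌋, rfl⟩⟩,
          fun i => ?_⟩
        simp only [PiLp.add_apply]
        constructor
        · push_cast; linarith [Int.floor_le (q.2 i)]
        · push_cast; linarith [Int.lt_floor_add_one (q.2 i)]
    rw [add_comm] at ha
    exact mem_iUnion.2 ⟨a, hN fun h' => hq (hp a a.2 q.1 q.2 h'), mem_univ _, ha⟩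
  · refine measure_iUnion_null fun a => ?_
    rw [(hs a).measure_preimage]
    · exact hN0
    · exact (hNm.inter (MeasurableSet.univ.prod D.measurableSet_cell)).nullMeasurableSet

/-- Unfolding of integrals over pairs of points. -/
lemma integral_offsets_unfold (D : SpaceDomain) (T : ℝ) {F : (ℝ × Space d) × Space d → ℝ}
    (hF : Measurable F) (hp : ∀ a ∈ D.periods (d := d), ∀ p x, F (p, x + a) = F (p, x))
    {w : Space d → ℝ} {r : ℝ} (hw : Continuous w) (hr : ∀ x, w x ≠ 0 → ‖x‖ ≤ r)
    (hi : Integrable (fun q => F (offset q) * w q.2) (D.offsets T)) :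
    Integrable (fun q => F q * periodize D w (q.1.2 - q.2)) ((D.spaceTime T).prod D.vol) ∧
    ∫ q, F q * periodize D w (q.1.2 - q.2) ∂((D.spaceTime T).prod D.vol)
      = ∫ q, F (offset q) * w q.2 ∂(D.offsets T) := by
  have hwm := hw.measurable
  have hpc := (continuous_periodize D hr hw).measurable
  have h1 : Integrable (fun q => F q * periodize D w (q.1.2 - q.2))
      ((D.spaceTime T).prod D.vol) := by
    refine ⟨(by fun_prop : Measurable _).aestronglyMeasurable, ?_⟩
    refine lt_of_le_of_lt ?_ hi.2
    rw [lintegral_prod _ (by fun_prop), SpaceDomain.offsets, lintegral_prod _ (by fun_prop)]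
    refine lintegral_mono fun p => ?_
    have h := lintegral_unfold D (F := fun y => ‖F (p, y)‖ₑ) (by fun_prop)
      (fun a ha x => by rw [hp a ha]) (w := fun y => ‖w y‖ₑ) (by fun_prop) p.2
    simp only [offset, enorm_mul]
    rw [← h]
    refine lintegral_mono fun y => ?_
    gcongr
    -- The norm of a periodization is at most the periodization of the norm, whose integral unfolds
    -- to the one assumed finite.
    exact enorm_tsum_le_tsum_enorm
  refine ⟨h1, ?_⟩
  rw [integral_prod _ h1, SpaceDomain.offsets, integral_prod _ hi]
  refine integral_congr_ae ?_
  filter_upwards [hi.prod_right_ae] with p hp'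
  exact integral_unfold D (F := fun y => F (p, y)) (by fun_prop) (fun a ha x => hp a ha p x) hwm
    p.2 hp'

/-- The two-point measures in terms of a base point and an offset. -/
def offsetKernel (ν : Hierarchy d) : Kernel ((ℝ × Space d) × Space d) (Fin 2 → Phase d) :=
  (twoPoint ν).comap offset measurable_offset

lemma offsetKernel_apply (ν : Hierarchy d) (q : (ℝ × Space d) × Space d) :
    offsetKernel ν q = twoPoint ν (offset q) := rfl

/-- The joint measure of base points, offsets and the values at the two points. -/
def joint (D : SpaceDomain) (T : ℝ) (ν : Hierarchy d) :
    Measure (((ℝ × Space d) × Space d) × (Fin 2 → Phase d)) :=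
  D.offsets T ⊗ₘ offsetKernel ν

namespace IsCorrelationMeasure

variable {D : SpaceDomain} {T : ℝ} {ν : Hierarchy d}

lemma isMarkovKernel_offsetKernel (hν : IsCorrelationMeasure D T ν) :
    IsMarkovKernel (offsetKernel ν) := by
  have := hν.isMarkovKernel_twoPoint
  unfold offsetKernel
  infer_instance

lemma ae_offsetKernel_map_zero (hν : IsCorrelationMeasure D T ν) :
    ∀ᵐ q ∂(D.offsets T), (offsetKernel ν q).map (fun ξ => ξ 0) = onePoint ν q.1 :=
  ae_offset D T (P := fun q => (twoPoint ν q).map (fun ξ => ξ 0) = onePoint ν q.1)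
    (fun a ha p x h => by rwa [← hν.twoPoint_periodic_right ha]) hν.ae_map_zero

lemma ae_offsetKernel_map_one (hν : IsCorrelationMeasure D T ν) :
    ∀ᵐ q ∂(D.offsets T),
      (offsetKernel ν q).map (fun ξ => ξ 1) = onePoint ν (q.1.1, q.1.2 - q.2) :=
  ae_offset D T (P := fun q => (twoPoint ν q).map (fun ξ => ξ 1) = onePoint ν (q.1.1, q.2))
    (fun a ha p x h => by
      rw [← hν.twoPoint_periodic_right ha, h]
      exact hν.onePoint_periodic ha _ _) hν.ae_map_one

/-- By consistency the law of the first value does not depend on the offset, so the integral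
factorizes. -/
lemma lintegral_joint_zero (hν : IsCorrelationMeasure D T ν) {b : Space d → ℝ≥0∞}
    (hb : Measurable b) {h : Phase d → ℝ≥0∞} (hh : Measurable h) :
    ∫⁻ u, b u.1.2 * h (u.2 0) ∂(joint D T ν)
      = (∫⁻ z, b z) * ∫⁻ p, ∫⁻ ζ, h ζ ∂(onePoint ν p) ∂(D.spaceTime T) := by
  have := hν.isMarkovKernel_offsetKernel
  have := hν.isMarkovKernel_onePoint
  rw [joint, Measure.lintegral_compProd (by fun_prop)]
  calc ∫⁻ q, ∫⁻ ξ, b q.2 * h (ξ 0) ∂(offsetKernel ν q) ∂(D.offsets T)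
      = ∫⁻ q, (∫⁻ ζ, h ζ ∂(onePoint ν q.1)) * b q.2 ∂(D.offsets T) := by
        refine lintegral_congr_ae ?_
        filter_upwards [hν.ae_offsetKernel_map_zero] with q hq
        rw [lintegral_const_mul _ (by fun_prop), ← hq,
          lintegral_map hh (measurable_pi_apply 0), mul_comm]
    _ = _ := by
        rw [SpaceDomain.offsets, lintegral_prod_mul (f := fun p => ∫⁻ ζ, h ζ ∂(onePoint ν p))
          hh.lintegral_kernel.aemeasurable hb.aemeasurable, mul_comm]

/-- For a fixed offset `z` the law of the second value is `ν¹` at `(t, x - z)`; translation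
invariance of the measure on `D` removes the shift, and the integral factorizes as for the first
value. -/
lemma lintegral_joint_one (hν : IsCorrelationMeasure D T ν) {b : Space d → ℝ≥0∞}
    (hb : Measurable b) {h : Phase d → ℝ≥0∞} (hh : Measurable h) :
    ∫⁻ u, b u.1.2 * h (u.2 1) ∂(joint D T ν)
      = (∫⁻ z, b z) * ∫⁻ p, ∫⁻ ζ, h ζ ∂(onePoint ν p) ∂(D.spaceTime T) := by
  have := hν.isMarkovKernel_offsetKernel
  have := hν.isMarkovKernel_onePoint
  have hH : Measurable fun p => ∫⁻ ζ, h ζ ∂(onePoint ν p) := hh.lintegral_kernel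
  rw [joint, Measure.lintegral_compProd (by fun_prop)]
  calc ∫⁻ q, ∫⁻ ξ, b q.2 * h (ξ 1) ∂(offsetKernel ν q) ∂(D.offsets T)
      = ∫⁻ q, b q.2 * ∫⁻ ζ, h ζ ∂(onePoint ν (q.1.1, q.1.2 - q.2)) ∂(D.offsets T) := by
        refine lintegral_congr_ae ?_
        filter_upwards [hν.ae_offsetKernel_map_one] with q hq
        rw [lintegral_const_mul _ (by fun_prop), ← hq,
          lintegral_map hh (measurable_pi_apply 1)]
    _ = ∫⁻ z, b z * ∫⁻ p, ∫⁻ ζ, h ζ ∂(onePoint ν p) ∂(D.spaceTime T) := by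
        have hm : Measurable fun q : (ℝ × Space d) × Space d =>
            ∫⁻ ζ, h ζ ∂(onePoint ν (q.1.1, q.1.2 - q.2)) :=
          hH.comp (g := fun p => ∫⁻ ζ, h ζ ∂(onePoint ν p))
            (f := fun q : (ℝ × Space d) × Space d => (q.1.1, q.1.2 - q.2)) (by fun_prop)
        rw [SpaceDomain.offsets, lintegral_prod_symm' _ (by fun_prop)]
        refine lintegral_congr fun z => ?_
        refine (lintegral_const_mul (b z) (hm.comp measurable_prodMk_right)).trans ?_
        congr 1
        have := lintegral_spaceTime_add D T hH
          (fun a ha t x => by rw [hν.onePoint_periodic ha]) (-z)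
        simpa only [sub_eq_add_neg, Function.comp_def] using this
    _ = _ := lintegral_mul_const _ hb

end IsCorrelationMeasure

/-! ### Moments -/

/-- The moments of velocity and pressure that are integrable. -/
def weight (ζ : Phase d) : ℝ := ‖ζ.1‖ ^ 2 + ‖ζ.1‖ ^ 3 + |ζ.2| ^ (3 / 2 : ℝ)

lemma weight_nonneg (ζ : Phase d) : 0 ≤ weight ζ := by
  unfold weight; positivity

@[fun_prop]
lemma measurable_weight : Measurable (weight (d := d)) := by
  unfold weight; fun_prop

lemma ofReal_weight (ζ : Phase d) :
    ENNReal.ofReal (weight ζ) = ‖ζ.1‖ₑ ^ 2 + (‖ζ.1‖ₑ ^ 3 + ‖ζ.2‖ₑ ^ (3 / 2 : ℝ)) := by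
  rw [weight, ENNReal.ofReal_add (by positivity) (by positivity),
    ENNReal.ofReal_add (by positivity) (by positivity), ENNReal.ofReal_pow (norm_nonneg _),
    ENNReal.ofReal_pow (norm_nonneg _), ofReal_norm, add_assoc,
    ← ENNReal.ofReal_rpow_of_nonneg (abs_nonneg _) (by norm_num), ← Real.norm_eq_abs,
    ofReal_norm]

/-- One-point observables controlled by the integrable moments. -/
def IsDominatedOne (g : Phase d → ℝ) : Prop :=
  Measurable g ∧ ∃ C : ℝ, ∀ ζ, |g ζ| ≤ C * weight ζ

/-- Two-point observables controlled by the integrable moments. -/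
def IsDominatedTwo (g : (Fin 2 → Phase d) → ℝ) : Prop :=
  Measurable g ∧ ∃ C : ℝ, ∀ ξ, |g ξ| ≤ C * (weight (ξ 0) + weight (ξ 1))

lemma IsDominatedOne.exists_enorm_le {g : Phase d → ℝ} (hg : IsDominatedOne g) :
    ∃ C : ℝ≥0, ∀ ζ, ‖g ζ‖ₑ ≤ C * ENNReal.ofReal (weight ζ) := by
  obtain ⟨-, C, hC⟩ := hg
  refine ⟨C.toNNReal, fun ζ => ?_⟩
  rw [Real.enorm_eq_ofReal_abs, ENNReal.ofNNReal_toNNReal,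
    ← ENNReal.ofReal_mul' (weight_nonneg _)]
  exact ENNReal.ofReal_le_ofReal (hC ζ)

lemma IsDominatedTwo.exists_enorm_le {g : (Fin 2 → Phase d) → ℝ} (hg : IsDominatedTwo g) :
    ∃ C : ℝ≥0, ∀ ξ, ‖g ξ‖ₑ ≤ C * (ENNReal.ofReal (weight (ξ 0)) + ENNReal.ofReal (weight (ξ 1))) := by
  obtain ⟨-, C, hC⟩ := hg
  refine ⟨C.toNNReal, fun ξ => ?_⟩
  rw [Real.enorm_eq_ofReal_abs, ENNReal.ofNNReal_toNNReal,
    ← ENNReal.ofReal_add (weight_nonneg _) (weight_nonneg _),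
    ← ENNReal.ofReal_mul' (add_nonneg (weight_nonneg _) (weight_nonneg _))]
  exact ENNReal.ofReal_le_ofReal (hC ξ)

lemma IsDominatedOne.zero {g : Phase d → ℝ} (hg : IsDominatedOne g) :
    IsDominatedTwo fun ξ => g (ξ 0) := by
  obtain ⟨hm, C, hC⟩ := hg
  refine ⟨hm.comp (measurable_pi_apply 0), |C|, fun ξ => (hC _).trans ?_⟩
  have h0 := weight_nonneg (ξ 0)
  have h1 := weight_nonneg (ξ 1)
  nlinarith [le_abs_self C, abs_nonneg C]

lemma IsDominatedOne.one {g : Phase d → ℝ} (hg : IsDominatedOne g) :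
    IsDominatedTwo fun ξ => g (ξ 1) := by
  obtain ⟨hm, C, hC⟩ := hg
  refine ⟨hm.comp (measurable_pi_apply 1), |C|, fun ξ => (hC _).trans ?_⟩
  have h0 := weight_nonneg (ξ 0)
  have h1 := weight_nonneg (ξ 1)
  nlinarith [le_abs_self C, abs_nonneg C]

lemma IsDominatedTwo.sub {g h : (Fin 2 → Phase d) → ℝ} (hg : IsDominatedTwo g)
    (hh : IsDominatedTwo h) : IsDominatedTwo fun ξ => g ξ - h ξ := by
  obtain ⟨hm, C, hC⟩ := hg
  obtain ⟨hm', C', hC'⟩ := hh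
  refine ⟨hm.sub hm', C + C', fun ξ => (abs_sub _ _).trans ?_⟩
  rw [add_mul]
  exact add_le_add (hC ξ) (hC' ξ)

lemma integrable_integral_of_compProd {X Y : Type*} [MeasurableSpace X] [MeasurableSpace Y]
    {μ : Measure X} [SFinite μ] {κ : Kernel X Y} [IsSFiniteKernel κ] {f : X × Y → ℝ}
    (hf : Integrable f (μ ⊗ₘ κ)) : Integrable (fun x => ∫ y, f (x, y) ∂(κ x)) μ := by
  have h2 : Integrable f ((Kernel.const Unit μ ⊗ₖ Kernel.prodMkLeft Unit κ) ()) := hf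
  simpa using h2.integral_compProd

/-- Bounded continuous functions on `ℝ × D`. -/
structure IsCoefficient (D : SpaceDomain) (α : ℝ × Space d → ℝ) : Prop where
  continuous : Continuous α
  periodic : ∀ a ∈ D.periods (d := d), ∀ t x, α (t, x + a) = α (t, x)
  bounded : ∃ A : ℝ, ∀ p, |α p| ≤ A

/-- Continuous functions of bounded support. -/
structure IsCutoff (β : Space d → ℝ) : Prop where
  continuous : Continuous β
  bounded_support : ∃ r : ℝ, ∀ z, β z ≠ 0 → ‖z‖ ≤ r

lemma IsCutoff.integrable {β : Space d → ℝ} (hβ : IsCutoff β) : Integrable β := by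
  obtain ⟨r, hr⟩ := hβ.bounded_support
  refine hβ.continuous.integrable_of_hasCompactSupport
    (HasCompactSupport.intro (isCompact_closedBall 0 r) fun x hx => ?_)
  by_contra h
  exact hx (by simpa using hr x h)

lemma IsCoefficient.exists_enorm_le {D : SpaceDomain} {α : ℝ × Space d → ℝ}
    (hα : IsCoefficient D α) : ∃ A : ℝ≥0, ∀ p, ‖α p‖ₑ ≤ A := by
  obtain ⟨A, hA⟩ := hα.bounded
  refine ⟨A.toNNReal, fun p => ?_⟩
  rw [Real.enorm_eq_ofReal_abs]
  exact ENNReal.ofReal_le_ofReal (hA p)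

/-- The integral of an observable with respect to the joint measure, with a coefficient at the base
point and a cutoff of the offset. -/
def jointIntegral (D : SpaceDomain) (T : ℝ) (ν : Hierarchy d) (α : ℝ × Space d → ℝ)
    (β : Space d → ℝ) (g : (Fin 2 → Phase d) → ℝ) : ℝ :=
  ∫ u, α u.1.1 * β u.1.2 * g u.2 ∂(joint D T ν)

namespace IsCorrelationMeasure

variable {D : SpaceDomain} {T : ℝ} {ν : Hierarchy d}

/-- The square moment is bounded uniformly in time, hence integrable over the bounded interval
`[0,T]`; the other two moments are assumed integrable. -/
lemma lintegral_weight_lt_top (hν : IsCorrelationMeasure D T ν) :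
    ∫⁻ p, ∫⁻ ζ, ENNReal.ofReal (weight ζ) ∂(onePoint ν p) ∂(D.spaceTime T) < ⊤ := by
  have := hν.markov 1
  have hw : Measurable fun ζ : Phase d => ENNReal.ofReal (weight ζ) := by fun_prop
  have hc := hν.cubic_bound
  obtain ⟨c, hc2⟩ := hν.energy_bound
  have hm1 : Measurable fun p : ℝ × Space d => ∫⁻ ξ, ‖(ξ 0).1‖ₑ ^ 2 ∂(ν 1 (point p)) := by
    have : Measurable fun z => ∫⁻ ξ, ‖(ξ 0).1‖ₑ ^ 2 ∂(ν 1 z) :=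
      Measurable.lintegral_kernel (by fun_prop)
    exact this.comp measurable_point
  have hm2 : Measurable fun p : ℝ × Space d =>
      ∫⁻ ξ, (‖(ξ 0).1‖ₑ ^ 3 + ‖(ξ 0).2‖ₑ ^ (3 / 2 : ℝ)) ∂(ν 1 (point p)) := by
    have : Measurable fun z => ∫⁻ ξ, (‖(ξ 0).1‖ₑ ^ 3 + ‖(ξ 0).2‖ₑ ^ (3 / 2 : ℝ)) ∂(ν 1 z) :=
      Measurable.lintegral_kernel (by fun_prop)
    exact this.comp measurable_point
  simp_rw [lintegral_onePoint ν _ hw, ofReal_weight]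
  rw [lintegral_congr fun p => lintegral_add_left (by fun_prop) _, lintegral_add_left hm1]
  refine ENNReal.add_lt_top.2 ⟨?_, ?_⟩
  · rw [SpaceDomain.spaceTime, lintegral_prod _ hm1.aemeasurable]
    refine (lintegral_mono_ae hc2).trans_lt ?_
    rw [lintegral_const]
    refine ENNReal.mul_lt_top ENNReal.coe_lt_top ?_
    simp
  · rw [SpaceDomain.spaceTime, lintegral_prod _ hm2.aemeasurable]
    exact hc

lemma lintegral_joint_weight_lt_top (hν : IsCorrelationMeasure D T ν) {b : Space d → ℝ≥0∞}
    (hb : Measurable b) (hb' : ∫⁻ z, b z ≠ ⊤) :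
    ∫⁻ u, b u.1.2 * (ENNReal.ofReal (weight (u.2 0)) + ENNReal.ofReal (weight (u.2 1)))
      ∂(joint D T ν) < ⊤ := by
  simp_rw [mul_add]
  rw [lintegral_add_left (by fun_prop),
    hν.lintegral_joint_zero hb (h := fun ζ => ENNReal.ofReal (weight ζ)) (by fun_prop),
    hν.lintegral_joint_one hb (h := fun ζ => ENNReal.ofReal (weight ζ)) (by fun_prop)]
  have := ENNReal.mul_lt_top hb'.lt_top hν.lintegral_weight_lt_top
  exact ENNReal.add_lt_top.2 ⟨this, this⟩

lemma lintegral_joint_enorm_lt_top (hν : IsCorrelationMeasure D T ν) {b : Space d → ℝ≥0∞}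
    (hb : Measurable b) (hb' : ∫⁻ z, b z ≠ ⊤) {g : (Fin 2 → Phase d) → ℝ}
    (hg : IsDominatedTwo g) : ∫⁻ u, b u.1.2 * ‖g u.2‖ₑ ∂(joint D T ν) < ⊤ := by
  obtain ⟨C, hC⟩ := hg.exists_enorm_le
  calc ∫⁻ u, b u.1.2 * ‖g u.2‖ₑ ∂(joint D T ν)
      ≤ ∫⁻ u, C * (b u.1.2 * (ENNReal.ofReal (weight (u.2 0)) + ENNReal.ofReal (weight (u.2 1))))
          ∂(joint D T ν) := lintegral_mono fun u => by
        rw [mul_left_comm]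
        gcongr
        exact hC _
    _ < ⊤ := by
        rw [lintegral_const_mul _ (by fun_prop)]
        exact ENNReal.mul_lt_top ENNReal.coe_lt_top (hν.lintegral_joint_weight_lt_top hb hb')

lemma integrable_joint (hν : IsCorrelationMeasure D T ν) {α : ℝ × Space d → ℝ} {β : Space d → ℝ}
    {g : (Fin 2 → Phase d) → ℝ} (hα : IsCoefficient D α) (hβ : IsCutoff β)
    (hg : IsDominatedTwo g) :
    Integrable (fun u => α u.1.1 * β u.1.2 * g u.2) (joint D T ν) := by
  obtain ⟨A, hA⟩ := hα.exists_enorm_le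
  have hm1 := hα.continuous.measurable
  have hm2 := hβ.continuous.measurable
  have hm3 := hg.1
  refine ⟨(by fun_prop : Measurable _).aestronglyMeasurable, ?_⟩
  calc ∫⁻ u, ‖α u.1.1 * β u.1.2 * g u.2‖ₑ ∂(joint D T ν)
      ≤ ∫⁻ u, A * (‖β u.1.2‖ₑ * ‖g u.2‖ₑ) ∂(joint D T ν) := lintegral_mono fun u => by
        rw [enorm_mul, enorm_mul, mul_assoc]
        gcongr
        exact hA _
    _ < ⊤ := by
        rw [lintegral_const_mul _ (by fun_prop)]
        exact ENNReal.mul_lt_top ENNReal.coe_lt_top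
          (hν.lintegral_joint_enorm_lt_top (b := fun z => ‖β z‖ₑ) (by fun_prop)
            hβ.integrable.2.ne hg)

lemma integrable_onePoint (hν : IsCorrelationMeasure D T ν) {g : Phase d → ℝ}
    (hg : IsDominatedOne g) : Integrable (fun p => ∫ ζ, g ζ ∂(onePoint ν p)) (D.spaceTime T) := by
  have := hν.isMarkovKernel_onePoint
  obtain ⟨C, hC⟩ := hg.exists_enorm_le
  have hm := hg.1
  refine ⟨(StronglyMeasurable.integral_kernel
    hm.stronglyMeasurable).aestronglyMeasurable, ?_⟩
  calc ∫⁻ p, ‖∫ ζ, g ζ ∂(onePoint ν p)‖ₑ ∂(D.spaceTime T)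
      ≤ ∫⁻ p, C * ∫⁻ ζ, ENNReal.ofReal (weight ζ) ∂(onePoint ν p) ∂(D.spaceTime T) :=
        lintegral_mono fun p => by
          refine (enorm_integral_le_lintegral_enorm _).trans ?_
          rw [← lintegral_const_mul _ (by fun_prop)]
          exact lintegral_mono fun ζ => hC ζ
    _ < ⊤ := by
        rw [lintegral_const_mul _ (Measurable.lintegral_kernel (by fun_prop))]
        exact ENNReal.mul_lt_top ENNReal.coe_lt_top hν.lintegral_weight_lt_top

/-- Observables of the first value: the offset integrates out. -/
lemma jointIntegral_zero (hν : IsCorrelationMeasure D T ν) {α : ℝ × Space d → ℝ}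
    {β : Space d → ℝ} {g : Phase d → ℝ} (hα : IsCoefficient D α) (hβ : IsCutoff β)
    (hg : IsDominatedOne g) :
    jointIntegral D T ν α β (fun ξ => g (ξ 0))
      = (∫ p, α p * ∫ ζ, g ζ ∂(onePoint ν p) ∂(D.spaceTime T)) * ∫ z, β z := by
  have := hν.isMarkovKernel_offsetKernel
  have hm := hg.1
  rw [jointIntegral, joint, Measure.integral_compProd (hν.integrable_joint hα hβ hg.zero),
    ← integral_prod_mul]
  refine integral_congr_ae ?_
  filter_upwards [hν.ae_offsetKernel_map_zero] with q hq
  rw [integral_const_mul, ← hq, integral_map (measurable_pi_apply 0).aemeasurable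
    hm.aestronglyMeasurable]
  ring

/-- Observables of the second value: the cutoff acts on the coefficient. -/
lemma jointIntegral_one (hν : IsCorrelationMeasure D T ν) {α : ℝ × Space d → ℝ}
    {β : Space d → ℝ} {g : Phase d → ℝ} (hα : IsCoefficient D α) (hβ : IsCutoff β)
    (hg : IsDominatedOne g) :
    jointIntegral D T ν α β (fun ξ => g (ξ 1))
      = ∫ p, (∫ ζ, g ζ ∂(onePoint ν p)) * (∫ z, α (p.1, p.2 + z) * β z) ∂(D.spaceTime T) := by
  have := hν.isMarkovKernel_offsetKernel
  have := hν.isMarkovKernel_onePoint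
  have hm := hg.1
  have hαm := hα.continuous.measurable
  have hβm := hβ.continuous.measurable
  set G : ℝ × Space d → ℝ := fun p => ∫ ζ, g ζ ∂(onePoint ν p) with hG
  have hGm : Measurable G := (StronglyMeasurable.integral_kernel hm.stronglyMeasurable).measurable
  have hGi : Integrable G (D.spaceTime T) := hν.integrable_onePoint hg
  have hGp : ∀ a ∈ D.periods (d := d), ∀ t x, G (t, x + a) = G (t, x) := fun a ha t x => by
    simp only [hG, hν.onePoint_periodic ha]
  have hi := hν.integrable_joint hα hβ hg.one
  have h1 : (fun q : (ℝ × Space d) × Space d => ∫ ξ, α q.1 * β q.2 * g (ξ 1) ∂(offsetKernel ν q))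
      =ᵐ[D.offsets T] fun q => α q.1 * β q.2 * G (q.1.1, q.1.2 - q.2) := by
    filter_upwards [hν.ae_offsetKernel_map_one] with q hq
    rw [integral_const_mul, hG]
    simp only
    rw [← hq, integral_map (measurable_pi_apply 1).aemeasurable hm.aestronglyMeasurable]
  have h2 : Integrable (fun q : (ℝ × Space d) × Space d => α q.1 * β q.2 * G (q.1.1, q.1.2 - q.2))
      (D.offsets T) := by
    refine Integrable.congr ?_ h1
    exact integrable_integral_of_compProd hi
  have h3 : Integrable (fun q : (ℝ × Space d) × Space d => α (q.1.1, q.1.2 + q.2) * (G q.1 * β q.2))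
      (D.offsets T) := by
    obtain ⟨A, hA⟩ := hα.bounded
    exact (hGi.mul_prod hβ.integrable).bdd_mul (c := A)
      (by fun_prop : Measurable _).aestronglyMeasurable (Eventually.of_forall fun q => hA _)
  rw [jointIntegral, joint, Measure.integral_compProd hi, integral_congr_ae h1]
  unfold SpaceDomain.offsets at h2 h3 ⊢
  rw [integral_prod_symm _ h2]
  simp_rw [← integral_const_mul]
  -- With `z` fixed, the change of variables `x ↦ x + z` takes the shift off the one-point moment
  -- and puts it on the coefficient.
  have h4 : ∀ᵐ z : Space d, ∫ p, α p * β z * G (p.1, p.2 - z) ∂(D.spaceTime T)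
      = ∫ p, α (p.1, p.2 + z) * (G p * β z) ∂(D.spaceTime T) := by
    filter_upwards [h2.prod_left_ae] with z hz
    rw [← integral_spaceTime_add D T (by fun_prop) ?_ hz z]
    · refine integral_congr_ae (Eventually.of_forall fun p => ?_)
      simp only [add_sub_cancel_right]
      ring
    · intro a ha t x
      simp only [hα.periodic a ha]
      rw [add_sub_right_comm, hGp a ha]
  rw [integral_congr_ae h4, ← integral_prod_symm _ h3, integral_prod _ h3]
  refine integral_congr_ae (Eventually.of_forall fun p =>
    integral_congr_ae (Eventually.of_forall fun z => ?_))
  simp only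
  ring

end IsCorrelationMeasure

/-! ### Local integrability -/

namespace IsCorrelationMeasure

variable {D : SpaceDomain} {T : ℝ} {ν : Hierarchy d}

/-- A compact set lies in a ball, and the integral of a periodic function over a ball is at most `N`
times the one over a cell, where the weight is integrable. -/
lemma locIntegrable_one (hν : IsCorrelationMeasure D T ν) {g : Phase d → ℝ}
    (hg : IsDominatedOne g) : LocIntegrable T (ν 1) fun ξ => g (ξ 0) := by
  have := hν.isMarkovKernel_onePoint
  intro K hK
  obtain ⟨C, hC⟩ := hg.exists_enorm_le
  have hgm := hg.1
  obtain ⟨R, hR⟩ := hK.isBounded.subset_closedBall 0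
  obtain ⟨N, hN⟩ := exists_lintegral_ball_le D d R
  have hGm : Measurable fun p => ∫⁻ ζ, ‖g ζ‖ₑ ∂(onePoint ν p) :=
    Measurable.lintegral_kernel (by fun_prop)
  have hsub : Icc 0 T ×ˢ K ⊆ Icc 0 T ×ˢ
      (Set.pi univ fun _ : Fin 1 => Metric.closedBall (0 : Space d) R) := by
    refine prod_mono_right fun x hx i _ => ?_
    have h := hR hx
    rw [mem_closedBall_zero_iff] at h ⊢
    exact (norm_le_pi_norm x i).trans h
  refine (lintegral_mono_set hsub).trans_lt ?_
  rw [Measure.volume_eq_prod, ← Measure.prod_restrict, volume_pi, Measure.restrict_pi_pi,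
    ← (measurePreserving_pointEquiv _ _).lintegral_comp_emb pointEquiv.measurableEmbedding]
  calc ∫⁻ p, ∫⁻ ξ, ‖g (ξ 0)‖ₑ ∂(ν 1 (pointEquiv p))
        ∂((volume.restrict (Icc 0 T)).prod (volume.restrict (Metric.closedBall (0 : Space d) R)))
      = ∫⁻ t in Icc 0 T, ∫⁻ x in Metric.closedBall (0 : Space d) R,
          ∫⁻ ζ, ‖g ζ‖ₑ ∂(onePoint ν (t, x)) := by
        simp_rw [pointEquiv_apply,
          ← lintegral_onePoint ν _ (h := fun ζ => ‖g ζ‖ₑ) (by fun_prop)]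
        rw [lintegral_prod _ hGm.aemeasurable]
    _ ≤ ∫⁻ t in Icc 0 T, N * ∫⁻ x, ∫⁻ ζ, ‖g ζ‖ₑ ∂(onePoint ν (t, x)) ∂D.vol :=
        lintegral_mono fun t => hN _ (hGm.comp measurable_prodMk_left) fun a ha x => by
          rw [hν.onePoint_periodic ha]
    _ = N * ∫⁻ p, ∫⁻ ζ, ‖g ζ‖ₑ ∂(onePoint ν p) ∂(D.spaceTime T) := by
        rw [lintegral_const_mul _ hGm.lintegral_prod_right', SpaceDomain.spaceTime,
          lintegral_prod _ hGm.aemeasurable]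
    _ ≤ N * ∫⁻ p, C * ∫⁻ ζ, ENNReal.ofReal (weight ζ) ∂(onePoint ν p) ∂(D.spaceTime T) := by
        gcongr with p
        rw [← lintegral_const_mul _ (by fun_prop)]
        exact lintegral_mono hC
    _ < ⊤ := by
        rw [lintegral_const_mul _ (Measurable.lintegral_kernel (by fun_prop))]
        exact ENNReal.mul_lt_top (ENNReal.natCast_lt_top N) (ENNReal.mul_lt_top ENNReal.coe_lt_top
          hν.lintegral_weight_lt_top)

/-- Two points of a ball differ by a bounded offset, so the integral is dominated by one over the
joint measure with a cutoff of the offset. There both marginals have integrable weight. -/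
lemma locIntegrable_two (hν : IsCorrelationMeasure D T ν) {g : (Fin 2 → Phase d) → ℝ}
    (hg : IsDominatedTwo g) : LocIntegrable T (ν 2) g := by
  have := hν.isMarkovKernel_twoPoint
  have := hν.isMarkovKernel_offsetKernel
  intro K hK
  have hgm := hg.1
  obtain ⟨R, hR⟩ := hK.isBounded.subset_closedBall 0
  obtain ⟨N, hN⟩ := exists_lintegral_ball_le D d R
  set F : (ℝ × Space d) × Space d → ℝ≥0∞ := fun q => ∫⁻ ξ, ‖g ξ‖ₑ ∂(twoPoint ν q) with hF
  have hFm : Measurable F := Measurable.lintegral_kernel (by fun_prop)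
  -- The radius `R + R` bounds the difference of any two points in the ball of radius `R`.
  set b : Space d → ℝ≥0∞ := (Metric.closedBall 0 (R + R)).indicator 1 with hb
  have hbm : Measurable b := measurable_one.indicator Metric.isClosed_closedBall.measurableSet
  have hbi : ∫⁻ z, b z ≠ ⊤ := by
    rw [hb, lintegral_indicator_one Metric.isClosed_closedBall.measurableSet]
    exact (isCompact_closedBall _ _).measure_lt_top.ne
  have hsub : Icc 0 T ×ˢ K ⊆ Icc 0 T ×ˢ
      (Set.pi univ fun _ : Fin 2 => Metric.closedBall (0 : Space d) R) := by
    refine prod_mono_right fun x hx i _ => ?_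
    have h := hR hx
    rw [mem_closedBall_zero_iff] at h ⊢
    exact (norm_le_pi_norm x i).trans h
  set H : ℝ × Space d → ℝ≥0∞ := fun p => ∫⁻ z, b z * F (p, p.2 - z) with hH
  have hHm : Measurable H := by
    refine Measurable.lintegral_prod_right'
      (f := fun q : (ℝ × Space d) × Space d => b q.2 * F (q.1, q.1.2 - q.2)) ?_
    fun_prop
  refine (lintegral_mono_set hsub).trans_lt ?_
  rw [Measure.volume_eq_prod, ← Measure.prod_restrict, volume_pi, Measure.restrict_pi_pi,
    ← (measurePreserving_twoPointsEquiv _ _).lintegral_comp_emb twoPointsEquiv.measurableEmbedding]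
  calc ∫⁻ q, ∫⁻ ξ, ‖g ξ‖ₑ ∂(ν 2 (twoPointsEquiv q))
        ∂(((volume.restrict (Icc 0 T)).prod (volume.restrict (Metric.closedBall (0 : Space d) R))).prod
          (volume.restrict (Metric.closedBall (0 : Space d) R)))
      = ∫⁻ t in Icc 0 T, ∫⁻ x in Metric.closedBall (0 : Space d) R,
          ∫⁻ y in Metric.closedBall (0 : Space d) R, F ((t, x), y) := by
        have h1 : ∀ q, ∫⁻ ξ, ‖g ξ‖ₑ ∂(ν 2 (twoPointsEquiv q)) = F q := fun q => rfl
        simp_rw [h1]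
        rw [lintegral_prod _ hFm.aemeasurable, lintegral_prod _
          hFm.lintegral_prod_right'.aemeasurable]
    _ ≤ ∫⁻ t in Icc 0 T, ∫⁻ x in Metric.closedBall (0 : Space d) R, H (t, x) := by
        refine lintegral_mono fun t =>
          setLIntegral_mono (hHm.comp measurable_prodMk_left) fun x hx => ?_
        rw [← lintegral_indicator Metric.isClosed_closedBall.measurableSet]
        simp only [hH]
        rw [← lintegral_sub_left_eq_self _ x]
        refine lintegral_mono fun z => ?_
        by_cases hz : x - z ∈ Metric.closedBall (0 : Space d) R
        · rw [indicator_of_mem hz, hb, indicator_of_mem]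
          · simp
          · rw [mem_closedBall_zero_iff] at hz hx ⊢
            calc ‖z‖ = ‖x - (x - z)‖ := by rw [sub_sub_cancel]
              _ ≤ _ := (norm_sub_le _ _).trans (add_le_add hx hz)
        · rw [indicator_of_notMem hz]
          exact zero_le
    _ ≤ ∫⁻ t in Icc 0 T, N * ∫⁻ x, H (t, x) ∂D.vol :=
        lintegral_mono fun t => hN _ (hHm.comp measurable_prodMk_left) fun a ha x => by
          refine lintegral_congr fun z => ?_
          simp only [hF]
          rw [hν.twoPoint_periodic_left ha, add_sub_right_comm, hν.twoPoint_periodic_right ha]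
    _ = N * ∫⁻ u, b u.1.2 * ‖g u.2‖ₑ ∂(joint D T ν) := by
        rw [lintegral_const_mul _ hHm.lintegral_prod_right', joint,
          Measure.lintegral_compProd (by fun_prop), SpaceDomain.offsets,
          lintegral_prod _ (Measurable.aemeasurable ?_), SpaceDomain.spaceTime,
          lintegral_prod _ (Measurable.aemeasurable ?_)]
        · congr 1
          refine lintegral_congr fun t => lintegral_congr fun x => lintegral_congr fun z => ?_
          exact (lintegral_const_mul (b z) hgm.enorm).symm
        · refine Measurable.lintegral_prod_right'
            (f := fun q => ∫⁻ ξ, b q.2 * ‖g ξ‖ₑ ∂(offsetKernel ν q)) ?_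
          exact Measurable.lintegral_kernel_prod_right'
            (f := fun u : ((ℝ × Space d) × Space d) × (Fin 2 → Phase d) => b u.1.2 * ‖g u.2‖ₑ)
            (by fun_prop)
        · exact Measurable.lintegral_kernel_prod_right'
            (f := fun u : ((ℝ × Space d) × Space d) × (Fin 2 → Phase d) => b u.1.2 * ‖g u.2‖ₑ)
            (by fun_prop)
    _ < ⊤ := ENNReal.mul_lt_top (ENNReal.natCast_lt_top N)
        (hν.lintegral_joint_enorm_lt_top hbm hbi hg)

end IsCorrelationMeasure

/-! ### Integrals over the box as joint integrals -/

/-- `f` is integrable over `[0,T] × D^2`, with integral `a`. -/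
def HasBoxIntegral (D : SpaceDomain) (T : ℝ) (f : ℝ × (Fin 2 → Space d) → ℝ) (a : ℝ) : Prop :=
  IntegrableOn f (D.box T 2) ∧ ∫ z in D.box T 2, f z = a

namespace HasBoxIntegral

variable {D : SpaceDomain} {T : ℝ} {f g : ℝ × (Fin 2 → Space d) → ℝ} {a b : ℝ}

lemma add (hf : HasBoxIntegral D T f a) (hg : HasBoxIntegral D T g b) :
    HasBoxIntegral D T (fun z => f z + g z) (a + b) :=
  ⟨hf.1.add hg.1, by rw [integral_add hf.1 hg.1, hf.2, hg.2]⟩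

lemma neg (hf : HasBoxIntegral D T f a) : HasBoxIntegral D T (fun z => -f z) (-a) :=
  ⟨hf.1.neg, by rw [integral_neg, hf.2]⟩

lemma sum {ι : Type*} (s : Finset ι) {f : ι → ℝ × (Fin 2 → Space d) → ℝ} {a : ι → ℝ}
    (h : ∀ i ∈ s, HasBoxIntegral D T (f i) (a i)) :
    HasBoxIntegral D T (fun z => ∑ i ∈ s, f i z) (∑ i ∈ s, a i) :=
  ⟨integrable_finsetSum _ fun i hi => (h i hi).1, by
    rw [integral_finsetSum _ fun i hi => (h i hi).1]
    exact Finset.sum_congr rfl fun i hi => (h i hi).2⟩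

end HasBoxIntegral

/-- Bridge between the equations, which live on `D × D`, and the joint measure on `D × ℝ^d`: summing
over the periods in the second point unfolds the periodized cutoff into `β` itself. -/
lemma IsCorrelationMeasure.hasBoxIntegral {D : SpaceDomain} {T : ℝ} {ν : Hierarchy d}
    (hν : IsCorrelationMeasure D T ν) {α : ℝ × Space d → ℝ} {β : Space d → ℝ}
    {g : (Fin 2 → Phase d) → ℝ} (hα : IsCoefficient D α) (hβ : IsCutoff β)
    (hg : IsDominatedTwo g) :
    HasBoxIntegral D T
      (fun z => α (z.1, z.2 0) * periodize D β (z.2 0 - z.2 1) * pairing (ν 2) g z)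
      (jointIntegral D T ν α β g) := by
  have := hν.isMarkovKernel_offsetKernel
  have := hν.isMarkovKernel_twoPoint
  obtain ⟨r, hr⟩ := hβ.bounded_support
  have hgm := hg.1
  have hαm := hα.continuous.measurable
  have hGm : Measurable fun q => ∫ ξ, g ξ ∂(twoPoint ν q) :=
    (StronglyMeasurable.integral_kernel hgm.stronglyMeasurable).measurable
  have hi := hν.integrable_joint hα hβ hg
  have hi2 := integrable_integral_of_compProd hi
  have hF : ∀ q : (ℝ × Space d) × Space d, ∫ ξ, α q.1 * β q.2 * g ξ ∂(offsetKernel ν q)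
      = (α (offset q).1 * ∫ ξ, g ξ ∂(twoPoint ν (offset q))) * β q.2 := fun q => by
    rw [integral_const_mul, offsetKernel_apply, offset]
    ring
  simp only [hF] at hi2
  obtain ⟨h1, h2⟩ := integral_offsets_unfold D T
    (F := fun q => α q.1 * ∫ ξ, g ξ ∂(twoPoint ν q)) (by fun_prop)
    (fun a ha p x => by simp only [hν.twoPoint_periodic_right ha]) hβ.continuous hr hi2
  have h3 : ∀ q : (ℝ × Space d) × Space d,
      (α q.1 * ∫ ξ, g ξ ∂(twoPoint ν q)) * periodize D β (q.1.2 - q.2)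
      = (fun z : ℝ × (Fin 2 → Space d) => α (z.1, z.2 0) * periodize D β (z.2 0 - z.2 1)
          * pairing (ν 2) g z) (twoPoints q) := fun q => by
    simp only [twoPoints, pairing, Matrix.cons_val_zero, Matrix.cons_val_one, twoPoint_apply]
    ring
  simp only [h3] at h1 h2
  refine ⟨?_, ?_⟩
  · rw [IntegrableOn, ← (measurePreserving_twoPoints D T).integrable_comp_emb
      twoPointsEquiv.measurableEmbedding]
    exact h1
  · rw [integral_box_two, h2, jointIntegral, joint, Measure.integral_compProd hi]
    exact integral_congr_ae (Eventually.of_forall fun q => (hF q).symm)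

/-! ### Test functions -/

lemma point_eq (q : ℝ × Space d) : point q = (q.1, fun _ => q.2) :=
  Prod.ext rfl (funext fun i => by fin_cases i; rfl)

section TestFunctions

variable {D : SpaceDomain} {I : Set ℝ} {ψ : ℝ × (Fin 1 → Space d) → ℝ}

lemma fderiv_periodic_of_mem (hψ : ψ ∈ testFunctions D I 1) (t : ℝ) (x a : Fin 1 → Space d)
    (ha : ∀ l, D.IsPeriod (a l)) : fderiv ℝ ψ (t, x + a) = fderiv ℝ ψ (t, x) := by
  have h : (fun z : ℝ × (Fin 1 → Space d) => ψ (z + (0, a))) = ψ := by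
    funext z
    have := hψ.2.1 z.1 z.2 a ha
    rw [← this]
    congr 1
    ext1
    · simp
    · simp
  have h2 := fderiv_comp_add_right (𝕜 := ℝ) (f := ψ) (x := (t, x)) (0, a)
  rw [h] at h2
  rw [h2]
  simp

/-- The support of `ψ` is compact only modulo periods, so compactness applies after translation.
Periodicity of `G` makes the translation harmless. -/
lemma exists_bound_of_mem {E : Type*} [NormedAddCommGroup E] (hψ : ψ ∈ testFunctions D I 1)
    {G : ℝ × (Fin 1 → Space d) → E} (hG : Continuous G)
    (hp : ∀ t (x a : Fin 1 → Space d), (∀ l, D.IsPeriod (a l)) → G (t, x + a) = G (t, x))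
    (hs : ∀ z, G z ≠ 0 → z ∈ tsupport ψ) : ∃ C : ℝ, ∀ z, ‖G z‖ ≤ C := by
  obtain ⟨-, -, J, K, hJ, -, hK, hS⟩ := hψ
  -- A point of `tsupport ψ` need not itself satisfy `ψ ≠ 0`; it is within distance `1` of one that
  -- does, and the thickening absorbs this distance.
  have hc : IsCompact (Metric.cthickening 1 (J ×ˢ K)) := (hJ.prod hK).cthickening
  obtain ⟨C, hC⟩ := hc.exists_bound_of_continuousOn hG.continuousOn
  refine ⟨max C 0, fun z => ?_⟩
  by_cases hz : G z = 0
  · simp [hz]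
  · obtain ⟨z', hz', hd⟩ := Metric.mem_closure_iff.1 (hs z hz) 1 one_pos
    obtain ⟨ht, a, ha, hx⟩ := hS z'.1 z'.2 hz'
    rw [show G z = G (z.1, z.2) from rfl, ← hp z.1 z.2 a ha]
    refine (hC _ (Metric.mem_cthickening_of_dist_le _ (z'.1, z'.2 + a) 1 _ ⟨ht, hx⟩ ?_)).trans
      (le_max_left _ _)
    rw [Prod.dist_eq, dist_add_right, ← Prod.dist_eq (x := z) (y := z')]
    exact hd.le

lemma isCoefficient_of_mem (hψ : ψ ∈ testFunctions D I 1) :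
    IsCoefficient D fun p => ψ (point p) where
  continuous := hψ.1.continuous.comp continuous_point
  periodic a ha t x := by
    rw [point_eq, point_eq, ← hψ.2.1 t (fun _ => x) (fun _ => a) fun _ => ha]
    rfl
  bounded := by
    obtain ⟨C, hC⟩ := exists_bound_of_mem hψ hψ.1.continuous hψ.2.1 fun z hz => subset_tsupport _ hz
    exact ⟨C, fun p => hC _⟩

lemma exists_fderiv_bound_of_mem (hψ : ψ ∈ testFunctions D I 1) :
    ∃ C : ℝ, ∀ z, ‖fderiv ℝ ψ z‖ ≤ C :=
  exists_bound_of_mem hψ (hψ.1.continuous_fderiv (by simp)) (fderiv_periodic_of_mem hψ)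
    fun _ hz => support_fderiv_subset ℝ hz

lemma isCoefficient_fderiv_of_mem (hψ : ψ ∈ testFunctions D I 1)
    (v : ℝ × (Fin 1 → Space d)) : IsCoefficient D fun p => fderiv ℝ ψ (point p) v where
  continuous := ((hψ.1.continuous_fderiv (by simp)).comp continuous_point).clm_apply
    continuous_const
  periodic a ha t x := by
    rw [point_eq, point_eq, ← fderiv_periodic_of_mem hψ t (fun _ => x) (fun _ => a) fun _ => ha]
    rfl
  bounded := by
    obtain ⟨C, hC⟩ := exists_fderiv_bound_of_mem hψ
    refine ⟨C * ‖v‖, fun p => ?_⟩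
    rw [← Real.norm_eq_abs]
    exact (ContinuousLinearMap.le_opNorm _ _).trans
      (mul_le_mul_of_nonneg_right (hC _) (norm_nonneg _))

/-- The partial derivative of a function on `ℝ^d`. -/
def partialDeriv (m : Fin d) (w : Space d → ℝ) (x : Space d) : ℝ :=
  fderiv ℝ w x (EuclideanSpace.single m 1)

/-- Smooth functions of bounded support. -/
structure IsSmoothCutoff (w : Space d → ℝ) : Prop where
  contDiff : ContDiff ℝ ∞ w
  bounded_support : ∃ r : ℝ, ∀ z, w z ≠ 0 → ‖z‖ ≤ r

lemma IsSmoothCutoff.isCutoff {w : Space d → ℝ} (hw : IsSmoothCutoff w) : IsCutoff w :=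
  ⟨hw.contDiff.continuous, hw.bounded_support⟩

lemma IsSmoothCutoff.partialDeriv {w : Space d → ℝ} (hw : IsSmoothCutoff w) (m : Fin d) :
    IsCutoff (partialDeriv m w) := by
  obtain ⟨r, hr⟩ := hw.bounded_support
  refine ⟨(hw.contDiff.continuous_fderiv (by simp)).clm_apply continuous_const, r, fun z hz =>
    eq_zero_of_fderiv_ne hr z fun h => hz ?_⟩
  rw [StatEuler.partialDeriv, h]
  rfl

/-! ### Two-point test functions concentrated near the diagonal -/

/-- The test function `ψ(t,x) w(x - y)` on `ℝ × D^2`. -/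
def pairTest (D : SpaceDomain) (ψ : ℝ × (Fin 1 → Space d) → ℝ) (w : Space d → ℝ)
    (z : ℝ × (Fin 2 → Space d)) : ℝ :=
  ψ (z.1, fun _ => z.2 0) * periodize D w (z.2 0 - z.2 1)

lemma hasFDerivAt_pairTest {w : Space d → ℝ} (hψ : ψ ∈ testFunctions D I 1)
    (hw : IsSmoothCutoff w) (z v : ℝ × (Fin 2 → Space d)) :
    fderiv ℝ (pairTest D ψ w) z v
      = fderiv ℝ ψ (z.1, fun _ => z.2 0) (v.1, fun _ => v.2 0) * periodize D w (z.2 0 - z.2 1)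
        + ψ (z.1, fun _ => z.2 0)
          * fderiv ℝ (periodize D w) (z.2 0 - z.2 1) (v.2 0 - v.2 1) := by
  obtain ⟨r, hr⟩ := hw.bounded_support
  let A : ℝ × (Fin 2 → Space d) →L[ℝ] ℝ × (Fin 1 → Space d) :=
    (ContinuousLinearMap.id ℝ ℝ).prodMap
      (ContinuousLinearMap.pi fun _ => ContinuousLinearMap.proj 0)
  let B : ℝ × (Fin 2 → Space d) →L[ℝ] Space d :=
    (ContinuousLinearMap.proj (R := ℝ) (φ := fun _ : Fin 2 => Space d) 0
      - ContinuousLinearMap.proj 1).comp (ContinuousLinearMap.snd ℝ ℝ (Fin 2 → Space d))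
  have h1 : HasFDerivAt (fun z => ψ (A z)) ((fderiv ℝ ψ (A z)).comp A) z :=
    ((hψ.1.differentiable (by simp)) _).hasFDerivAt.comp z A.hasFDerivAt
  have h2 : HasFDerivAt (fun z => periodize D w (B z))
      ((fderiv ℝ (periodize D w) (B z)).comp B) z :=
    (((contDiff_periodize D hr hw.contDiff).differentiable (by simp)) _).hasFDerivAt.comp z
      B.hasFDerivAt
  have h3 : HasFDerivAt (pairTest D ψ w) _ z := h1.mul h2
  rw [h3.fderiv]
  simp only [_root_.add_apply, _root_.smul_apply, smul_eq_mul,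
    ContinuousLinearMap.comp_apply]
  rw [add_comm, mul_comm]
  rfl

lemma dt_pairTest {w : Space d → ℝ} (hψ : ψ ∈ testFunctions D I 1) (hw : IsSmoothCutoff w)
    (z : ℝ × (Fin 2 → Space d)) :
    dt (pairTest D ψ w) z = dt ψ (point (z.1, z.2 0)) * periodize D w (z.2 0 - z.2 1) := by
  rw [dt, hasFDerivAt_pairTest hψ hw, dt, point_eq]
  simp only [Pi.zero_apply, sub_self, map_zero, mul_zero, add_zero]
  rfl

lemma dx_zero_pairTest {w : Space d → ℝ} (hψ : ψ ∈ testFunctions D I 1) (hw : IsSmoothCutoff w)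
    (m : Fin d) (z : ℝ × (Fin 2 → Space d)) :
    dx 0 m (pairTest D ψ w) z
      = dx 0 m ψ (point (z.1, z.2 0)) * periodize D w (z.2 0 - z.2 1)
        + ψ (point (z.1, z.2 0)) * periodize D (partialDeriv m w) (z.2 0 - z.2 1) := by
  obtain ⟨r, hr⟩ := hw.bounded_support
  have h : (fun _ : Fin 1 => (EuclideanSpace.single m 1 : Space d))
      = (Pi.single 0 (EuclideanSpace.single m 1) : Fin 1 → Space d) := by
    funext i
    fin_cases i
    simp
  rw [dx, hasFDerivAt_pairTest hψ hw, dx, point_eq, fderiv_periodize D hr hw.contDiff]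
  simp only [Pi.single_eq_same, ne_eq, one_ne_zero, not_false_eq_true, Pi.single_eq_of_ne, sub_zero,
    h]
  rfl

lemma dx_one_pairTest {w : Space d → ℝ} (hψ : ψ ∈ testFunctions D I 1) (hw : IsSmoothCutoff w)
    (m : Fin d) (z : ℝ × (Fin 2 → Space d)) :
    dx 1 m (pairTest D ψ w) z
      = -(ψ (point (z.1, z.2 0)) * periodize D (partialDeriv m w) (z.2 0 - z.2 1)) := by
  obtain ⟨r, hr⟩ := hw.bounded_support
  have h : (fun _ : Fin 1 => (0 : Space d)) = 0 := rfl
  rw [dx, hasFDerivAt_pairTest hψ hw, point_eq]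
  simp only [Pi.single_eq_same, ne_eq, zero_ne_one, not_false_eq_true, Pi.single_eq_of_ne, zero_sub,
    h, map_neg]
  rw [fderiv_periodize D hr hw.contDiff]
  rw [show ((0 : ℝ), (0 : Fin 1 → Space d)) = 0 from rfl, map_zero]
  rw [zero_mul, zero_add, mul_neg]
  rfl

lemma pairTest_mem {w : Space d → ℝ} (hψ : ψ ∈ testFunctions D I 1) (hw : IsSmoothCutoff w) :
    pairTest D ψ w ∈ testFunctions D I 2 := by
  obtain ⟨r, hr⟩ := hw.bounded_support
  obtain ⟨hs, hp, J, K, hJ, hJI, hK, hS⟩ := hψ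
  -- The first point stays in the compact set of `ψ`; the second is the first minus a vector of norm
  -- at most `r`.
  refine ⟨?_, ?_, J, Set.pi univ ![(fun x => x 0) '' K,
    (fun q : Space d × Space d => q.1 + q.2) ''
      (((fun x => x 0) '' K) ×ˢ Metric.closedBall 0 r)], hJ, hJI, ?_, ?_⟩
  · have h1 := contDiff_periodize D hr hw.contDiff
    unfold pairTest
    fun_prop
  · intro t x a ha
    unfold pairTest
    have h1 := hp t (fun _ => x 0) (fun _ => a 0) fun _ => ha 0
    have h2 := periodize_add D w (D.periods.sub_mem (ha 0) (ha 1)) (x 0 - x 1)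
    rw [← h1, ← h2]
    congr 2
    simp only [Pi.add_apply]
    abel
  · refine isCompact_univ_pi fun i => ?_
    have h0 : IsCompact ((fun x : Fin 1 → Space d => x 0) '' K) := hK.image (by fun_prop)
    fin_cases i
    · exact h0
    · exact (h0.prod (isCompact_closedBall _ _)).image (by fun_prop)
  · intro t x hx
    unfold pairTest at hx
    obtain ⟨ht, a, ha, hxa⟩ := hS _ _ (left_ne_zero_of_mul hx)
    refine ⟨ht, ?_⟩
    obtain ⟨b, hb⟩ : ∃ b : D.periods (d := d), w (b + (x 0 - x 1)) ≠ 0 := by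
      by_contra hcon
      push Not at hcon
      refine right_ne_zero_of_mul hx ?_
      simp only [periodize, hcon, tsum_zero]
    -- The period `a 0` brings the first point into its compact set, and `b` is the period for which
    -- `b + (x - y)` lies in the support of `w`. With the shift `a 0 - b` the second point becomes
    -- `(x + a 0) - (b + (x - y))`.
    refine ⟨![a 0, a 0 - b], fun l => ?_, fun i _ => ?_⟩
    · fin_cases l
      · exact ha 0
      · exact D.periods.sub_mem (ha 0) b.2
    · have h0 : x 0 + a 0 ∈ (fun x : Fin 1 → Space d => x 0) '' K := ⟨_, hxa, rfl⟩
      fin_cases i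
      · exact h0
      · refine ⟨(x 0 + a 0, -(b + (x 0 - x 1))), ⟨h0, ?_⟩, ?_⟩
        · rw [mem_closedBall_zero_iff, norm_neg]
          exact hr _ hb
        · simp only [Fin.mk_one, Pi.add_apply, Matrix.cons_val_one, Matrix.cons_val_fin_one]
          abel

lemma testFunctions_mono {I' : Set ℝ} (h : I ⊆ I') {k : ℕ} {φ : ℝ × (Fin k → Space d) → ℝ}
    (hφ : φ ∈ testFunctions D I k) : φ ∈ testFunctions D I' k := by
  obtain ⟨h1, h2, J, K, hJ, hJI, hK, hS⟩ := hφ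
  exact ⟨h1, h2, J, K, hJ, hJI.trans h, hK, hS⟩

/-- The exchange of the two points as a linear map. -/
def exchangeCLM : ℝ × (Fin 2 → Space d) →L[ℝ] ℝ × (Fin 2 → Space d) :=
  (ContinuousLinearMap.id ℝ ℝ).prodMap
    (ContinuousLinearMap.pi fun i => ContinuousLinearMap.proj (Equiv.swap 0 1 i))

lemma comp_exchangeCLM_mem {φ : ℝ × (Fin 2 → Space d) → ℝ} (hφ : φ ∈ testFunctions D I 2) :
    (fun z => φ (exchangeCLM z)) ∈ testFunctions D I 2 := by
  obtain ⟨h1, h2, J, K, hJ, hJI, hK, hS⟩ := hφ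
  have hE : ∀ z : ℝ × (Fin 2 → Space d),
      exchangeCLM z = (z.1, z.2 ∘ Equiv.swap 0 1) := fun _ => rfl
  refine ⟨h1.comp exchangeCLM.contDiff, fun t x a ha => ?_, J,
    (fun x => x ∘ Equiv.swap 0 1) '' K, hJ, hJI, hK.image (by fun_prop), fun t x hx => ?_⟩
  · exact h2 t (x ∘ Equiv.swap 0 1) (a ∘ Equiv.swap 0 1) fun l => ha _
  · obtain ⟨ht, a, ha, hxa⟩ := hS t (x ∘ Equiv.swap 0 1) hx
    refine ⟨ht, a ∘ Equiv.swap 0 1, fun l => ha _, _, hxa, ?_⟩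
    funext i
    simp

lemma dx_one_comp_exchangeCLM {φ : ℝ × (Fin 2 → Space d) → ℝ} (hφ : φ ∈ testFunctions D I 2)
    (m : Fin d) (z : ℝ × (Fin 2 → Space d)) :
    dx 1 m (fun z => φ (exchangeCLM z)) z = dx 0 m φ (exchangeCLM z) := by
  have h : HasFDerivAt (fun z => φ (exchangeCLM z))
      ((fderiv ℝ φ (exchangeCLM z)).comp exchangeCLM) z :=
    ((hφ.1.differentiable (by simp)) _).hasFDerivAt.comp z exchangeCLM.hasFDerivAt
  rw [dx, h.fderiv, dx, ContinuousLinearMap.comp_apply]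
  congr 1
  refine Prod.ext rfl (funext fun i => ?_)
  fin_cases i <;> simp [exchangeCLM]

end TestFunctions

/-! ### Domination of the moments in the balance equations -/

/-- The larger of the two speeds. -/
def maxSpeed (ξ : Fin 2 → Phase d) : ℝ := max ‖(ξ 0).1‖ ‖(ξ 1).1‖

lemma maxSpeed_nonneg (ξ : Fin 2 → Phase d) : 0 ≤ maxSpeed ξ :=
  (norm_nonneg _).trans (le_max_left _ _)

lemma maxSpeed_pow_le (ξ : Fin 2 → Phase d) (n : ℕ) :
    maxSpeed ξ ^ n ≤ ‖(ξ 0).1‖ ^ n + ‖(ξ 1).1‖ ^ n := by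
  have h0 : 0 ≤ ‖(ξ 0).1‖ ^ n := by positivity
  have h1 : 0 ≤ ‖(ξ 1).1‖ ^ n := by positivity
  rcases max_cases ‖(ξ 0).1‖ ‖(ξ 1).1‖ with h | h <;> rw [maxSpeed, h.1] <;> linarith

lemma abs_coord_zero_le (ξ : Fin 2 → Phase d) (j : Fin d) : |(ξ 0).1 j| ≤ maxSpeed ξ :=
  (PiLp.norm_apply_le (ξ 0).1 j).trans (le_max_left _ _)

lemma abs_coord_one_le (ξ : Fin 2 → Phase d) (j : Fin d) : |(ξ 1).1 j| ≤ maxSpeed ξ :=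
  (PiLp.norm_apply_le (ξ 1).1 j).trans (le_max_right _ _)

lemma norm_zero_le (ξ : Fin 2 → Phase d) : ‖(ξ 0).1‖ ≤ maxSpeed ξ := le_max_left _ _

lemma norm_one_le (ξ : Fin 2 → Phase d) : ‖(ξ 1).1‖ ≤ maxSpeed ξ := le_max_right _ _

lemma maxSpeed_sq_le (ξ : Fin 2 → Phase d) : maxSpeed ξ ^ 2 ≤ weight (ξ 0) + weight (ξ 1) := by
  refine (maxSpeed_pow_le ξ 2).trans ?_
  unfold weight
  have h : ∀ i, 0 ≤ ‖(ξ i).1‖ ^ 3 + |(ξ i).2| ^ (3 / 2 : ℝ) := fun i => by positivity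
  linarith [h 0, h 1]

lemma maxSpeed_cube_le (ξ : Fin 2 → Phase d) : maxSpeed ξ ^ 3 ≤ weight (ξ 0) + weight (ξ 1) := by
  refine (maxSpeed_pow_le ξ 3).trans ?_
  unfold weight
  have h : ∀ i, 0 ≤ ‖(ξ i).1‖ ^ 2 + |(ξ i).2| ^ (3 / 2 : ℝ) := fun i => by positivity
  linarith [h 0, h 1]

/-- Young's inequality with exponents `3/2` and `3`, the factors `2/3` and `1/3` being dropped. It
is the reason why `|v|³` and `|p|^{3/2}` are the moments that control the pressure flux `p v`. -/
lemma mul_le_rpow_add_cube {a b : ℝ} (ha : 0 ≤ a) (hb : 0 ≤ b) :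
    a * b ≤ a ^ (3 / 2 : ℝ) + b ^ 3 := by
  have h := Real.young_inequality_of_nonneg ha hb
    (show (3 / 2 : ℝ).HolderConjugate 3 from Real.holderConjugate_iff.2 (by norm_num))
  have h1 : 0 ≤ a ^ (3 / 2 : ℝ) := by positivity
  have h2 : 0 ≤ b ^ 3 := by positivity
  have h3 : b ^ (3 : ℝ) = b ^ 3 := by exact_mod_cast Real.rpow_natCast b 3
  rw [h3] at h
  linarith

lemma abs_press_mul_maxSpeed_le (ξ : Fin 2 → Phase d) (i : Fin 2) :
    |(ξ i).2| * maxSpeed ξ ≤ weight (ξ 0) + weight (ξ 1) := by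
  have h0 := mul_le_rpow_add_cube (abs_nonneg (ξ i).2) (maxSpeed_nonneg ξ)
  have h1 := maxSpeed_pow_le ξ 3
  unfold weight
  have h : ∀ i, 0 ≤ |(ξ i).2| ^ (3 / 2 : ℝ) := fun i => by positivity
  have h' : ∀ i, 0 ≤ ‖(ξ i).1‖ ^ 2 := fun i => by positivity
  fin_cases i
  · simp only [Fin.zero_eta, Fin.isValue] at h0 ⊢
    linarith [h 1, h' 0, h' 1]
  · simp only [Fin.mk_one, Fin.isValue] at h0 ⊢
    linarith [h 0, h' 0, h' 1]

@[fun_prop]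
lemma measurable_coord (j : Fin d) : Measurable fun ζ : Phase d => ζ.1 j := by fun_prop

lemma isDominatedTwo_vel (j : Fin d) :
    IsDominatedTwo fun ξ : Fin 2 → Phase d => (ξ 0).1 j * (ξ 1).1 j := by
  refine ⟨by fun_prop, 1, fun ξ => ?_⟩
  rw [one_mul, abs_mul]
  refine le_trans ?_ (maxSpeed_sq_le ξ)
  rw [sq]
  exact mul_le_mul (abs_coord_zero_le ξ j) (abs_coord_one_le ξ j) (abs_nonneg _)
    (maxSpeed_nonneg ξ)

lemma abs_mul_mul_le {a b c M : ℝ} (ha : |a| ≤ M) (hb : |b| ≤ M) (hc : |c| ≤ M) :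
    |a * (b * c)| ≤ M ^ 3 := by
  rw [abs_mul, abs_mul, show M ^ 3 = M * (M * M) by ring]
  have := abs_nonneg a
  have := abs_nonneg b
  have := abs_nonneg c
  have : 0 ≤ M := by linarith
  gcongr

lemma abs_coord_le (ξ : Fin 2 → Phase d) (l : Fin 2) (j : Fin d) : |(ξ l).1 j| ≤ maxSpeed ξ := by
  fin_cases l
  · exact abs_coord_zero_le ξ j
  · exact abs_coord_one_le ξ j

lemma isDominatedTwo_vel_vel (l : Fin 2) (m j : Fin d) :
    IsDominatedTwo fun ξ : Fin 2 → Phase d => (ξ l).1 m * ((ξ 0).1 j * (ξ 1).1 j) := by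
  refine ⟨by fun_prop, 1, fun ξ => ?_⟩
  rw [one_mul]
  exact (abs_mul_mul_le (abs_coord_le ξ l m) (abs_coord_zero_le ξ j) (abs_coord_one_le ξ j)).trans
    (maxSpeed_cube_le ξ)

lemma isDominatedTwo_press (l k : Fin 2) (j : Fin d) :
    IsDominatedTwo fun ξ : Fin 2 → Phase d => (ξ l).2 * (ξ k).1 j := by
  refine ⟨by fun_prop, 1, fun ξ => ?_⟩
  rw [one_mul, abs_mul]
  refine le_trans ?_ (abs_press_mul_maxSpeed_le ξ l)
  gcongr
  exact abs_coord_le ξ k j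

lemma norm_le_maxSpeed (ξ : Fin 2 → Phase d) (l : Fin 2) : ‖(ξ l).1‖ ≤ maxSpeed ξ := by
  fin_cases l
  · exact norm_zero_le ξ
  · exact norm_one_le ξ

lemma isDominatedTwo_speed (l k : Fin 2) (j : Fin d) :
    IsDominatedTwo fun ξ : Fin 2 → Phase d => ‖(ξ l).1‖ ^ 2 * (ξ k).1 j := by
  refine ⟨by fun_prop, 1, fun ξ => ?_⟩
  simp only [one_mul, sq, mul_assoc]
  refine le_trans ?_ (maxSpeed_cube_le ξ)
  refine abs_mul_mul_le ?_ ?_ (abs_coord_le ξ k j)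
  all_goals rw [abs_norm]; exact norm_le_maxSpeed ξ l

lemma isDominatedTwo_diff (m : Fin d) : IsDominatedTwo fun ξ : Fin 2 → Phase d =>
    ‖(ξ 0).1 - (ξ 1).1‖ ^ 2 * ((ξ 0).1 m - (ξ 1).1 m) := by
  -- `8 = 2³`, since an increment is at most twice the larger speed.
  refine ⟨by fun_prop, 8, fun ξ => ?_⟩
  have h1 : ‖(ξ 0).1 - (ξ 1).1‖ ≤ 2 * maxSpeed ξ :=
    (norm_sub_le _ _).trans (by linarith [norm_zero_le ξ, norm_one_le ξ])
  have h2 : |(ξ 0).1 m - (ξ 1).1 m| ≤ 2 * maxSpeed ξ :=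
    (PiLp.norm_apply_le ((ξ 0).1 - (ξ 1).1) m).trans h1
  simp only [sq, mul_assoc]
  refine (abs_mul_mul_le ((abs_norm _).le.trans h1) ((abs_norm _).le.trans h1) h2).trans ?_
  linarith [maxSpeed_cube_le ξ]

lemma isDominatedTwo_diff_cube : IsDominatedTwo fun ξ : Fin 2 → Phase d =>
    ‖(ξ 0).1 - (ξ 1).1‖ ^ 3 := by
  refine ⟨by fun_prop, 8, fun ξ => ?_⟩
  have h1 : ‖(ξ 0).1 - (ξ 1).1‖ ≤ 2 * maxSpeed ξ :=
    (norm_sub_le _ _).trans (by linarith [norm_zero_le ξ, norm_one_le ξ])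
  rw [abs_of_nonneg (by positivity)]
  refine (pow_le_pow_left₀ (norm_nonneg _) h1 3).trans ?_
  linarith [maxSpeed_cube_le ξ]

lemma IsDominatedTwo.diag {g : (Fin 2 → Phase d) → ℝ} (hg : IsDominatedTwo g) :
    IsDominatedOne fun ζ => g fun _ => ζ := by
  obtain ⟨hm, C, hC⟩ := hg
  refine ⟨hm.comp (by fun_prop), 2 * C, fun ζ => (hC _).trans (le_of_eq (by ring))⟩

/-! ### Linearity of the joint integral -/

namespace IsCorrelationMeasure

variable {D : SpaceDomain} {T : ℝ} {ν : Hierarchy d} {α : ℝ × Space d → ℝ} {β : Space d → ℝ}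
  {g h : (Fin 2 → Phase d) → ℝ}

lemma jointIntegral_add (hν : IsCorrelationMeasure D T ν) (hα : IsCoefficient D α)
    (hβ : IsCutoff β) (hg : IsDominatedTwo g) (hh : IsDominatedTwo h) :
    jointIntegral D T ν α β (fun ξ => g ξ + h ξ)
      = jointIntegral D T ν α β g + jointIntegral D T ν α β h := by
  unfold jointIntegral
  rw [← integral_add (hν.integrable_joint hα hβ hg) (hν.integrable_joint hα hβ hh)]
  simp_rw [mul_add]

lemma jointIntegral_sub (hν : IsCorrelationMeasure D T ν) (hα : IsCoefficient D α)
    (hβ : IsCutoff β) (hg : IsDominatedTwo g) (hh : IsDominatedTwo h) :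
    jointIntegral D T ν α β (fun ξ => g ξ - h ξ)
      = jointIntegral D T ν α β g - jointIntegral D T ν α β h := by
  unfold jointIntegral
  rw [← integral_sub (hν.integrable_joint hα hβ hg) (hν.integrable_joint hα hβ hh)]
  simp_rw [mul_sub]

lemma jointIntegral_sum (hν : IsCorrelationMeasure D T ν) (hα : IsCoefficient D α)
    (hβ : IsCutoff β) {ι : Type*} (s : Finset ι) {g : ι → (Fin 2 → Phase d) → ℝ}
    (hg : ∀ i ∈ s, IsDominatedTwo (g i)) :
    jointIntegral D T ν α β (fun ξ => ∑ i ∈ s, g i ξ)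
      = ∑ i ∈ s, jointIntegral D T ν α β (g i) := by
  unfold jointIntegral
  rw [← integral_finsetSum _ fun i hi => hν.integrable_joint hα hβ (hg i hi)]
  simp_rw [Finset.mul_sum]

end IsCorrelationMeasure

lemma jointIntegral_const_mul (D : SpaceDomain) (T : ℝ) (ν : Hierarchy d) (α : ℝ × Space d → ℝ)
    (β : Space d → ℝ) (g : (Fin 2 → Phase d) → ℝ) (c : ℝ) :
    jointIntegral D T ν α β (fun ξ => c * g ξ) = c * jointIntegral D T ν α β g := by
  unfold jointIntegral
  rw [← integral_const_mul]
  simp_rw [mul_left_comm]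

/-! ### The equations for the two-point measures tested at nearby points -/

section Equations

variable {D : SpaceDomain} {T : ℝ} {ν : Hierarchy d} {ψ : ℝ × (Fin 1 → Space d) → ℝ}
  {w : Space d → ℝ}

/-- The evolution equation for `k = 2` and `i₁ = i₂ = j`, tested with `ψ(t,x) w(x - y)`. A
derivative in `x` falls on both factors, whereas one in `y` falls on `w` only and changes sign. This
asymmetry is why the two points contribute different numbers of terms. -/
lemma IsStatisticalSolution.evolution_pair (hν : IsStatisticalSolution D T ν)
    (hψ : ψ ∈ testFunctions D (Ioo 0 T) 1) (hw : IsSmoothCutoff w) (j : Fin d) :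
    jointIntegral D T ν (fun p => dt ψ (point p)) w (fun ξ => (ξ 0).1 j * (ξ 1).1 j)
      + (∑ m, (jointIntegral D T ν (fun p => dx 0 m ψ (point p)) w
            (fun ξ => (ξ 0).1 m * ((ξ 0).1 j * (ξ 1).1 j))
          + jointIntegral D T ν (fun p => ψ (point p)) (partialDeriv m w)
            (fun ξ => (ξ 0).1 m * ((ξ 0).1 j * (ξ 1).1 j)))
        + ∑ m, -jointIntegral D T ν (fun p => ψ (point p)) (partialDeriv m w)
            (fun ξ => (ξ 1).1 m * ((ξ 0).1 j * (ξ 1).1 j)))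
      + ((jointIntegral D T ν (fun p => dx 0 j ψ (point p)) w (fun ξ => (ξ 0).2 * (ξ 1).1 j)
          + jointIntegral D T ν (fun p => ψ (point p)) (partialDeriv j w)
            (fun ξ => (ξ 0).2 * (ξ 1).1 j))
        + -jointIntegral D T ν (fun p => ψ (point p)) (partialDeriv j w)
            (fun ξ => (ξ 1).2 * (ξ 0).1 j)) = 0 := by
  have hc := hν.toIsCorrelationMeasure
  have hψ0 := isCoefficient_of_mem hψ
  have hψt : IsCoefficient D fun p => dt ψ (point p) := isCoefficient_fderiv_of_mem hψ _
  have hψx : ∀ m, IsCoefficient D fun p => dx 0 m ψ (point p) := fun m =>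
    isCoefficient_fderiv_of_mem hψ _
  have hvel : velProd (fun _ : Fin 2 => j) = fun ξ => (ξ 0).1 j * (ξ 1).1 j := by
    funext ξ
    simp [velProd, Fin.prod_univ_two]
  have hp0 : pressProd (fun _ : Fin 2 => j) 0 = fun ξ => (ξ 0).2 * (ξ 1).1 j := by
    funext ξ
    rw [pressProd, show Finset.univ.erase (0 : Fin 2) = {1} by decide, Finset.prod_singleton]
  have hp1 : pressProd (fun _ : Fin 2 => j) 1 = fun ξ => (ξ 1).2 * (ξ 0).1 j := by
    funext ξ
    rw [pressProd, show Finset.univ.erase (1 : Fin 2) = {0} by decide, Finset.prod_singleton]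
  have hE := hν.evolution 2 one_le_two (fun _ => j)
    (by rw [hvel]; exact hc.locIntegrable_two (isDominatedTwo_vel j))
    (fun l m => by rw [hvel]; exact hc.locIntegrable_two (isDominatedTwo_vel_vel l m j))
    (fun l => by
      fin_cases l
      · simp only [Fin.zero_eta, hp0]
        exact hc.locIntegrable_two (isDominatedTwo_press 0 1 j)
      · simp only [Fin.mk_one, hp1]
        exact hc.locIntegrable_two (isDominatedTwo_press 1 0 j))
    (pairTest D ψ w) (pairTest_mem hψ hw)
  have hwc := hw.isCutoff
  have hB := ((hc.hasBoxIntegral hψt hwc (isDominatedTwo_vel j)).add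
    ((HasBoxIntegral.sum Finset.univ fun m _ =>
      (hc.hasBoxIntegral (hψx m) hwc (isDominatedTwo_vel_vel 0 m j)).add
        (hc.hasBoxIntegral hψ0 (hw.partialDeriv m) (isDominatedTwo_vel_vel 0 m j))).add
      (HasBoxIntegral.sum Finset.univ fun m _ =>
        (hc.hasBoxIntegral hψ0 (hw.partialDeriv m) (isDominatedTwo_vel_vel 1 m j)).neg))).add
    (((hc.hasBoxIntegral (hψx j) hwc (isDominatedTwo_press 0 1 j)).add
      (hc.hasBoxIntegral hψ0 (hw.partialDeriv j) (isDominatedTwo_press 0 1 j))).add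
      (hc.hasBoxIntegral hψ0 (hw.partialDeriv j) (isDominatedTwo_press 1 0 j)).neg)
  rw [← hB.2, ← hE]
  refine congrArg _ (funext fun z => ?_)
  simp only [momentIntegrand, Fin.sum_univ_two, hvel, hp0, hp1, dt_pairTest hψ hw,
    dx_zero_pairTest hψ hw, dx_one_pairTest hψ hw]
  congr 1
  · congr 1
    · ring
    · congr 1 <;> refine Finset.sum_congr rfl fun m _ => ?_ <;> ring
  · ring

/-- The first-point observables that the divergence constraint admits. -/
structure IsAdmissible (D : SpaceDomain) (T : ℝ) (ν : Hierarchy d) (g : Phase d → ℝ) : Prop where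
  continuous : Continuous g
  finite : ∀ᵐ p ∂(D.spaceTime T), ∫⁻ ζ, ‖g ζ‖ₑ ∂(onePoint ν p) < ⊤
  dominated : ∀ l k (m : Fin d), IsDominatedTwo fun ξ : Fin 2 → Phase d => g (ξ l) * (ξ k).1 m

lemma IsStatisticalSolution.divergence_free_two (hν : IsStatisticalSolution D T ν)
    {g : Phase d → ℝ} (hg : IsAdmissible D T ν g) {φ : ℝ × (Fin 2 → Space d) → ℝ}
    (hφ : φ ∈ testFunctions D univ 2) :
    ∫ z in D.box T 2, ∑ m, dx 1 m φ z *
      pairing (ν 2) (fun ξ => g (ξ 0) * (ξ 1).1 m) z = 0 := by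
  refine hν.divergence_free 1 (fun ξ => g (ξ 0)) (hg.continuous.comp (continuous_apply 0)) ?_
    (fun m => hν.toIsCorrelationMeasure.locIntegrable_two (hg.dominated 0 1 m)) φ hφ
  refine ae_box_one ?_
  filter_upwards [hg.finite] with p hp
  rwa [lintegral_onePoint ν p (h := fun ζ => ‖g ζ‖ₑ) hg.continuous.measurable.enorm] at hp

/-- The constraint is used in the second point, where `ψ` is constant, so no derivative of `ψ`
appears. -/
lemma IsStatisticalSolution.divergence_free_pair (hν : IsStatisticalSolution D T ν)
    (hψ : ψ ∈ testFunctions D (Ioo 0 T) 1) (hw : IsSmoothCutoff w) {g : Phase d → ℝ}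
    (hg : IsAdmissible D T ν g) :
    ∑ m, jointIntegral D T ν (fun p => ψ (point p)) (partialDeriv m w)
      (fun ξ => g (ξ 0) * (ξ 1).1 m) = 0 := by
  have hc := hν.toIsCorrelationMeasure
  have hB := HasBoxIntegral.sum Finset.univ fun m _ =>
    (hc.hasBoxIntegral (isCoefficient_of_mem hψ) (hw.partialDeriv m) (hg.dominated 0 1 m)).neg
  have h := hν.divergence_free_two hg (testFunctions_mono (subset_univ _) (pairTest_mem hψ hw))
  simp only [dx_one_pairTest hψ hw, neg_mul] at h
  have h2 := hB.2.symm.trans h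
  rwa [Finset.sum_neg_distrib, neg_eq_zero] at h2

/-- The divergence constraint is assumed in the last point only. Testing it with the exchanged test
function and using the symmetry of `ν²` gives it in the first point, where the derivative also hits
`ψ`. -/
lemma IsStatisticalSolution.divergence_free_pair_swap (hν : IsStatisticalSolution D T ν)
    (hψ : ψ ∈ testFunctions D (Ioo 0 T) 1) (hw : IsSmoothCutoff w) {g : Phase d → ℝ}
    (hg : IsAdmissible D T ν g) :
    ∑ m, (jointIntegral D T ν (fun p => dx 0 m ψ (point p)) w (fun ξ => g (ξ 1) * (ξ 0).1 m)
      + jointIntegral D T ν (fun p => ψ (point p)) (partialDeriv m w)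
      (fun ξ => g (ξ 1) * (ξ 0).1 m)) = 0 := by
  have hc := hν.toIsCorrelationMeasure
  have hψx : ∀ m, IsCoefficient D fun p => dx 0 m ψ (point p) := fun m =>
    isCoefficient_fderiv_of_mem hψ _
  have hB := HasBoxIntegral.sum Finset.univ fun m _ =>
    (hc.hasBoxIntegral (hψx m) hw.isCutoff (hg.dominated 1 0 m)).add
    (hc.hasBoxIntegral (isCoefficient_of_mem hψ) (hw.partialDeriv m) (hg.dominated 1 0 m))
  have hm := pairTest_mem hψ hw
  have h := hν.divergence_free_two hg
    (testFunctions_mono (subset_univ _) (comp_exchangeCLM_mem hm))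
  simp only [dx_one_comp_exchangeCLM hm] at h
  rw [← hB.2, integral_box_two, ← integral_exchange]
  rw [integral_box_two] at h
  rw [← h]
  refine integral_congr_ae ?_
  filter_upwards [hc.ae_map_exchange] with q hq
  refine Finset.sum_congr rfl fun m _ => ?_
  have h1 : exchangeCLM (twoPoints q) = twoPoints (exchange q) := by
    refine Prod.ext rfl (funext fun i => ?_)
    fin_cases i <;> rfl
  have h2 : pairing (ν 2) (fun ξ => g (ξ 0) * (ξ 1).1 m) (twoPoints q)
      = pairing (ν 2) (fun ξ => g (ξ 1) * (ξ 0).1 m) (twoPoints (exchange q)) := by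
    change ∫ ξ, g (ξ 0) * (ξ 1).1 m ∂(twoPoint ν q) = _
    have hm : Measurable fun ξ : Fin 2 → Phase d => ξ ∘ Equiv.swap (0 : Fin 2) 1 := by fun_prop
    rw [← hq, integral_map hm.aemeasurable (hg.dominated 0 1 m).1.aestronglyMeasurable]
    rfl
  rw [h1, h2, dx_zero_pairTest hψ hw]
  ring

end Equations

section Identity

variable {D : SpaceDomain} {T : ℝ} {ν : Hierarchy d} {ψ : ℝ × (Fin 1 → Space d) → ℝ}
  {w : Space d → ℝ}

/-! ### Integration by parts -/

lemma IsCutoff.integrable_mul {f β : Space d → ℝ} (hf : Continuous f) (hβ : IsCutoff β) :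
    Integrable fun z => f z * β z := by
  obtain ⟨r, hr⟩ := hβ.bounded_support
  exact (IsCutoff.mk (hf.mul hβ.continuous)
    ⟨r, fun z hz => hr z (right_ne_zero_of_mul hz)⟩).integrable

lemma integral_partialDeriv_eq_zero (hw : IsSmoothCutoff w) (m : Fin d) :
    ∫ z, partialDeriv m w z = 0 := by
  have h := integral_mul_fderiv_eq_neg_fderiv_mul_of_integrable (𝕜 := ℝ) (μ := volume)
    (f := fun _ : Space d => (1 : ℝ)) (g := w) (v := EuclideanSpace.single m 1)
    (by simp) (by simp only [one_mul]; exact (hw.partialDeriv m).integrable)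
    (by simpa only [one_mul] using hw.isCutoff.integrable)
    (by fun_prop) (fun x _ => hw.contDiff.differentiable (by simp) x)
  simpa [partialDeriv] using h

/-- Once the base point has been shifted by `z`, a derivative of `ψ` in `z` is its derivative in
`x`, so integration by parts in the offset carries `∂_m` from `w` to `ψ`. -/
lemma integral_mul_partialDeriv (hψ : ψ ∈ testFunctions D (Ioo 0 T) 1) (hw : IsSmoothCutoff w)
    (m : Fin d) (p : ℝ × Space d) :
    ∫ z, ψ (point (p.1, p.2 + z)) * partialDeriv m w z
      = -∫ z, dx 0 m ψ (point (p.1, p.2 + z)) * w z := by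
  let A : Space d →L[ℝ] ℝ × (Fin 1 → Space d) :=
    (0 : Space d →L[ℝ] ℝ).prod (ContinuousLinearMap.pi fun _ => ContinuousLinearMap.id ℝ (Space d))
  have hA : ∀ z, point (p.1, p.2 + z) = point p + A z := fun z => by
    simp only [point_eq]
    refine Prod.ext (by simp [A]) (funext fun i => by simp [A])
  have hd : ∀ z, HasFDerivAt (fun z => ψ (point (p.1, p.2 + z)))
      ((fderiv ℝ ψ (point (p.1, p.2 + z))).comp A) z := fun z => by
    simp only [hA]
    exact ((hψ.1.differentiable (by simp)) _).hasFDerivAt.comp z (A.hasFDerivAt.const_add _)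
  have hf : ∀ z, fderiv ℝ (fun z => ψ (point (p.1, p.2 + z))) z (EuclideanSpace.single m 1)
      = dx 0 m ψ (point (p.1, p.2 + z)) := fun z => by
    rw [(hd z).fderiv, dx, ContinuousLinearMap.comp_apply]
    congr 1
    refine Prod.ext rfl (funext fun i => ?_)
    fin_cases i
    simp [A]
  have hc0 := (isCoefficient_of_mem hψ).continuous
  have hc1 : Continuous fun p => dx 0 m ψ (point p) :=
    (isCoefficient_fderiv_of_mem hψ _).continuous
  have hcA : Continuous fun z : Space d => (p.1, p.2 + z) := by fun_prop
  have h := integral_mul_fderiv_eq_neg_fderiv_mul_of_integrable (𝕜 := ℝ) (μ := volume)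
    (f := fun z => ψ (point (p.1, p.2 + z))) (g := w) (v := EuclideanSpace.single m 1)
    (by simp only [hf]; exact IsCutoff.integrable_mul (hc1.comp hcA) hw.isCutoff)
    (IsCutoff.integrable_mul (hc0.comp hcA) (hw.partialDeriv m))
    (IsCutoff.integrable_mul (hc0.comp hcA) hw.isCutoff)
    (fun z _ => (hd z).differentiableAt) (fun x _ => hw.contDiff.differentiable (by simp) x)
  simp only [hf] at h
  exact h

lemma IsCorrelationMeasure.jointIntegral_partialDeriv_zero (hν : IsCorrelationMeasure D T ν)
    (hψ : ψ ∈ testFunctions D (Ioo 0 T) 1) (hw : IsSmoothCutoff w) (m : Fin d) {g : Phase d → ℝ}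
    (hg : IsDominatedOne g) :
    jointIntegral D T ν (fun p => ψ (point p)) (partialDeriv m w) (fun ξ => g (ξ 0)) = 0 := by
  rw [hν.jointIntegral_zero (isCoefficient_of_mem hψ) (hw.partialDeriv m) hg,
    integral_partialDeriv_eq_zero hw, mul_zero]

/-- For an observable of the second value, `jointIntegral_one` leaves `z` only in `ψ(t, x + z)` and
in the cutoff, and the integration by parts applies pointwise in `(t,x)`. -/
lemma IsCorrelationMeasure.jointIntegral_partialDeriv_one (hν : IsCorrelationMeasure D T ν)
    (hψ : ψ ∈ testFunctions D (Ioo 0 T) 1) (hw : IsSmoothCutoff w) (m : Fin d) {g : Phase d → ℝ}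
    (hg : IsDominatedOne g) :
    jointIntegral D T ν (fun p => ψ (point p)) (partialDeriv m w) (fun ξ => g (ξ 1))
      = -jointIntegral D T ν (fun p => dx 0 m ψ (point p)) w (fun ξ => g (ξ 1)) := by
  have hx : IsCoefficient D fun p => dx 0 m ψ (point p) := isCoefficient_fderiv_of_mem hψ _
  rw [hν.jointIntegral_one (isCoefficient_of_mem hψ) (hw.partialDeriv m) hg,
    hν.jointIntegral_one hx hw.isCutoff hg, ← integral_neg]
  refine integral_congr_ae (Eventually.of_forall fun p => ?_)
  change _ * ∫ z, ψ (point (p.1, p.2 + z)) * partialDeriv m w z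
    = -(_ * ∫ z, dx 0 m ψ (point (p.1, p.2 + z)) * w z)
  rw [integral_mul_partialDeriv hψ hw, mul_neg]

/-! ### Admissible observables -/

lemma IsCorrelationMeasure.ae_lintegral_weight_lt_top (hν : IsCorrelationMeasure D T ν) :
    ∀ᵐ p ∂(D.spaceTime T), ∫⁻ ζ, ENNReal.ofReal (weight ζ) ∂(onePoint ν p) < ⊤ := by
  have := hν.isMarkovKernel_onePoint
  exact ae_lt_top (Measurable.lintegral_kernel (by fun_prop)) hν.lintegral_weight_lt_top.ne

/-- The summand `1` is needed for the pressure, since `|p|^{3/2}` does not dominate `|p|` near zero.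
It costs nothing for probability measures, as only finiteness at almost every point is required. -/
lemma IsCorrelationMeasure.isAdmissible_of_le (hν : IsCorrelationMeasure D T ν) {g : Phase d → ℝ}
    (hg : Continuous g) (hle : ∀ ζ, |g ζ| ≤ 1 + weight ζ)
    (hd : ∀ l k (m : Fin d), IsDominatedTwo fun ξ : Fin 2 → Phase d => g (ξ l) * (ξ k).1 m) :
    IsAdmissible D T ν g where
  continuous := hg
  dominated := hd
  finite := by
    have := hν.isMarkovKernel_onePoint
    filter_upwards [hν.ae_lintegral_weight_lt_top] with p hp
    calc ∫⁻ ζ, ‖g ζ‖ₑ ∂(onePoint ν p) ≤ ∫⁻ ζ, (1 + ENNReal.ofReal (weight ζ)) ∂(onePoint ν p) := by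
          refine lintegral_mono fun ζ => ?_
          rw [Real.enorm_eq_ofReal_abs, ← ENNReal.ofReal_one,
            ← ENNReal.ofReal_add zero_le_one (weight_nonneg ζ)]
          exact ENNReal.ofReal_le_ofReal (hle ζ)
      _ < ⊤ := by
          rw [lintegral_add_left measurable_const, lintegral_const, measure_univ, mul_one]
          exact ENNReal.add_lt_top.2 ⟨ENNReal.one_lt_top, hp⟩

lemma IsCorrelationMeasure.isAdmissible_pressure (hν : IsCorrelationMeasure D T ν) :
    IsAdmissible D T ν fun ζ => ζ.2 := by
  refine hν.isAdmissible_of_le continuous_snd (fun ζ => ?_) isDominatedTwo_press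
  -- Young's inequality with second factor `1` gives `|p| ≤ |p|^{3/2} + 1`.
  have h := mul_le_rpow_add_cube (abs_nonneg ζ.2) zero_le_one
  have h1 : 0 ≤ ‖ζ.1‖ ^ 2 + ‖ζ.1‖ ^ 3 := by positivity
  unfold weight
  linarith

lemma IsCorrelationMeasure.isAdmissible_speed (hν : IsCorrelationMeasure D T ν) :
    IsAdmissible D T ν fun ζ => ‖ζ.1‖ ^ 2 := by
  refine hν.isAdmissible_of_le (by fun_prop) (fun ζ => ?_) isDominatedTwo_speed
  have h1 : 0 ≤ ‖ζ.1‖ ^ 3 + |ζ.2| ^ (3 / 2 : ℝ) := by positivity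
  rw [abs_of_nonneg (by positivity)]
  unfold weight
  linarith

/-! ### The energy balance at a positive scale -/

/-- The Duchon–Robert identity before passage to the limit. Its point is that `w` occurs
undifferentiated on the right, so that only averages of observables near the diagonal remain. -/
lemma IsStatisticalSolution.sum_jointIntegral_diff (hν : IsStatisticalSolution D T ν)
    (hψ : ψ ∈ testFunctions D (Ioo 0 T) 1) (hw : IsSmoothCutoff w) :
    ∑ m, jointIntegral D T ν (fun p => ψ (point p)) (partialDeriv m w)
        (fun ξ => ‖(ξ 0).1 - (ξ 1).1‖ ^ 2 * ((ξ 0).1 m - (ξ 1).1 m))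
      = 2 * ∑ j, jointIntegral D T ν (fun p => dt ψ (point p)) w (fun ξ => (ξ 0).1 j * (ξ 1).1 j)
        + ∑ m, (2 * ∑ j, jointIntegral D T ν (fun p => dx 0 m ψ (point p)) w
              (fun ξ => (ξ 0).1 m * ((ξ 0).1 j * (ξ 1).1 j))
            + 2 * jointIntegral D T ν (fun p => dx 0 m ψ (point p)) w
              (fun ξ => (ξ 0).2 * (ξ 1).1 m)
            + 2 * jointIntegral D T ν (fun p => dx 0 m ψ (point p)) w
              (fun ξ => (ξ 1).2 * (ξ 0).1 m)
            + jointIntegral D T ν (fun p => dx 0 m ψ (point p)) w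
              (fun ξ => ‖(ξ 1).1‖ ^ 2 * (ξ 1).1 m)
            - jointIntegral D T ν (fun p => dx 0 m ψ (point p)) w
              (fun ξ => ‖(ξ 1).1‖ ^ 2 * (ξ 0).1 m)) := by
  have hc := hν.toIsCorrelationMeasure
  have hψ0 := isCoefficient_of_mem hψ
  have hE := Finset.sum_congr rfl fun j (_ : j ∈ (Finset.univ : Finset (Fin d))) =>
    hν.evolution_pair hψ hw j
  have hp1 := hν.divergence_free_pair hψ hw hc.isAdmissible_pressure
  have hp2 := hν.divergence_free_pair_swap hψ hw hc.isAdmissible_pressure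
  have hs1 := hν.divergence_free_pair hψ hw hc.isAdmissible_speed
  have hs2 := hν.divergence_free_pair_swap hψ hw hc.isAdmissible_speed
  have hi0 : ∀ m, jointIntegral D T ν (fun p => ψ (point p)) (partialDeriv m w)
      (fun ξ => ‖(ξ 0).1‖ ^ 2 * (ξ 0).1 m) = 0 := fun m =>
    hc.jointIntegral_partialDeriv_zero hψ hw m (g := fun ζ => ‖ζ.1‖ ^ 2 * ζ.1 m)
      (isDominatedTwo_speed 0 0 m).diag
  have hi1 : ∀ m, jointIntegral D T ν (fun p => ψ (point p)) (partialDeriv m w)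
      (fun ξ => ‖(ξ 1).1‖ ^ 2 * (ξ 1).1 m)
      = -jointIntegral D T ν (fun p => dx 0 m ψ (point p)) w
        (fun ξ => ‖(ξ 1).1‖ ^ 2 * (ξ 1).1 m) := fun m =>
    hc.jointIntegral_partialDeriv_one hψ hw m (g := fun ζ => ‖ζ.1‖ ^ 2 * ζ.1 m)
      (isDominatedTwo_speed 0 0 m).diag
  -- Pointwise this is `|v₁ - v₂|² = |v₁|² + |v₂|² - 2 v₁·v₂` multiplied by the `m`-th component of
  -- `v₁ - v₂`, with `v₁·v₂` written as a sum over `j`. Domination of each piece allows the integral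
  -- to be split.
  have hexp : ∀ m, jointIntegral D T ν (fun p => ψ (point p)) (partialDeriv m w)
        (fun ξ => ‖(ξ 0).1 - (ξ 1).1‖ ^ 2 * ((ξ 0).1 m - (ξ 1).1 m))
      = jointIntegral D T ν (fun p => ψ (point p)) (partialDeriv m w)
          (fun ξ => ‖(ξ 0).1‖ ^ 2 * (ξ 0).1 m)
        - jointIntegral D T ν (fun p => ψ (point p)) (partialDeriv m w)
          (fun ξ => ‖(ξ 0).1‖ ^ 2 * (ξ 1).1 m)
        + (jointIntegral D T ν (fun p => ψ (point p)) (partialDeriv m w)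
          (fun ξ => ‖(ξ 1).1‖ ^ 2 * (ξ 0).1 m)
        - jointIntegral D T ν (fun p => ψ (point p)) (partialDeriv m w)
          (fun ξ => ‖(ξ 1).1‖ ^ 2 * (ξ 1).1 m))
        - 2 * ∑ j, (jointIntegral D T ν (fun p => ψ (point p)) (partialDeriv m w)
            (fun ξ => (ξ 0).1 m * ((ξ 0).1 j * (ξ 1).1 j))
          - jointIntegral D T ν (fun p => ψ (point p)) (partialDeriv m w)
            (fun ξ => (ξ 1).1 m * ((ξ 0).1 j * (ξ 1).1 j))) := fun m => by
    have hβ := hw.partialDeriv m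
    have hd1 : ∀ j ∈ (Finset.univ : Finset (Fin d)), IsDominatedTwo fun ξ : Fin 2 → Phase d =>
        (ξ 0).1 m * ((ξ 0).1 j * (ξ 1).1 j) - (ξ 1).1 m * ((ξ 0).1 j * (ξ 1).1 j) := fun j _ =>
      (isDominatedTwo_vel_vel 0 m j).sub (isDominatedTwo_vel_vel 1 m j)
    simp_rw [← hc.jointIntegral_sub hψ0 hβ (isDominatedTwo_vel_vel 0 m _)
      (isDominatedTwo_vel_vel 1 m _)]
    rw [← hc.jointIntegral_sum hψ0 hβ _ hd1,
      ← hc.jointIntegral_sub hψ0 hβ (isDominatedTwo_speed 0 0 m) (isDominatedTwo_speed 0 1 m),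
      ← hc.jointIntegral_sub hψ0 hβ (isDominatedTwo_speed 1 0 m) (isDominatedTwo_speed 1 1 m),
      ← hc.jointIntegral_add hψ0 hβ
        ((isDominatedTwo_speed 0 0 m).sub (isDominatedTwo_speed 0 1 m))
        ((isDominatedTwo_speed 1 0 m).sub (isDominatedTwo_speed 1 1 m)), eq_sub_iff_add_eq,
      ← jointIntegral_const_mul]
    have hd2 : IsDominatedTwo fun ξ : Fin 2 → Phase d => 2 * ∑ j, ((ξ 0).1 m *
        ((ξ 0).1 j * (ξ 1).1 j) - (ξ 1).1 m * ((ξ 0).1 j * (ξ 1).1 j)) := by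
      choose C hC using fun j => (hd1 j (Finset.mem_univ j)).2
      refine ⟨by fun_prop, 2 * ∑ j, C j, fun ξ => ?_⟩
      rw [abs_mul, abs_two, mul_assoc, Finset.sum_mul]
      gcongr
      exact (Finset.abs_sum_le_sum_abs _ _).trans (Finset.sum_le_sum fun j _ => hC j ξ)
    rw [← hc.jointIntegral_add hψ0 hβ (isDominatedTwo_diff m) hd2]
    congr 1
    funext ξ
    have h1 : ∑ j, (ξ 0).1 j * (ξ 1).1 j = inner ℝ (ξ 1).1 (ξ 0).1 := by
      simp [PiLp.inner_apply]
    rw [← Finset.sum_congr rfl fun j _ => sub_mul ((ξ 0).1 m) ((ξ 1).1 m)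
      ((ξ 0).1 j * (ξ 1).1 j), ← Finset.mul_sum, h1, @norm_sub_sq_real, real_inner_comm]
    ring
  simp only [hexp, hi0, hi1]
  simp only [Finset.sum_add_distrib, Finset.sum_sub_distrib, Finset.sum_neg_distrib,
    Finset.sum_const_zero, ← Finset.mul_sum] at hE hp1 hp2 hs1 hs2 ⊢
  -- The evolution equations are summed over `j` last and the divergence over `m` last; the double
  -- sums must agree before they can be combined.
  rw [Finset.sum_comm (f := fun m j => jointIntegral D T ν (fun p => dx 0 m ψ (point p)) w
    (fun ξ => (ξ 0).1 m * ((ξ 0).1 j * (ξ 1).1 j))), Finset.sum_comm (f := fun m j =>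
      jointIntegral D T ν (fun p => ψ (point p)) (partialDeriv m w)
        (fun ξ => (ξ 0).1 m * ((ξ 0).1 j * (ξ 1).1 j))), Finset.sum_comm (f := fun m j =>
      jointIntegral D T ν (fun p => ψ (point p)) (partialDeriv m w)
        (fun ξ => (ξ 1).1 m * ((ξ 0).1 j * (ξ 1).1 j)))]
  -- The evolution equation and the two pressure constraints enter with weight two, the two
  -- constraints for `|v|²` with weight one.
  linarith

end Identity

/-! ### Rescaled kernels -/

lemma continuous_rescale {f : Space d → ℝ} (hf : Continuous f) (ε : ℝ) :
    Continuous (rescale f ε) := by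
  unfold rescale; fun_prop

lemma norm_le_of_rescale_ne {f : Space d → ℝ} (hf : ∀ z, f z ≠ 0 → ‖z‖ ≤ 1) {ε : ℝ} (hε : 0 < ε)
    (z : Space d) (hz : rescale f ε z ≠ 0) : ‖z‖ ≤ ε := by
  have h := hf _ (right_ne_zero_of_mul hz)
  rw [norm_smul, norm_inv, Real.norm_of_nonneg hε.le, inv_mul_le_iff₀ hε, mul_one] at h
  exact h

lemma partialDeriv_rescale {f : Space d → ℝ} (hf : Differentiable ℝ f) (ε : ℝ) (m : Fin d)
    (z : Space d) : partialDeriv m (rescale f ε) z = ε⁻¹ * rescale (partialDeriv m f) ε z := by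
  have h : HasFDerivAt (rescale f ε) ((ε ^ d)⁻¹ • (fderiv ℝ f (ε⁻¹ • z)).comp
      (ε⁻¹ • ContinuousLinearMap.id ℝ (Space d))) z :=
    (((hf _).hasFDerivAt).comp z
      ((ε⁻¹ • ContinuousLinearMap.id ℝ (Space d)).hasFDerivAt)).const_mul _
  rw [partialDeriv, h.fderiv, rescale, partialDeriv]
  simp only [_root_.smul_apply, ContinuousLinearMap.comp_apply, ContinuousLinearMap.id_apply,
    map_smul, smul_eq_mul]
  ring

/-- Spheres of positive radius are null. The means and the dissipation are defined with open balls,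
whereas the support bounds on rescaled kernels give closed ones. -/
lemma restrict_ball_eq (x : Space d) {ε : ℝ} (hε : 0 < ε) :
    (volume : Measure (Space d)).restrict (Metric.ball x ε)
      = volume.restrict (Metric.closedBall x ε) := by
  refine Measure.restrict_congr_set ?_
  refine Metric.ball_subset_closedBall.eventuallyLE.antisymm ?_
  refine ae_le_set.2 ?_
  rw [Metric.closedBall_sdiff_ball]
  exact Measure.addHaar_sphere_of_ne_zero _ _ hε.ne'

variable {D : SpaceDomain} {T : ℝ} {ν : Hierarchy d}

/-- Averages against rescaled kernels are controlled by averages over balls. -/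
lemma IsCorrelationMeasure.exists_lintegral_rescale_le (hν : IsCorrelationMeasure D T ν)
    {f : Space d → ℝ} (hf : Continuous f) (hs : ∀ z, f z ≠ 0 → ‖z‖ ≤ 1) :
    ∃ C : ℝ≥0, ∀ ε > 0, ∀ G : (Fin 2 → Phase d) → ℝ≥0∞, Measurable G →
      ∫⁻ u, ‖rescale f ε u.1.2‖ₑ * G u.2 ∂(joint D T ν) ≤ C * diagonalMean D T ν G ε := by
  have := hν.isMarkovKernel_offsetKernel
  have := hν.isMarkovKernel_twoPoint
  obtain ⟨B, hB⟩ : ∃ B : ℝ, ∀ z, ‖f z‖ ≤ B :=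
    (HasCompactSupport.intro (isCompact_closedBall 0 1) fun x hx => by
      by_contra h
      exact hx (by simpa using hs x h)).exists_bound_of_continuous hf
  -- On `B_ε` the kernel is at most `ε^{-d} B = B |B_1| / |B_ε|`, so `B |B_1|` compares it with the
  -- normalized average.
  refine ⟨B.toNNReal * (volume (Metric.ball (0 : Space d) 1)).toNNReal, fun ε hε G hG => ?_⟩
  have hfm := (continuous_rescale hf ε).measurable
  have hFm : Measurable fun q => ∫⁻ ξ, G ξ ∂(twoPoint ν q) := Measurable.lintegral_kernel hG
  have hv1 : volume (Metric.ball (0 : Space d) 1) ≠ ⊤ := Metric.isBounded_ball.measure_lt_top.ne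
  have hvε : ∀ x : Space d, volume (Metric.ball x ε)
      = ENNReal.ofReal (ε ^ d) * volume (Metric.ball (0 : Space d) 1) := fun x => by
    rw [Measure.addHaar_ball_of_pos _ _ hε, finrank_euclideanSpace_fin]
  have hp : 0 < ε ^ d := by positivity
  rw [joint, Measure.lintegral_compProd (by fun_prop)]
  have h1 : ∀ q : (ℝ × Space d) × Space d,
      ∫⁻ ξ, ‖rescale f ε q.2‖ₑ * G ξ ∂(offsetKernel ν q)
        = ‖rescale f ε q.2‖ₑ * ∫⁻ ξ, G ξ ∂(twoPoint ν (offset q)) := fun q =>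
    lintegral_const_mul _ hG
  simp only [h1]
  rw [SpaceDomain.offsets, lintegral_prod _ (by fun_prop), SpaceDomain.spaceTime,
    lintegral_prod _ (Measurable.aemeasurable ?_), diagonalMean,
    ← lintegral_const_mul' _ _ ENNReal.coe_ne_top]
  · refine lintegral_mono fun t => ?_
    rw [← lintegral_const_mul' _ _ ENNReal.coe_ne_top]
    refine lintegral_mono fun x => ?_
    have hF' : Measurable fun y => ∫⁻ ξ, G ξ ∂(ν 2 (t, ![x, y])) :=
      hFm.comp (measurable_prodMk_left (x := (t, x)))
    calc ∫⁻ z, ‖rescale f ε z‖ₑ * ∫⁻ ξ, G ξ ∂(twoPoint ν (offset ((t, x), z)))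
        ≤ ∫⁻ z, ENNReal.ofReal ((ε ^ d)⁻¹ * B) * (Metric.closedBall x ε).indicator
            (fun y => ∫⁻ ξ, G ξ ∂(ν 2 (t, ![x, y]))) (x - z) := by
          refine lintegral_mono fun z => ?_
          by_cases hz : rescale f ε z = 0
          · simp [hz]
          · rw [indicator_of_mem]
            · refine mul_le_mul_left ?_ _
              rw [Real.enorm_eq_ofReal_abs]
              refine ENNReal.ofReal_le_ofReal ?_
              rw [rescale, abs_mul, abs_of_pos (inv_pos.2 hp)]
              gcongr
              exact hB _
            · rw [mem_closedBall_iff_norm, sub_sub_cancel_left, norm_neg]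
              exact norm_le_of_rescale_ne hs hε z hz
      _ = ENNReal.ofReal ((ε ^ d)⁻¹ * B) * ∫⁻ y in Metric.ball x ε,
            ∫⁻ ξ, G ξ ∂(ν 2 (t, ![x, y])) := by
          rw [lintegral_const_mul' _ _ ENNReal.ofReal_ne_top,
            lintegral_sub_left_eq_self (fun y => (Metric.closedBall x ε).indicator
              (fun y => ∫⁻ ξ, G ξ ∂(ν 2 (t, ![x, y]))) y) x,
            lintegral_indicator Metric.isClosed_closedBall.measurableSet, restrict_ball_eq x hε]
      _ = ENNReal.ofReal ((ε ^ d)⁻¹ * B) * (volume (Metric.ball x ε) *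
            ⨍⁻ y in Metric.ball x ε, (∫⁻ ξ, G ξ ∂(ν 2 (t, ![x, y]))) ∂volume) := by
          rw [setLAverage_eq, ENNReal.mul_div_cancel (Metric.measure_ball_pos _ _ hε).ne'
            Metric.isBounded_ball.measure_lt_top.ne]
      _ = _ := by
          rw [hvε, ← mul_assoc, ← mul_assoc, ← ENNReal.ofReal_mul' hp.le]
          congr 1
          rw [ENNReal.coe_mul, ENNReal.coe_toNNReal hv1, ENNReal.ofNNReal_toNNReal]
          congr 2
          field_simp
  · exact Measurable.lintegral_prod_right'
      (f := fun q : (ℝ × Space d) × Space d => ‖rescale f ε q.2‖ₑ *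
        ∫⁻ ξ, G ξ ∂(twoPoint ν (offset q))) (by fun_prop)

/-! ### Mollifiers -/

namespace IsMollifier

variable {ρ : Space d → ℝ}

lemma norm_le_one (hρ : IsMollifier ρ) (z : Space d) (hz : ρ z ≠ 0) : ‖z‖ ≤ 1 := by
  simpa using hρ.support (subset_tsupport _ hz)

lemma isSmoothCutoff_rescale (hρ : IsMollifier ρ) {ε : ℝ} (hε : 0 < ε) :
    IsSmoothCutoff (rescale ρ ε) := by
  refine ⟨?_, ε, norm_le_of_rescale_ne hρ.norm_le_one hε⟩
  have := hρ.smooth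
  unfold rescale
  fun_prop

lemma rescale_nonneg (hρ : IsMollifier ρ) {ε : ℝ} (hε : 0 < ε) (z : Space d) :
    0 ≤ rescale ρ ε z :=
  mul_nonneg (by positivity) (hρ.nonneg _)

lemma integral_rescale (hρ : IsMollifier ρ) {ε : ℝ} (hε : 0 < ε) : ∫ z, rescale ρ ε z = 1 := by
  unfold rescale
  rw [integral_const_mul, Measure.integral_comp_inv_smul, hρ.mass, finrank_euclideanSpace_fin,
    abs_of_pos (by positivity)]
  simp [hε.ne']

lemma lintegral_rescale (hρ : IsMollifier ρ) {ε : ℝ} (hε : 0 < ε) :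
    ∫⁻ z, ‖rescale ρ ε z‖ₑ = 1 := by
  have h := ofReal_integral_norm_eq_lintegral_enorm
    (hρ.isSmoothCutoff_rescale hε).isCutoff.integrable
  rw [← h]
  simp_rw [Real.norm_of_nonneg (hρ.rescale_nonneg hε _)]
  rw [hρ.integral_rescale hε, ENNReal.ofReal_one]

end IsMollifier

/-- Part (c) does not mention a mollifier, but its proof computes the limit along one. A smooth
function of `|z|²`, normalized, is radial and smooth at the origin. -/
lemma exists_isMollifier (d : ℕ) : ∃ ρ : Space d → ℝ, IsMollifier ρ := by
  let f : Space d → ℝ := fun z => Real.smoothTransition (1 - ‖z‖ ^ 2)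
  have hs : ContDiff ℝ ∞ f :=
    Real.smoothTransition.contDiff.comp (contDiff_const.sub (contDiff_norm_sq ℝ))
  have h0 : ∀ z, 0 ≤ f z := fun z => Real.smoothTransition.nonneg _
  have hsupp : ∀ z, f z ≠ 0 → z ∈ Metric.closedBall (0 : Space d) 1 := fun z hz => by
    rw [mem_closedBall_zero_iff]
    by_contra h
    exact hz (Real.smoothTransition.zero_of_nonpos (by nlinarith [not_le.1 h]))
  have hc : HasCompactSupport f := HasCompactSupport.intro (isCompact_closedBall 0 1)
    fun z hz => by_contra fun h => hz (hsupp z h)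
  have hpos : 0 < ∫ z, f z := hs.continuous.integral_pos_of_hasCompactSupport_nonneg_nonzero hc
    h0 (x := 0) (by simp [f])
  refine ⟨fun z => (∫ z, f z)⁻¹ * f z, contDiff_const.mul hs, fun z =>
    mul_nonneg (inv_nonneg.2 hpos.le) (h0 z), fun z w h => by simp only [f, h], ?_, ?_⟩
  · exact closure_minimal (fun z hz => hsupp z (right_ne_zero_of_mul hz)) Metric.isClosed_closedBall
  · rw [integral_const_mul, inv_mul_cancel₀ hpos.ne']

/-! ### Convergence of the joint integrals -/

/-- The differences whose averages vanish at the diagonal. -/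
def diffWeight (ξ : Fin 2 → Phase d) : ℝ :=
  ‖(ξ 0).1 - (ξ 1).1‖ ^ 2 + ‖(ξ 0).1 - (ξ 1).1‖ ^ 3 + |(ξ 0).2 - (ξ 1).2| ^ (3 / 2 : ℝ)

lemma ofReal_diffWeight (ξ : Fin 2 → Phase d) :
    ENNReal.ofReal (diffWeight ξ) = ‖(ξ 0).1 - (ξ 1).1‖ₑ ^ 2 + ‖(ξ 0).1 - (ξ 1).1‖ₑ ^ 3 +
      ‖(ξ 0).2 - (ξ 1).2‖ₑ ^ (3 / 2 : ℝ) := by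
  rw [diffWeight, ENNReal.ofReal_add (by positivity) (by positivity),
    ENNReal.ofReal_add (by positivity) (by positivity), ENNReal.ofReal_pow (norm_nonneg _),
    ENNReal.ofReal_pow (norm_nonneg _), ofReal_norm,
    ← ENNReal.ofReal_rpow_of_nonneg (abs_nonneg _) (by norm_num), ← Real.norm_eq_abs,
    ofReal_norm]

@[fun_prop]
lemma measurable_diffWeight : Measurable (diffWeight (d := d)) := by
  unfold diffWeight; fun_prop

/-- Hölder's inequality for the joint measure with density `ρ_ε(z)`. The factor with `X` stays
bounded because both marginals have integrable weight and `ρ_ε` has unit mass. The factor with `Y`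
tends to zero by diagonal continuity. -/
lemma IsCorrelationMeasure.tendsto_lintegral_mul (hν : IsCorrelationMeasure D T ν) {ρ : Space d → ℝ}
    (hρ : IsMollifier ρ) {X Y : (Fin 2 → Phase d) → ℝ} (hX : Measurable X) (hY : Measurable Y)
    (hX0 : ∀ ξ, 0 ≤ X ξ) (hY0 : ∀ ξ, 0 ≤ Y ξ) {p q : ℝ} (hpq : p.HolderConjugate q)
    (hXp : ∀ ξ, X ξ ^ p ≤ weight (ξ 0) + weight (ξ 1)) (hYq : ∀ ξ, Y ξ ^ q ≤ diffWeight ξ) :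
    Tendsto (fun ε => ∫⁻ u, ‖rescale ρ ε u.1.2‖ₑ *
      (ENNReal.ofReal (X u.2) * ENNReal.ofReal (Y u.2)) ∂(joint D T ν)) (𝓝[>] 0) (𝓝 0) := by
  obtain ⟨C, hC⟩ := hν.exists_lintegral_rescale_le hρ.smooth.continuous hρ.norm_le_one
  set A : ℝ≥0∞ := ∫⁻ p, ∫⁻ ζ, ENNReal.ofReal (weight ζ) ∂(onePoint ν p) ∂(D.spaceTime T) with hA
  have hA' : A + A ≠ ⊤ := (ENNReal.add_lt_top.2
    ⟨hν.lintegral_weight_lt_top, hν.lintegral_weight_lt_top⟩).ne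
  have hdc := hν.diagonal_continuity
  have hq0 : 0 < 1 / q := by have := hpq.symm.pos; positivity
  have hp0 : 0 < 1 / p := by have := hpq.pos; positivity
  simp only [← ofReal_diffWeight] at hdc
  have hlim : Tendsto (fun ε => (A + A) ^ (1 / p) * (C * diagonalMean D T ν
      (fun ξ => ENNReal.ofReal (diffWeight ξ)) ε) ^ (1 / q)) (𝓝[>] 0) (𝓝 0) := by
    have h1 := ENNReal.Tendsto.const_mul (a := (C : ℝ≥0∞)) hdc (Or.inr ENNReal.coe_ne_top)
    rw [mul_zero] at h1
    have h2 := (ENNReal.continuous_rpow_const (y := 1 / q)).continuousAt.tendsto.comp h1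
    rw [ENNReal.zero_rpow_of_pos hq0] at h2
    have h3 := ENNReal.Tendsto.const_mul (a := (A + A) ^ (1 / p)) h2
      (Or.inr (ENNReal.rpow_ne_top_of_nonneg hp0.le hA'))
    rw [mul_zero] at h3
    exact h3
  refine tendsto_of_tendsto_of_tendsto_of_le_of_le' tendsto_const_nhds hlim
    (Eventually.of_forall fun _ => zero_le) ?_
  filter_upwards [self_mem_nhdsWithin] with ε hε
  have hρm := (continuous_rescale hρ.smooth.continuous ε).measurable
  -- Keeping the kernel in the measure lets Hölder's inequality apply without distributing powers of
  -- `ρ_ε` over the two factors.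
  have hwd : ∀ G : (Fin 2 → Phase d) → ℝ≥0∞, Measurable G →
      ∫⁻ u, G u.2 ∂((joint D T ν).withDensity fun u => ‖rescale ρ ε u.1.2‖ₑ)
        = ∫⁻ u, ‖rescale ρ ε u.1.2‖ₑ * G u.2 ∂(joint D T ν) := fun G hG => by
    rw [lintegral_withDensity_eq_lintegral_mul _ (by fun_prop) (by fun_prop)]
    rfl
  have hH := ENNReal.lintegral_mul_le_Lp_mul_Lq
    ((joint D T ν).withDensity fun u => ‖rescale ρ ε u.1.2‖ₑ) hpq
    (f := fun u => ENNReal.ofReal (X u.2)) (g := fun u => ENNReal.ofReal (Y u.2))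
    (by fun_prop) (by fun_prop)
  simp only [Pi.mul_apply, ENNReal.ofReal_rpow_of_nonneg (hX0 _) hpq.nonneg,
    ENNReal.ofReal_rpow_of_nonneg (hY0 _) hpq.symm.nonneg] at hH
  rw [hwd (fun ξ => ENNReal.ofReal (X ξ) * ENNReal.ofReal (Y ξ)) (by fun_prop),
    hwd (fun ξ => ENNReal.ofReal (X ξ ^ p)) (by fun_prop),
    hwd (fun ξ => ENNReal.ofReal (Y ξ ^ q)) (by fun_prop)] at hH
  refine hH.trans ?_
  gcongr
  · calc ∫⁻ u, ‖rescale ρ ε u.1.2‖ₑ * ENNReal.ofReal (X u.2 ^ p) ∂(joint D T ν)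
        ≤ ∫⁻ u, (‖rescale ρ ε u.1.2‖ₑ * ENNReal.ofReal (weight (u.2 0))
            + ‖rescale ρ ε u.1.2‖ₑ * ENNReal.ofReal (weight (u.2 1))) ∂(joint D T ν) := by
          refine lintegral_mono fun u => ?_
          rw [← mul_add, ← ENNReal.ofReal_add (weight_nonneg _) (weight_nonneg _)]
          gcongr
          exact hXp _
      _ = A + A := by
          rw [lintegral_add_left (by fun_prop),
            hν.lintegral_joint_zero (b := fun z => ‖rescale ρ ε z‖ₑ)
              (h := fun ζ => ENNReal.ofReal (weight ζ)) (by fun_prop) (by fun_prop),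
            hν.lintegral_joint_one (b := fun z => ‖rescale ρ ε z‖ₑ)
              (h := fun ζ => ENNReal.ofReal (weight ζ)) (by fun_prop) (by fun_prop),
            hρ.lintegral_rescale hε, one_mul]
  · refine le_trans ?_ (hC ε hε (fun ξ => ENNReal.ofReal (diffWeight ξ)) (by fun_prop))
    refine lintegral_mono fun u => ?_
    gcongr
    exact hYq _

lemma enorm_jointIntegral_le {α : ℝ × Space d → ℝ} {A : ℝ≥0}
    (hA : ∀ p, ‖α p‖ₑ ≤ A) (β : Space d → ℝ) (g : (Fin 2 → Phase d) → ℝ) :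
    ‖jointIntegral D T ν α β g‖ₑ ≤ A * ∫⁻ u, ‖β u.1.2‖ₑ * ‖g u.2‖ₑ ∂(joint D T ν) := by
  refine (enorm_integral_le_lintegral_enorm _).trans ?_
  rw [← lintegral_const_mul' _ _ ENNReal.coe_ne_top]
  refine lintegral_mono fun u => ?_
  rw [enorm_mul, enorm_mul, mul_assoc]
  gcongr
  exact hA _

/-- The joint integrals converge to integrals over the diagonal. -/
lemma IsCorrelationMeasure.tendsto_jointIntegral (hν : IsCorrelationMeasure D T ν) {ρ : Space d → ℝ}
    (hρ : IsMollifier ρ) {α : ℝ × Space d → ℝ} (hα : IsCoefficient D α)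
    {g : (Fin 2 → Phase d) → ℝ} (hg : IsDominatedTwo g) {X Y : (Fin 2 → Phase d) → ℝ} (K : ℝ)
    (hle : ∀ ξ, |g ξ - g fun _ => ξ 0| ≤ K * (X ξ * Y ξ)) (hX : Measurable X) (hY : Measurable Y)
    (hX0 : ∀ ξ, 0 ≤ X ξ) (hY0 : ∀ ξ, 0 ≤ Y ξ) {p q : ℝ} (hpq : p.HolderConjugate q)
    (hXp : ∀ ξ, X ξ ^ p ≤ weight (ξ 0) + weight (ξ 1)) (hYq : ∀ ξ, Y ξ ^ q ≤ diffWeight ξ) :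
    Tendsto (fun ε => jointIntegral D T ν α (rescale ρ ε) g) (𝓝[>] 0)
      (𝓝 (∫ p, α p * ∫ ζ, g (fun _ => ζ) ∂(onePoint ν p) ∂(D.spaceTime T))) := by
  obtain ⟨A, hA⟩ := hα.exists_enorm_le
  rw [tendsto_iff_edist_tendsto_0]
  have hlim := ENNReal.Tendsto.const_mul (a := (A * ENNReal.ofReal K))
    (hν.tendsto_lintegral_mul hρ hX hY hX0 hY0 hpq hXp hYq)
    (Or.inr (ENNReal.mul_ne_top ENNReal.coe_ne_top ENNReal.ofReal_ne_top))
  rw [mul_zero] at hlim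
  refine tendsto_of_tendsto_of_tendsto_of_le_of_le' tendsto_const_nhds hlim
    (Eventually.of_forall fun _ => zero_le) ?_
  filter_upwards [self_mem_nhdsWithin] with ε hε
  have hβ := (hρ.isSmoothCutoff_rescale hε).isCutoff
  -- As `ρ_ε` has unit mass, the limit is for every `ε` the joint integral of `g` with both
  -- arguments set to the first value. Only the difference from that observable has to be estimated.
  have h0 := hν.jointIntegral_zero hα hβ hg.diag
  rw [hρ.integral_rescale hε, mul_one] at h0
  rw [← h0, edist_eq_enorm_sub, ← hν.jointIntegral_sub hα hβ hg hg.diag.zero]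
  refine (enorm_jointIntegral_le hA _ _).trans ?_
  rw [mul_assoc, ← lintegral_const_mul' _ _ ENNReal.ofReal_ne_top]
  refine mul_le_mul_right (lintegral_mono fun u => ?_) _
  rw [mul_left_comm]
  refine mul_le_mul_right ?_ _
  rw [Real.enorm_eq_ofReal_abs, ← ENNReal.ofReal_mul (hX0 _),
    ← ENNReal.ofReal_mul' (mul_nonneg (hX0 _) (hY0 _))]
  exact ENNReal.ofReal_le_ofReal (hle _)

/-! ### Integrals over the diagonal -/

/-- The integral of a one-point observable with a coefficient. -/
def diagIntegral (D : SpaceDomain) (T : ℝ) (ν : Hierarchy d) (α : ℝ × Space d → ℝ)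
    (h : Phase d → ℝ) : ℝ :=
  ∫ p, α p * ∫ ζ, h ζ ∂(onePoint ν p) ∂(D.spaceTime T)

lemma abs_coord_sub_le (ξ : Fin 2 → Phase d) (j : Fin d) :
    |(ξ 1).1 j - (ξ 0).1 j| ≤ ‖(ξ 0).1 - (ξ 1).1‖ := by
  rw [abs_sub_comm]
  exact PiLp.norm_apply_le ((ξ 0).1 - (ξ 1).1) j

lemma abs_sq_norm_sub_le (ξ : Fin 2 → Phase d) :
    |‖(ξ 1).1‖ ^ 2 - ‖(ξ 0).1‖ ^ 2| ≤ 2 * maxSpeed ξ * ‖(ξ 0).1 - (ξ 1).1‖ := by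
  have h1 := norm_le_maxSpeed ξ 0
  have h2 := norm_le_maxSpeed ξ 1
  have h3 : |‖(ξ 1).1‖ - ‖(ξ 0).1‖| ≤ ‖(ξ 0).1 - (ξ 1).1‖ := by
    rw [abs_sub_comm]
    exact abs_norm_sub_norm_le _ _
  rw [sq_sub_sq, abs_mul, abs_of_nonneg (by positivity)]
  exact mul_le_mul (by linarith) h3 (abs_nonneg _) (by linarith [maxSpeed_nonneg ξ])

@[fun_prop]
lemma measurable_maxSpeed : Measurable (maxSpeed (d := d)) := by
  unfold maxSpeed; fun_prop

lemma diff_sq_le_diffWeight (ξ : Fin 2 → Phase d) :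
    ‖(ξ 0).1 - (ξ 1).1‖ ^ 2 ≤ diffWeight ξ := by
  have h1 : 0 ≤ ‖(ξ 0).1 - (ξ 1).1‖ ^ 3 := by positivity
  have h2 : 0 ≤ |(ξ 0).2 - (ξ 1).2| ^ (3 / 2 : ℝ) := by positivity
  unfold diffWeight
  linarith

lemma diff_cube_le_diffWeight (ξ : Fin 2 → Phase d) :
    ‖(ξ 0).1 - (ξ 1).1‖ ^ 3 ≤ diffWeight ξ := by
  have h1 : 0 ≤ ‖(ξ 0).1 - (ξ 1).1‖ ^ 2 := by positivity
  have h2 : 0 ≤ |(ξ 0).2 - (ξ 1).2| ^ (3 / 2 : ℝ) := by positivity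
  unfold diffWeight
  linarith

lemma diff_press_le_diffWeight (ξ : Fin 2 → Phase d) :
    |(ξ 0).2 - (ξ 1).2| ^ (3 / 2 : ℝ) ≤ diffWeight ξ := by
  have h1 : 0 ≤ ‖(ξ 0).1 - (ξ 1).1‖ ^ 2 := by positivity
  have h2 : 0 ≤ ‖(ξ 0).1 - (ξ 1).1‖ ^ 3 := by positivity
  unfold diffWeight
  linarith

lemma press_le_weight (ξ : Fin 2 → Phase d) :
    |(ξ 0).2| ^ (3 / 2 : ℝ) ≤ weight (ξ 0) + weight (ξ 1) := by
  have h1 : 0 ≤ ‖(ξ 0).1‖ ^ 2 + ‖(ξ 0).1‖ ^ 3 := by positivity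
  have h2 := weight_nonneg (ξ 1)
  unfold weight at h2 ⊢
  linarith

lemma holderConjugate_three_halves : (3 / 2 : ℝ).HolderConjugate 3 :=
  Real.holderConjugate_iff.2 (by norm_num)

/-! ### Limits of the individual moments in the balance -/

namespace IsCorrelationMeasure

variable {ρ : Space d → ℝ} {α : ℝ × Space d → ℝ}

lemma tendsto_vel (hν : IsCorrelationMeasure D T ν) (hρ : IsMollifier ρ) (hα : IsCoefficient D α)
    (j : Fin d) :
    Tendsto (fun ε => jointIntegral D T ν α (rescale ρ ε) fun ξ => (ξ 0).1 j * (ξ 1).1 j) (𝓝[>] 0)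
      (𝓝 (diagIntegral D T ν α fun ζ => ζ.1 j * ζ.1 j)) := by
  refine hν.tendsto_jointIntegral hρ hα (isDominatedTwo_vel j) (X := maxSpeed)
    (Y := fun ξ => ‖(ξ 0).1 - (ξ 1).1‖) 1 (fun ξ => ?_) (by fun_prop) (by fun_prop) maxSpeed_nonneg
    (fun _ => norm_nonneg _) Real.HolderConjugate.two_two (fun ξ => ?_) (fun ξ => ?_)
  · rw [one_mul, ← mul_sub, abs_mul]
    exact mul_le_mul (abs_coord_le ξ 0 j) (abs_coord_sub_le ξ j) (abs_nonneg _) (maxSpeed_nonneg ξ)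
  · rw [Real.rpow_two]
    exact maxSpeed_sq_le ξ
  · rw [Real.rpow_two]
    exact diff_sq_le_diffWeight ξ

/-- Exponents `3/2` and `3`: two speeds in `L^{3/2}` as a product, one velocity increment in `L³`.
-/
lemma tendsto_cubic (hν : IsCorrelationMeasure D T ν) (hρ : IsMollifier ρ)
    (hα : IsCoefficient D α) {g : (Fin 2 → Phase d) → ℝ} (hg : IsDominatedTwo g) (K : ℝ)
    (hle : ∀ ξ, |g ξ - g fun _ => ξ 0| ≤ K * (maxSpeed ξ ^ 2 * ‖(ξ 0).1 - (ξ 1).1‖)) :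
    Tendsto (fun ε => jointIntegral D T ν α (rescale ρ ε) g) (𝓝[>] 0)
      (𝓝 (diagIntegral D T ν α fun ζ => g fun _ => ζ)) := by
  refine hν.tendsto_jointIntegral hρ hα hg (X := fun ξ => maxSpeed ξ ^ 2)
    (Y := fun ξ => ‖(ξ 0).1 - (ξ 1).1‖) K hle (by fun_prop) (by fun_prop) (fun _ => sq_nonneg _)
    (fun _ => norm_nonneg _) holderConjugate_three_halves (fun ξ => ?_) (fun ξ => ?_)
  · rw [← Real.rpow_natCast, ← Real.rpow_mul (maxSpeed_nonneg ξ)]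
    norm_num
    exact maxSpeed_cube_le ξ
  · exact_mod_cast diff_cube_le_diffWeight ξ

lemma tendsto_vel_vel (hν : IsCorrelationMeasure D T ν) (hρ : IsMollifier ρ)
    (hα : IsCoefficient D α) (m j : Fin d) :
    Tendsto (fun ε => jointIntegral D T ν α (rescale ρ ε)
        fun ξ => (ξ 0).1 m * ((ξ 0).1 j * (ξ 1).1 j)) (𝓝[>] 0)
      (𝓝 (diagIntegral D T ν α fun ζ => ζ.1 m * (ζ.1 j * ζ.1 j))) := by
  refine hν.tendsto_cubic hρ hα (isDominatedTwo_vel_vel 0 m j) 1 fun ξ => ?_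
  rw [one_mul, ← mul_sub, ← mul_sub, abs_mul, abs_mul, sq, mul_assoc]
  have := maxSpeed_nonneg ξ
  gcongr
  · exact abs_coord_le ξ 0 m
  · exact abs_coord_le ξ 0 j
  · exact abs_coord_sub_le ξ j

lemma tendsto_speed_zero (hν : IsCorrelationMeasure D T ν) (hρ : IsMollifier ρ)
    (hα : IsCoefficient D α) (m : Fin d) :
    Tendsto (fun ε => jointIntegral D T ν α (rescale ρ ε)
        fun ξ => ‖(ξ 1).1‖ ^ 2 * (ξ 0).1 m) (𝓝[>] 0)
      (𝓝 (diagIntegral D T ν α fun ζ => ‖ζ.1‖ ^ 2 * ζ.1 m)) := by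
  refine hν.tendsto_cubic hρ hα (isDominatedTwo_speed 1 0 m) 2 fun ξ => ?_
  rw [← sub_mul, abs_mul]
  have := maxSpeed_nonneg ξ
  calc |‖(ξ 1).1‖ ^ 2 - ‖(ξ 0).1‖ ^ 2| * |(ξ 0).1 m|
      ≤ (2 * maxSpeed ξ * ‖(ξ 0).1 - (ξ 1).1‖) * maxSpeed ξ := by
        gcongr
        · exact abs_sq_norm_sub_le ξ
        · exact abs_coord_le ξ 0 m
    _ = _ := by ring

lemma tendsto_speed_one (hν : IsCorrelationMeasure D T ν) (hρ : IsMollifier ρ)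
    (hα : IsCoefficient D α) (m : Fin d) :
    Tendsto (fun ε => jointIntegral D T ν α (rescale ρ ε)
        fun ξ => ‖(ξ 1).1‖ ^ 2 * (ξ 1).1 m) (𝓝[>] 0)
      (𝓝 (diagIntegral D T ν α fun ζ => ‖ζ.1‖ ^ 2 * ζ.1 m)) := by
  -- `3 = 1 + 2`: one from the increment of the coordinate, two from the increment of `|v|²`.
  refine hν.tendsto_cubic hρ hα (isDominatedTwo_speed 1 1 m) 3 fun ξ => ?_
  have := maxSpeed_nonneg ξ
  calc |‖(ξ 1).1‖ ^ 2 * (ξ 1).1 m - ‖(ξ 0).1‖ ^ 2 * (ξ 0).1 m|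
      = |‖(ξ 1).1‖ ^ 2 * ((ξ 1).1 m - (ξ 0).1 m)
          + (‖(ξ 1).1‖ ^ 2 - ‖(ξ 0).1‖ ^ 2) * (ξ 0).1 m| := by
        congr 1
        ring
    _ ≤ ‖(ξ 1).1‖ ^ 2 * |(ξ 1).1 m - (ξ 0).1 m|
          + |‖(ξ 1).1‖ ^ 2 - ‖(ξ 0).1‖ ^ 2| * |(ξ 0).1 m| := by
        refine (abs_add_le _ _).trans (le_of_eq ?_)
        rw [abs_mul, abs_mul, abs_of_nonneg (sq_nonneg ‖(ξ 1).1‖)]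
    _ ≤ maxSpeed ξ ^ 2 * ‖(ξ 0).1 - (ξ 1).1‖
          + (2 * maxSpeed ξ * ‖(ξ 0).1 - (ξ 1).1‖) * maxSpeed ξ := by
        gcongr
        · exact norm_le_maxSpeed ξ 1
        · exact abs_coord_sub_le ξ m
        · exact abs_sq_norm_sub_le ξ
        · exact abs_coord_le ξ 0 m
    _ = _ := by ring

/-- The pressure already sits at the base point, so only the velocity increment enters: `p₁` in
`L^{3/2}` against the increment in `L³`. -/
lemma tendsto_press_zero (hν : IsCorrelationMeasure D T ν) (hρ : IsMollifier ρ)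
    (hα : IsCoefficient D α) (m : Fin d) :
    Tendsto (fun ε => jointIntegral D T ν α (rescale ρ ε)
        fun ξ => (ξ 0).2 * (ξ 1).1 m) (𝓝[>] 0)
      (𝓝 (diagIntegral D T ν α fun ζ => ζ.2 * ζ.1 m)) := by
  refine hν.tendsto_jointIntegral hρ hα (isDominatedTwo_press 0 1 m) (X := fun ξ => |(ξ 0).2|)
    (Y := fun ξ => ‖(ξ 0).1 - (ξ 1).1‖) 1 (fun ξ => ?_) (by fun_prop) (by fun_prop)
    (fun _ => abs_nonneg _) (fun _ => norm_nonneg _) holderConjugate_three_halves press_le_weight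
    (fun ξ => ?_)
  · rw [one_mul, ← mul_sub, abs_mul]
    gcongr
    exact abs_coord_sub_le ξ m
  · exact_mod_cast diff_cube_le_diffWeight ξ

/-- Here the pressure is the factor that moves, so the exponents trade places. This is where
diagonal continuity of the pressure is used. -/
lemma tendsto_press_one (hν : IsCorrelationMeasure D T ν) (hρ : IsMollifier ρ)
    (hα : IsCoefficient D α) (m : Fin d) :
    Tendsto (fun ε => jointIntegral D T ν α (rescale ρ ε)
        fun ξ => (ξ 1).2 * (ξ 0).1 m) (𝓝[>] 0)
      (𝓝 (diagIntegral D T ν α fun ζ => ζ.2 * ζ.1 m)) := by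
  refine hν.tendsto_jointIntegral hρ hα (isDominatedTwo_press 1 0 m) (X := maxSpeed)
    (Y := fun ξ => |(ξ 0).2 - (ξ 1).2|) 1 (fun ξ => ?_) (by fun_prop) (by fun_prop)
    maxSpeed_nonneg (fun _ => abs_nonneg _) holderConjugate_three_halves.symm (fun ξ => ?_)
    diff_press_le_diffWeight
  · rw [one_mul, ← sub_mul, abs_mul, abs_sub_comm, mul_comm]
    gcongr
    exact abs_coord_le ξ 0 m
  · exact_mod_cast maxSpeed_cube_le ξ

/-! ### Linearity in the observable -/

lemma integrable_diag (hν : IsCorrelationMeasure D T ν) (hα : IsCoefficient D α)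
    {h : Phase d → ℝ} (hh : IsDominatedOne h) :
    Integrable (fun p => α p * ∫ ζ, h ζ ∂(onePoint ν p)) (D.spaceTime T) := by
  obtain ⟨A, hA⟩ := hα.bounded
  exact (hν.integrable_onePoint hh).bdd_mul hα.continuous.aestronglyMeasurable
    (Eventually.of_forall fun p => hA p)

lemma ae_integrable_onePoint (hν : IsCorrelationMeasure D T ν) {h : Phase d → ℝ}
    (hh : IsDominatedOne h) : ∀ᵐ p ∂(D.spaceTime T), Integrable h (onePoint ν p) := by
  obtain ⟨C, hC⟩ := hh.exists_enorm_le
  filter_upwards [hν.ae_lintegral_weight_lt_top] with p hp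
  refine ⟨hh.1.aestronglyMeasurable, (lintegral_mono hC).trans_lt ?_⟩
  rw [lintegral_const_mul' _ _ ENNReal.coe_ne_top]
  exact ENNReal.mul_lt_top ENNReal.coe_lt_top hp

lemma diagIntegral_add (hν : IsCorrelationMeasure D T ν) (hα : IsCoefficient D α)
    {g h : Phase d → ℝ} (hg : IsDominatedOne g) (hh : IsDominatedOne h) :
    diagIntegral D T ν α (fun ζ => g ζ + h ζ)
      = diagIntegral D T ν α g + diagIntegral D T ν α h := by
  unfold diagIntegral
  rw [← integral_add (hν.integrable_diag hα hg) (hν.integrable_diag hα hh)]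
  refine integral_congr_ae ?_
  filter_upwards [hν.ae_integrable_onePoint hg, hν.ae_integrable_onePoint hh] with p h1 h2
  rw [integral_add h1 h2, mul_add]

lemma diagIntegral_sum (hν : IsCorrelationMeasure D T ν) (hα : IsCoefficient D α)
    {g : Fin d → Phase d → ℝ} (hg : ∀ j, IsDominatedOne (g j)) :
    diagIntegral D T ν α (fun ζ => ∑ j, g j ζ) = ∑ j, diagIntegral D T ν α (g j) := by
  unfold diagIntegral
  rw [← integral_finsetSum _ fun j _ => hν.integrable_diag hα (hg j)]
  refine integral_congr_ae ?_
  filter_upwards [ae_all_iff.2 fun j => hν.ae_integrable_onePoint (hg j)] with p h1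
  rw [integral_finsetSum _ fun j _ => h1 j, Finset.mul_sum]

end IsCorrelationMeasure

lemma diagIntegral_const_mul (D : SpaceDomain) (T : ℝ) (ν : Hierarchy d) (α : ℝ × Space d → ℝ)
    (h : Phase d → ℝ) (c : ℝ) :
    diagIntegral D T ν α (fun ζ => c * h ζ) = c * diagIntegral D T ν α h := by
  unfold diagIntegral
  simp_rw [integral_const_mul, mul_left_comm, integral_const_mul]

/-! ### The energy functional -/

/-- The energy density. -/
def energyDensity (ζ : Phase d) : ℝ := ‖ζ.1‖ ^ 2

/-- The energy flux. -/
def energyFlux (m : Fin d) (ζ : Phase d) : ℝ := ‖ζ.1‖ ^ 2 * ζ.1 m + 2 * ζ.2 * ζ.1 m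

lemma norm_sq_eq_sum (v : Space d) : ‖v‖ ^ 2 = ∑ j, v j * v j := by
  rw [EuclideanSpace.real_norm_sq_eq]
  simp_rw [sq]

lemma isDominatedOne_energyDensity : IsDominatedOne (energyDensity (d := d)) := by
  refine ⟨by unfold energyDensity; fun_prop, 1, fun ζ => ?_⟩
  have h1 : 0 ≤ ‖ζ.1‖ ^ 3 := by positivity
  have h2 : 0 ≤ |ζ.2| ^ (3 / 2 : ℝ) := by positivity
  rw [one_mul, energyDensity, abs_of_nonneg (by positivity), weight]
  linarith

lemma isDominatedOne_energyFlux (m : Fin d) : IsDominatedOne (energyFlux (d := d) m) := by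
  obtain ⟨-, C, hC⟩ := (isDominatedTwo_speed (d := d) 0 0 m).diag
  obtain ⟨-, C', hC'⟩ := (isDominatedTwo_press (d := d) 0 0 m).diag
  refine ⟨by unfold energyFlux; fun_prop, C + 2 * C', fun ζ => ?_⟩
  rw [energyFlux, mul_assoc]
  refine (abs_add_le _ _).trans ?_
  rw [abs_mul 2, abs_two]
  linarith [hC ζ, hC' ζ]

/-- The weak form of the energy balance operator. -/
def energyBalance (D : SpaceDomain) (T : ℝ) (ν : Hierarchy d) (ψ : ℝ × (Fin 1 → Space d) → ℝ) : ℝ :=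
  diagIntegral D T ν (fun p => dt ψ (point p)) energyDensity
    + ∑ m, diagIntegral D T ν (fun p => dx 0 m ψ (point p)) (energyFlux m)

/-- The joint integrals of the dissipation converge to the energy balance. -/
lemma IsStatisticalSolution.tendsto_sum_jointIntegral_diff (hν : IsStatisticalSolution D T ν)
    {ψ : ℝ × (Fin 1 → Space d) → ℝ} (hψ : ψ ∈ testFunctions D (Ioo 0 T) 1) {ρ : Space d → ℝ}
    (hρ : IsMollifier ρ) :
    Tendsto (fun ε => ∑ m, jointIntegral D T ν (fun p => ψ (point p))
        (partialDeriv m (rescale ρ ε))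
        (fun ξ => ‖(ξ 0).1 - (ξ 1).1‖ ^ 2 * ((ξ 0).1 m - (ξ 1).1 m))) (𝓝[>] 0)
      (𝓝 (2 * energyBalance D T ν ψ)) := by
  have hc := hν.toIsCorrelationMeasure
  have ht : IsCoefficient D fun p => dt ψ (point p) := isCoefficient_fderiv_of_mem hψ _
  have hx : ∀ m, IsCoefficient D fun p => dx 0 m ψ (point p) := fun m =>
    isCoefficient_fderiv_of_mem hψ _
  have hlim := ((tendsto_finsetSum Finset.univ fun j _ =>
    hc.tendsto_vel hρ ht j).const_mul 2).add (tendsto_finsetSum Finset.univ fun m _ =>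
      (((((tendsto_finsetSum Finset.univ fun j _ =>
        hc.tendsto_vel_vel hρ (hx m) m j).const_mul 2).add
      ((hc.tendsto_press_zero hρ (hx m) m).const_mul 2)).add
      ((hc.tendsto_press_one hρ (hx m) m).const_mul 2)).add
      (hc.tendsto_speed_one hρ (hx m) m)).sub (hc.tendsto_speed_zero hρ (hx m) m))
  -- On the diagonal the last two moments cancel, the mixed cubic one gives `2 |v|² v`, and the two
  -- pressure moments together give `4 p v`.
  have hval : 2 * energyBalance D T ν ψ
      = 2 * ∑ j, diagIntegral D T ν (fun p => dt ψ (point p)) (fun ζ => ζ.1 j * ζ.1 j)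
        + ∑ m, (2 * ∑ j, diagIntegral D T ν (fun p => dx 0 m ψ (point p))
              (fun ζ => ζ.1 m * (ζ.1 j * ζ.1 j))
            + 2 * diagIntegral D T ν (fun p => dx 0 m ψ (point p)) (fun ζ => ζ.2 * ζ.1 m)
            + 2 * diagIntegral D T ν (fun p => dx 0 m ψ (point p)) (fun ζ => ζ.2 * ζ.1 m)
            + diagIntegral D T ν (fun p => dx 0 m ψ (point p)) (fun ζ => ‖ζ.1‖ ^ 2 * ζ.1 m)
            - diagIntegral D T ν (fun p => dx 0 m ψ (point p)) (fun ζ => ‖ζ.1‖ ^ 2 * ζ.1 m)) := by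
    rw [energyBalance, mul_add, Finset.mul_sum]
    congr 1
    · have h1 := hc.diagIntegral_sum ht (g := fun j ζ => ζ.1 j * ζ.1 j) fun j =>
        (isDominatedTwo_vel j).diag
      rw [← h1]
      congr 2
      exact funext fun ζ => norm_sq_eq_sum ζ.1
    · refine Finset.sum_congr rfl fun m _ => ?_
      have h1 := hc.diagIntegral_add (hx m) (isDominatedTwo_speed 0 0 m).diag
        (h := fun ζ => 2 * (ζ.2 * ζ.1 m)) (by
          obtain ⟨hm, C, hC⟩ := (isDominatedTwo_press (d := d) 0 0 m).diag
          refine ⟨hm.const_mul 2, 2 * C, fun ζ => ?_⟩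
          rw [abs_mul, abs_two, mul_assoc]
          exact mul_le_mul_of_nonneg_left (hC ζ) two_pos.le)
      have h2 : energyFlux (d := d) m = fun ζ => ‖ζ.1‖ ^ 2 * ζ.1 m + 2 * (ζ.2 * ζ.1 m) := by
        funext ζ
        rw [energyFlux, mul_assoc]
      have h3 : (fun ζ : Phase d => ‖ζ.1‖ ^ 2 * ζ.1 m) = fun ζ => ∑ j, ζ.1 m * (ζ.1 j * ζ.1 j) := by
        funext ζ
        rw [norm_sq_eq_sum, mul_comm, Finset.mul_sum]
      have h4 := hc.diagIntegral_sum (hx m) (g := fun j ζ => ζ.1 m * (ζ.1 j * ζ.1 j)) fun j =>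
        (isDominatedTwo_vel_vel 0 m j).diag
      rw [h2, h1, diagIntegral_const_mul, h3, h4]
      ring
  rw [hval]
  refine hlim.congr' ?_
  filter_upwards [self_mem_nhdsWithin] with ε hε
  exact (hν.sum_jointIntegral_diff hψ (hρ.isSmoothCutoff_rescale hε)).symm

/-! ### The dissipation as a joint integral -/

variable {ψ : ℝ × (Fin 1 → Space d) → ℝ}

lemma fderiv_eq_sum_partialDeriv (w : Space d → ℝ) (z v : Space d) :
    fderiv ℝ w z v = ∑ m, partialDeriv m w z * v m := by
  conv_lhs => rw [← (EuclideanSpace.basisFun (Fin d) ℝ).sum_repr v]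
  rw [map_sum]
  refine Finset.sum_congr rfl fun m _ => ?_
  rw [map_smul, smul_eq_mul, mul_comm, EuclideanSpace.basisFun_repr, EuclideanSpace.basisFun_apply]
  rfl

/-- The inner integral of the dissipation is vector valued, and taking its coordinates under the
integral requires integrability. The cubic moment is finite for almost every offset in a ball, which
is enough since `∇ρ_ε` vanishes outside one. -/
lemma IsCorrelationMeasure.ae_integrable_offsetKernel (hν : IsCorrelationMeasure D T ν) (r : ℝ) :
    ∀ᵐ q ∂(D.offsets T), ‖q.2‖ ≤ r → Integrable
      (fun ξ : Fin 2 → Phase d => ‖(ξ 0).1 - (ξ 1).1‖ ^ 2 • ((ξ 0).1 - (ξ 1).1))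
      (offsetKernel ν q) := by
  have := hν.isMarkovKernel_offsetKernel
  set b : Space d → ℝ≥0∞ := (Metric.closedBall 0 r).indicator 1 with hb
  have hbm : Measurable b := measurable_one.indicator Metric.isClosed_closedBall.measurableSet
  have hbi : ∫⁻ z, b z ≠ ⊤ := by
    rw [hb, lintegral_indicator_one Metric.isClosed_closedBall.measurableSet]
    exact (isCompact_closedBall _ _).measure_lt_top.ne
  have h := hν.lintegral_joint_enorm_lt_top hbm hbi isDominatedTwo_diff_cube
  rw [joint, Measure.lintegral_compProd (by fun_prop)] at h
  have hm : Measurable fun q : (ℝ × Space d) × Space d =>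
      ∫⁻ ξ, b q.2 * ‖‖(ξ 0).1 - (ξ 1).1‖ ^ 3‖ₑ ∂(offsetKernel ν q) :=
    Measurable.lintegral_kernel_prod_right' (f := fun u : ((ℝ × Space d) × Space d) ×
      (Fin 2 → Phase d) => b u.1.2 * ‖‖(u.2 0).1 - (u.2 1).1‖ ^ 3‖ₑ) (by fun_prop)
  filter_upwards [ae_lt_top hm h.ne] with q hq hr
  refine ⟨(by fun_prop : Measurable _).aestronglyMeasurable, ?_⟩
  rw [hb, indicator_of_mem (by simpa using hr)] at hq
  simp only [Pi.one_apply, one_mul] at hq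
  refine (lintegral_mono fun ξ => ?_).trans_lt hq
  rw [enorm_smul, pow_succ _ 2, enorm_mul, enorm_norm]

/-- The dissipation as a sum of joint integrals. -/
lemma IsCorrelationMeasure.dissipation_eq (hν : IsCorrelationMeasure D T ν)
    (hψ : ψ ∈ testFunctions D (Ioo 0 T) 1) {ρ : Space d → ℝ} (hρ : IsMollifier ρ) {ε : ℝ}
    (hε : 0 < ε) :
    dissipation D T ν ρ ψ ε = -(1 / 2) * ∑ m, jointIntegral D T ν (fun p => ψ (point p))
      (partialDeriv m (rescale ρ ε))
      (fun ξ => ‖(ξ 0).1 - (ξ 1).1‖ ^ 2 * ((ξ 0).1 m - (ξ 1).1 m)) := by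
  have := hν.isMarkovKernel_offsetKernel
  have hw := hρ.isSmoothCutoff_rescale hε
  set w := rescale ρ ε with hwdef
  have hw0 : ∀ z : Space d, ¬ ‖z‖ ≤ ε → fderiv ℝ w z = 0 := fun z hz => by
    by_contra h
    exact hz (eq_zero_of_fderiv_ne (norm_le_of_rescale_ne hρ.norm_le_one hε) z h)
  set F : (ℝ × Space d) × Space d → ℝ := fun q => ψ (point q.1) * inner ℝ (gradient w q.2)
    (∫ ξ, ‖(ξ 0).1 - (ξ 1).1‖ ^ 2 • ((ξ 0).1 - (ξ 1).1) ∂(offsetKernel ν q)) with hF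
  have hFd : ∀ q, F q = ψ (point q.1) * fderiv ℝ w q.2
      (∫ ξ, ‖(ξ 0).1 - (ξ 1).1‖ ^ 2 • ((ξ 0).1 - (ξ 1).1) ∂(offsetKernel ν q)) := fun q => by
    -- The gradient represents the derivative through the Riesz isomorphism, so the inner product is
    -- the derivative applied to the vector.
    rw [← InnerProductSpace.toDual_symm_apply]
    rfl
  have hi : ∀ m, Integrable (fun u : ((ℝ × Space d) × Space d) × (Fin 2 → Phase d) =>
      ψ (point u.1.1) * partialDeriv m w u.1.2
        * (‖(u.2 0).1 - (u.2 1).1‖ ^ 2 * ((u.2 0).1 m - (u.2 1).1 m)))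
      (D.offsets T ⊗ₘ offsetKernel ν) := fun m =>
    hν.integrable_joint (isCoefficient_of_mem hψ) (hw.partialDeriv m) (isDominatedTwo_diff m)
  have hae : F =ᵐ[D.offsets T] fun q => ∑ m, ∫ ξ, ψ (point q.1) * partialDeriv m w q.2
      * (‖(ξ 0).1 - (ξ 1).1‖ ^ 2 * ((ξ 0).1 m - (ξ 1).1 m)) ∂(offsetKernel ν q) := by
    filter_upwards [hν.ae_integrable_offsetKernel ε] with q hq
    rw [hFd]
    by_cases hz : ‖q.2‖ ≤ ε
    · rw [fderiv_eq_sum_partialDeriv, Finset.mul_sum]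
      refine Finset.sum_congr rfl fun m _ => ?_
      rw [integral_const_mul, mul_assoc]
      congr 2
      exact ((EuclideanSpace.proj (𝕜 := ℝ) m).integral_comp_comm (hq hz)).symm
    · simp [hw0 _ hz, partialDeriv]
  have hFi : Integrable F (D.offsets T) := by
    refine Integrable.congr ?_ hae.symm
    exact integrable_finsetSum _ fun m _ => integrable_integral_of_compProd (hi m)
  have hJ : ∑ m, jointIntegral D T ν (fun p => ψ (point p)) (partialDeriv m w)
      (fun ξ => ‖(ξ 0).1 - (ξ 1).1‖ ^ 2 * ((ξ 0).1 m - (ξ 1).1 m)) = ∫ q, F q ∂(D.offsets T) := by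
    rw [integral_congr_ae hae, integral_finsetSum _ fun m _ =>
      integrable_integral_of_compProd (hi m)]
    refine Finset.sum_congr rfl fun m _ => ?_
    exact Measure.integral_compProd (hi m)
  rw [hJ, dissipation]
  congr 1
  rw [SpaceDomain.offsets] at hFi ⊢
  rw [integral_prod _ hFi, SpaceDomain.spaceTime, integral_prod _ hFi.integral_prod_left]
  refine integral_congr_ae (Eventually.of_forall fun t => integral_congr_ae
    (Eventually.of_forall fun x => ?_))
  change ∫ z in Metric.ball 0 ε, F ((t, x), z) = ∫ z, F ((t, x), z)
  -- The derivative of `ρ_ε` is zero outside the closed ball, so the offset integral extends to all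
  -- of `ℝ^d`.
  rw [restrict_ball_eq _ hε]
  refine setIntegral_eq_integral_of_forall_compl_eq_zero fun z hz => ?_
  rw [hFd, hw0 z (by simpa using hz)]
  simp

/-! ### The regularity condition -/

lemma partialDeriv_continuous {f : Space d → ℝ} (hf : ContDiff ℝ ∞ f) (m : Fin d) :
    Continuous (partialDeriv m f) :=
  (hf.continuous_fderiv (by simp)).clm_apply continuous_const

/-- The dissipation is controlled by the third-order structure function. -/
lemma IsCorrelationMeasure.exists_sum_jointIntegral_diff_le (hν : IsCorrelationMeasure D T ν)
    (hψ : ψ ∈ testFunctions D (Ioo 0 T) 1) {ρ : Space d → ℝ} (hρ : IsMollifier ρ) :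
    ∃ C : ℝ≥0, ∀ ε > 0, ‖∑ m, jointIntegral D T ν (fun p => ψ (point p))
        (partialDeriv m (rescale ρ ε))
        (fun ξ => ‖(ξ 0).1 - (ξ 1).1‖ ^ 2 * ((ξ 0).1 m - (ξ 1).1 m))‖ₑ
      ≤ C * ((ENNReal.ofReal ε)⁻¹ *
          diagonalMean D T ν (fun ξ => ‖(ξ 0).1 - (ξ 1).1‖ₑ ^ 3) ε) := by
  obtain ⟨A, hA⟩ := (isCoefficient_of_mem hψ).exists_enorm_le
  have hC : ∀ m, ∃ C : ℝ≥0, ∀ ε > 0, ∀ G : (Fin 2 → Phase d) → ℝ≥0∞, Measurable G →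
      ∫⁻ u, ‖rescale (partialDeriv m ρ) ε u.1.2‖ₑ * G u.2 ∂(joint D T ν)
        ≤ C * diagonalMean D T ν G ε := fun m =>
    hν.exists_lintegral_rescale_le (partialDeriv_continuous hρ.smooth m) fun z hz =>
      eq_zero_of_fderiv_ne hρ.norm_le_one z fun h => hz (by rw [partialDeriv, h]; rfl)
  choose C hC using hC
  -- `A` bounds `ψ`, and `C m` compares the rescaled `∂_m ρ` with the average over a ball; the
  -- factor `1/ε` comes from differentiating `ρ_ε`.
  refine ⟨∑ m, A * C m, fun ε hε => ?_⟩
  rw [ENNReal.ofNNReal_finsetSum, Finset.sum_mul]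
  refine (enorm_sum_le _ _).trans (Finset.sum_le_sum fun m _ => ?_)
  refine (enorm_jointIntegral_le hA _ _).trans ?_
  rw [ENNReal.coe_mul, mul_assoc]
  refine mul_le_mul_right ?_ _
  calc ∫⁻ u, ‖partialDeriv m (rescale ρ ε) u.1.2‖ₑ
        * ‖‖(u.2 0).1 - (u.2 1).1‖ ^ 2 * ((u.2 0).1 m - (u.2 1).1 m)‖ₑ ∂(joint D T ν)
      ≤ ∫⁻ u, (ENNReal.ofReal ε)⁻¹ * (‖rescale (partialDeriv m ρ) ε u.1.2‖ₑ
        * ‖(u.2 0).1 - (u.2 1).1‖ₑ ^ 3) ∂(joint D T ν) := by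
        refine lintegral_mono fun u => ?_
        rw [partialDeriv_rescale (hρ.smooth.differentiable (by simp)), enorm_mul, mul_assoc,
          ← ENNReal.ofReal_inv_of_pos hε, Real.enorm_eq_ofReal (inv_nonneg.2 hε.le)]
        refine mul_le_mul_right (mul_le_mul_right ?_ _) _
        rw [enorm_mul, enorm_pow, enorm_norm, pow_succ _ 2]
        refine mul_le_mul_right ?_ _
        rw [← ofReal_norm, ← ofReal_norm]
        exact ENNReal.ofReal_le_ofReal (PiLp.norm_apply_le ((u.2 0).1 - (u.2 1).1) m)
    _ ≤ C m * ((ENNReal.ofReal ε)⁻¹ *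
          diagonalMean D T ν (fun ξ => ‖(ξ 0).1 - (ξ 1).1‖ₑ ^ 3) ε) := by
        rw [lintegral_const_mul' _ _ (ENNReal.inv_ne_top.2 (by simpa using hε)), mul_left_comm]
        exact mul_le_mul_right (hC m ε hε _ (by fun_prop)) _

/-- A lower limit suffices because the dissipation is already known to converge: the norm of the
limit is its own lower limit, which is at most a constant times the given one. -/
lemma IsStatisticalSolution.energyBalance_eq_zero (hν : IsStatisticalSolution D T ν)
    (hψ : ψ ∈ testFunctions D (Ioo 0 T) 1)
    (h : liminf (fun ε : ℝ => (ENNReal.ofReal ε)⁻¹ *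
      diagonalMean D T ν (fun ξ => ‖(ξ 0).1 - (ξ 1).1‖ₑ ^ 3) ε) (𝓝[>] 0) = 0) :
    energyBalance D T ν ψ = 0 := by
  obtain ⟨ρ, hρ⟩ := exists_isMollifier d
  have hlim := hν.tendsto_sum_jointIntegral_diff hψ hρ
  obtain ⟨C, hC⟩ := hν.exists_sum_jointIntegral_diff_le hψ hρ
  have hl := hlim.enorm.liminf_eq
  have hle : ‖2 * energyBalance D T ν ψ‖ₑ ≤ liminf (fun ε : ℝ => C * ((ENNReal.ofReal ε)⁻¹ *
      diagonalMean D T ν (fun ξ => ‖(ξ 0).1 - (ξ 1).1‖ₑ ^ 3) ε)) (𝓝[>] 0) := by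
    rw [← hl]
    refine liminf_le_liminf ?_
    filter_upwards [self_mem_nhdsWithin] with ε hε using hC ε hε
  rw [ENNReal.liminf_const_mul_of_ne_top ENNReal.coe_ne_top, h, mul_zero] at hle
  simpa using hle

/-! ### The energy balance as a distribution -/

section Distribution

variable {I : Set ℝ} {φ : ℝ × (Fin 1 → Space d) → ℝ}

lemma IsCorrelationMeasure.diagIntegral_fderiv_add (hν : IsCorrelationMeasure D T ν)
    (hψ : ψ ∈ testFunctions D I 1) (hφ : φ ∈ testFunctions D I 1) (v : ℝ × (Fin 1 → Space d))
    {h : Phase d → ℝ} (hh : IsDominatedOne h) :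
    diagIntegral D T ν (fun p => fderiv ℝ (ψ + φ) (point p) v) h
      = diagIntegral D T ν (fun p => fderiv ℝ ψ (point p) v) h
        + diagIntegral D T ν (fun p => fderiv ℝ φ (point p) v) h := by
  unfold diagIntegral
  rw [← integral_add (hν.integrable_diag (isCoefficient_fderiv_of_mem hψ v) hh)
    (hν.integrable_diag (isCoefficient_fderiv_of_mem hφ v) hh)]
  refine integral_congr_ae (Eventually.of_forall fun p => ?_)
  simp only
  rw [fderiv_add (hψ.1.differentiable (by simp) _) (hφ.1.differentiable (by simp) _),
    _root_.add_apply, add_mul]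

lemma diagIntegral_fderiv_smul (hψ : ψ ∈ testFunctions D I 1) (c : ℝ)
    (v : ℝ × (Fin 1 → Space d)) (h : Phase d → ℝ) :
    diagIntegral D T ν (fun p => fderiv ℝ (c • ψ) (point p) v) h
      = c * diagIntegral D T ν (fun p => fderiv ℝ ψ (point p) v) h := by
  unfold diagIntegral
  rw [← integral_const_mul]
  refine integral_congr_ae (Eventually.of_forall fun p => ?_)
  simp only
  rw [fderiv_const_smul (hψ.1.differentiable (by simp) _), _root_.smul_apply, smul_eq_mul,
    mul_assoc]

/-- The energy balance as a linear form. -/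
def energyForm (hν : IsCorrelationMeasure D T ν) : testFunctions (d := d) D I 1 →ₗ[ℝ] ℝ where
  toFun ψ := -energyBalance D T ν ψ.1
  map_add' ψ φ := by
    have h1 : ∀ v h, IsDominatedOne h → diagIntegral D T ν
        (fun p => fderiv ℝ (ψ + φ).1 (point p) v) h = _ := fun v h hh =>
      hν.diagIntegral_fderiv_add ψ.2 φ.2 v hh
    simp only [energyBalance, dt, dx, h1 _ _ isDominatedOne_energyDensity,
      h1 _ _ (isDominatedOne_energyFlux _), Finset.sum_add_distrib]
    ring
  map_smul' c ψ := by
    have h1 : ∀ v h, diagIntegral D T ν (fun p => fderiv ℝ (c • ψ).1 (point p) v) h = _ :=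
      fun v h => diagIntegral_fderiv_smul ψ.2 c v h
    simp only [energyBalance, dt, dx, h1, RingHom.id_apply, smul_eq_mul, ← Finset.mul_sum]
    ring

lemma IsCorrelationMeasure.abs_diagIntegral_fderiv_le (hν : IsCorrelationMeasure D T ν)
    {v : ℝ × (Fin 1 → Space d)} (hv : ‖v‖ ≤ 1) {M : ℝ} (hM : ∀ z, ‖fderiv ℝ ψ z‖ ≤ M)
    {h : Phase d → ℝ} (hh : IsDominatedOne h) :
    |diagIntegral D T ν (fun p => fderiv ℝ ψ (point p) v) h|
      ≤ (∫ p, |∫ ζ, h ζ ∂(onePoint ν p)| ∂(D.spaceTime T)) * M := by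
  rw [← integral_mul_const, ← Real.norm_eq_abs]
  refine norm_integral_le_of_norm_le ((hν.integrable_onePoint hh).abs.mul_const _)
    (Eventually.of_forall fun p => ?_)
  rw [norm_mul, mul_comm, ← Real.norm_eq_abs]
  refine mul_le_mul_of_nonneg_left ?_ (norm_nonneg _)
  refine ((fderiv ℝ ψ (point p)).le_opNorm v).trans ?_
  exact (mul_le_of_le_one_right (norm_nonneg _) hv).trans (hM _)

lemma isDistribution_energyForm (hν : IsCorrelationMeasure D T ν) :
    IsDistribution (energyForm (I := Ioo 0 T) hν) := by
  intro J K _ _ _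
  -- Order one, with a constant that does not depend on `J` and `K`: the energy and its flux are
  -- integrable over the whole of `[0,T] × D`.
  refine ⟨1, (∫ p, |∫ ζ, energyDensity ζ ∂(onePoint ν p)| ∂(D.spaceTime T))
    + ∑ m, ∫ p, |∫ ζ, energyFlux m ζ ∂(onePoint ν p)| ∂(D.spaceTime T), fun ψ _ M hM => ?_⟩
  have h1 : ∀ z, ‖fderiv ℝ ψ.1 z‖ ≤ M := fun z => by
    rw [← norm_iteratedFDeriv_one]
    exact hM 1 le_rfl z
  change |-energyBalance D T ν ψ.1| ≤ _
  rw [abs_neg, energyBalance, add_mul, Finset.sum_mul]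
  refine (abs_add_le _ _).trans (add_le_add ?_ ((Finset.abs_sum_le_sum_abs _ _).trans
    (Finset.sum_le_sum fun m _ => ?_)))
  · exact hν.abs_diagIntegral_fderiv_le (by simp) h1 isDominatedOne_energyDensity
  · exact hν.abs_diagIntegral_fderiv_le (by simp [Prod.norm_def, Pi.norm_single]) h1
      (isDominatedOne_energyFlux m)

lemma IsCorrelationMeasure.integral_box_energy (hν : IsCorrelationMeasure D T ν)
    (hψ : ψ ∈ testFunctions D I 1) :
    ∫ z in D.box T 1, (pairing (ν 1) energy z * dt ψ z
      + ∑ m, pairing (ν 1) (flux m) z * dx 0 m ψ z) = energyBalance D T ν ψ := by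
  have ht := hν.integrable_diag (α := fun p => dt ψ (point p)) (isCoefficient_fderiv_of_mem hψ _)
    isDominatedOne_energyDensity
  have hx := fun m => hν.integrable_diag (α := fun p => dx 0 m ψ (point p))
    (isCoefficient_fderiv_of_mem hψ _) (isDominatedOne_energyFlux m)
  rw [integral_box_one, energyBalance]
  unfold diagIntegral
  rw [← integral_finsetSum _ fun m _ => hx m, ← integral_add ht
    (integrable_finsetSum _ fun m _ => hx m)]
  refine integral_congr_ae (Eventually.of_forall fun p => ?_)
  simp only [integral_onePoint ν p isDominatedOne_energyDensity.1,
    integral_onePoint ν p (isDominatedOne_energyFlux _).1, mul_comm (pairing _ _ _)]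
  rfl

end Distribution

end StatEuler

end

/-! ### The theorem -/

theorem mainTheorem1 (d : ℕ) (D : SpaceDomain) (T : ℝ) (hT : 0 < T) (ν : Hierarchy d)
    (hν : IsStatisticalSolution D T ν) :
    -- all the integrals below exist
    (LocIntegrable T (ν 2) fun ξ => ‖(ξ 0).1 - (ξ 1).1‖ ^ 3) ∧
    LocIntegrable T (ν 1) energy ∧
    (∀ m, LocIntegrable T (ν 1) (flux m)) ∧
    ∃ 𝓔 : testFunctions (d := d) D (Ioo 0 T) 1 →ₗ[ℝ] ℝ,
      IsDistribution 𝓔 ∧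
      -- the limit that defines the dissipation exists and is the same for all mollifiers
      (∀ ρ : Space d → ℝ, IsMollifier ρ → ∀ ψ : testFunctions (d := d) D (Ioo 0 T) 1,
        Tendsto (dissipation D T ν ρ ψ.1) (𝓝[>] 0) (𝓝 (𝓔 ψ))) ∧
      -- the local energy balance in the sense of distributions
      (∀ ψ : testFunctions (d := d) D (Ioo 0 T) 1,
        -(∫ z in D.box T 1, (pairing (ν 1) energy z * dt ψ.1 z
            + ∑ m, pairing (ν 1) (flux m) z * dx 0 m ψ.1 z)) = 𝓔 ψ) ∧
      -- the regularity condition implies that there is no dissipation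
      (liminf (fun ε : ℝ => (ENNReal.ofReal ε)⁻¹ *
          diagonalMean D T ν (fun ξ => ‖(ξ 0).1 - (ξ 1).1‖ₑ ^ 3) ε) (𝓝[>] 0) = 0 →
        𝓔 = 0) := by
  have hc := hν.toIsCorrelationMeasure
  refine ⟨hc.locIntegrable_two isDominatedTwo_diff_cube,
    hc.locIntegrable_one isDominatedOne_energyDensity,
    fun m => hc.locIntegrable_one (isDominatedOne_energyFlux m), energyForm hc,
    isDistribution_energyForm hc, fun ρ hρ ψ => ?_, fun ψ => ?_, fun h => ?_⟩
  · have hlim := (hν.tendsto_sum_jointIntegral_diff ψ.2 hρ).const_mul (-(1 / 2))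
    -- The factor `-1/2` of the dissipation turns the limit into `-energyBalance`, the
    -- distributional left-hand side of the energy equation, whose sign comes from moving the
    -- derivatives to `ψ`.
    rw [show -(1 / 2) * (2 * energyBalance D T ν ψ.1) = energyForm hc ψ by
      change _ = -energyBalance D T ν ψ.1
      ring] at hlim
    refine hlim.congr' ?_
    filter_upwards [self_mem_nhdsWithin] with ε hε
    exact (hc.dissipation_eq ψ.2 hρ hε).symm
  · rw [hc.integral_box_energy ψ.2]
    rfl
  · refine LinearMap.ext fun ψ => ?_
    change -energyBalance D T ν ψ.1 = 0
    rw [hν.energyBalance_eq_zero ψ.2 h, neg_zero]
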